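/- **Setting.** Let $g_\xi:\mathbb R^d\to\mathbb R^p$ and $f_\eta:\mathbb R^p\to\mathbb R$ be differentiable and $r:\mathbb R^d\to\mathbb R$ convex. Consider minimizing $\Phi=F+r$ with $F=f\circ g$, where - $(\Sigma^2)$: $f=\frac1N\sum_{k=1}^N f_k$, $g=\frac1n\sum_{i=1}^n g_i$ with $N,n\ge1$; or - $(\mathbb E^2)$: $f=\mathbb E_\eta f_\eta$, $g=\mathbb E_\xi g_\xi$. Assume that every $f_\eta$ is $l_f$-Lipschitz with $L_f$-Lipschitz gradient, every $g_\xi$ is $l_g$-Lipschitz with Jacobian $g_\xi'$ that is $L_g$-Lipschitz in the Frobenius norm ($l_f,L_f,l_g,L_g>0$), and $\Phi^*=\inf\Phi>-\infty$. For $(\mathbb E^2)$ assume also that there are $\sigma_g,\sigma_{g'},\sigma_{f'}>0$ with $\mathbb E\|g_\xi(x)-g(x)\|^2\le\sigma_g^2$, $\mathbb E\|g'_\xi(x)-g'(x)\|_F^2\le\sigma_{g'}^2$ and $\mathbb E\|\nabla f_\eta(y)-\nabla f(y)\|^2\le\sigma_{f'}^2$ for all $x,y$. Put $L_F=l_g^2L_f+l_fL_g$,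 $\operatorname{prox}_{\lambda r}(x)=\arg\min_y\{r(y)+\frac1{2\lambda}\|y-x\|^2\}$ and $\mathcal G_\lambda(x)=\frac1\lambda\big(x-\operatorname{prox}_{\lambda r}(x-\lambda\nabla F(x))\big)$. **Algorithm MVRC-2** (constant momentum $\alpha$, step sizes $\beta,\lambda_t$, accuracy parameter $\epsilon$, period $\tau$, $T\ge 1$ iterations). Start from $y_0=x_0$. For $t=0,\dots,T-1$, put $z_t=(1-\alpha)y_t+\alpha x_t$ and draw batches $A_t,A_t'$ of indices $\xi$ and $B_t$ of indices $\eta$, where all batches are independent. If $t\bmod\tau=0$, let $\tilde g_t,\tilde g_t',\tilde f_t'$ be the averages of $g_\xi(z_t)$ over $A_t$, of $g'_\xi(z_t)$ over $A'_t$, and of $\nabla f_\eta(\tilde g_t)$ over $B_t$. Otherwise let $\tilde g_t-\tilde g_{t-1}$, $\tilde g_t'-\tilde g_{t-1}'$, $\tilde f_t'-\tilde f_{t-1}'$ be the averages of $g_\xi(z_t)-g_\xi(z_{t-1})$, $g'_\xi(z_t)-g'_\xi(z_{t-1})$, $\nabla f_\eta(\tilde g_t)-\nabla f_\eta(\tilde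 g_{t-1})$ over these batches. Then set $$\tilde x_{t+1}=\operatorname{prox}_{\lambda_tr}\big(x_t-\lambda_t\,\tilde g_t'^{\top}\tilde f_t'\big),\quad \theta_t=\min\Big\{\frac{\epsilon\lambda_t}{\|\tilde x_{t+1}-x_t\|},\frac12\Big\},\quad x_{t+1}=(1-\theta_t)x_t+\theta_t\tilde x_{t+1},\quad y_{t+1}=z_t+\frac{\beta}{\lambda_t}(x_{t+1}-x_t).$$ The output is $z_\zeta$ with $\zeta$ uniform on $\{0,\dots,T-1\}$ and independent of the batches. For $(\mathbb E^2)$ batches are i.i.d. samples of $\xi$, resp. $\eta$. For $(\Sigma^2)$ the batches are the full index sets when $t\bmod\tau=0$, and otherwise are sampled uniformly from $\{1,\dots,n\}$, resp. $\{1,\dots,N\}$ (with replacement, or as uniformly random subsets). **Theorem.** Let $c_1,c_2,b_1,b_2>0$. For each of the two problems there is a constant $C$ depending only on $c_1,c_2,b_1,b_2$ such that the following holds whenever $\alpha\in(0,1]$, $c_1/L_F\le\beta\le c_2/L_F$ and $\lambda_t\in[\beta,(1+\alpha)\beta]$ for all $t$. 1. For $(\Sigma^2)$, let $\tau=\lfloor\sqrt{\max\{N,n\}}\rfloor$,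 and let all batch sizes lie in $[b_1\tau,b_2\tau]$ when $t\bmod\tau\neq0$. Then for every $0<\epsilon<l_fl_g\max\{N,n\}^{-1/2}$ and $T\ge1$, $$\mathbb E\|\mathcal G_{\lambda_\zeta}(z_\zeta)\|\le C\Big(\frac{\epsilon}{\alpha}+\frac{L_F(\Phi(x_0)-\Phi^*)}{\epsilon T}\Big).$$ Moreover, for every such $\epsilon$ there are an accuracy parameter $\epsilon'\in(0,\epsilon]$ and a $T\geq 1$ such that every such run of MVRC-2 with $\epsilon'$ in place of $\epsilon$ satisfies $\mathbb E\|\mathcal G_{\lambda_\zeta}(z_\zeta)\|\le\epsilon$ and uses at most $$C\big(N+n+\sqrt{\max\{N,n\}}\,L_F(\Phi(x_0)-\Phi^*)\,\epsilon^{-2}\big)$$ evaluations of $g_\xi,g_\xi',\nabla f_\eta$, i.e. $\mathcal O(N+n+\sqrt{\max\{N,n\}}\,\epsilon^{-2})$. 2. For $(\mathbb E^2)$, let $0<\epsilon\le l_fl_g$ and $\tau=\lfloor l_fl_g\epsilon^{-1}\rfloor$. Let $|A_t|,|A'_t|,|B_t|$ lie between $b_1$ times and $b_2$ times $\lceil L_f^2l_g^2\sigma_g^2\epsilon^{-2}\rceil$,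 $\lceil l_f^2\sigma_{g'}^2\epsilon^{-2}\rceil$, $\lceil l_g^2\sigma_{f'}^2\epsilon^{-2}\rceil$, respectively, when $t\bmod\tau=0$, and in $[b_1\tau,b_2\tau]$ otherwise. Then for every $T\ge1$ the bound on $\mathbb E\|\mathcal G_{\lambda_\zeta}(z_\zeta)\|$ displayed in item 1 holds. Moreover, for every $0<\epsilon\le l_fl_g$ there are $\epsilon'\in(0,\epsilon]$ and $T\geq 1$ such that every such run with $\epsilon'$ in place of $\epsilon$ (also in $\tau$ and the batch sizes) satisfies $\mathbb E\|\mathcal G_{\lambda_\zeta}(z_\zeta)\|\le\epsilon$ and uses at most $$C\,\big(l_f^2l_g^2+L_f^2l_g^2\sigma_g^2+l_f^2\sigma_{g'}^2+l_g^2\sigma_{f'}^2\big)\Big(l_fl_g+\frac{L_F(\Phi(x_0)-\Phi^*)}{l_fl_g}\Big)\epsilon^{-3}$$ evaluations of $g_\xi,g_\xi',\nabla f_\eta$, i.e. $\mathcal O(\epsilon^{-3})$. -/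

import Mathlib

open MeasureTheory ProbabilityTheory

namespace MVRC

noncomputable section

/-- The Euclidean space `ℝ^d`. -/
abbrev E (d : ℕ) : Type := EuclideanSpace ℝ (Fin d)

/-- Frobenius norm of a Jacobian matrix (given as a linear map). -/
def frob {d p : ℕ} (A : E d →L[ℝ] E p) : ℝ :=
  Real.sqrt (∑ j : Fin d, ‖A (EuclideanSpace.single j 1)‖ ^ 2)

/-- Proximal mapping: a minimizer of `y ↦ r y + ‖y - x‖² / (2 lam)`
(it exists and is unique when `r` is convex and `0 < lam`). -/
def prox {d : ℕ} (lam : ℝ) (r : E d → ℝ) (x : E d) : E d :=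
  Classical.epsilon fun y : E d =>
    ∀ y' : E d, r y + 1 / (2 * lam) * ‖y - x‖ ^ 2 ≤ r y' + 1 / (2 * lam) * ‖y' - x‖ ^ 2

/-- Generalized gradient mapping of `F + r` with parameter `lam`. -/
def gradMap {d : ℕ} (F r : E d → ℝ) (lam : ℝ) (x : E d) : E d :=
  (1 / lam) • (x - prox lam r (x - lam • gradient F x))

/-- Average of a finite family of vectors. -/
def avg {V : Type*} [AddCommGroup V] [Module ℝ V] {m : ℕ} (v : Fin m → V) : V :=
  (1 / (m : ℝ)) • ∑ i, v i

/-! ### The algorithm -/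

/-- Accuracy parameter, period, step sizes and momentum parameters. -/
structure Hyper where
  eps : ℝ
  tau : ℕ
  lam : ℕ → ℝ
  beta : ℕ → ℝ
  alpha : ℕ → ℝ

/-- The samples drawn in one iteration: `A` for `g`, `A'` for the Jacobians, `B` for `∇f`. -/
abbrev Batch (ι κ : Type*) (mA mA' mB : ℕ) : Type _ :=
  (Fin mA → ι) × (Fin mA' → ι) × (Fin mB → κ)

/-- The batch sizes `|A_t|`, `|A_t'|`, `|B_t|`. -/
structure BatchSizes where
  A : ℕ → ℕ
  A' : ℕ → ℕ
  B : ℕ → ℕ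

/-- State at the beginning of iteration `t`: the iterates `x_t`, `y_t`, and the query point and the
three estimates of iteration `t - 1`. -/
structure State (d p : ℕ) where
  x : E d
  y : E d
  zPrev : E d
  gEst : E p
  jEst : E d →L[ℝ] E p
  fEst : E p

/-- Initial state, `y_0 = x_0`. The remaining fields are never read, as iteration `0` resets. -/
def initState {d p : ℕ} (x0 : E d) : State d p := ⟨x0, x0, 0, 0, 0, 0⟩

/-- `z_t = (1 - α_{t+1}) y_t + α_{t+1} x_t`. -/
def query {d p : ℕ} (h : Hyper) (t : ℕ) (s : State d p) : E d :=
  (1 - h.alpha (t + 1)) • s.y + h.alpha (t + 1) • s.x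

/-- Iteration `t` of MVRC-2. If the proximal point equals `x_t`, the value of `theta` is
irrelevant: `x_{t+1} = x_t`. -/
def step {d p : ℕ} {ι κ : Type*} (f : κ → E p → ℝ) (g : ι → E d → E p) (r : E d → ℝ)
    (h : Hyper) (t : ℕ) {mA mA' mB : ℕ} (b : Batch ι κ mA mA' mB) (s : State d p) : State d p :=
  let z : E d := query h t s
  let gEst : E p :=
    if t % h.tau = 0 then avg fun i => g (b.1 i) z
    else s.gEst + avg fun i => g (b.1 i) z - g (b.1 i) s.zPrev
  let jEst : E d →L[ℝ] E p :=
    if t % h.tau = 0 then avg fun i => fderiv ℝ (g (b.2.1 i)) z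
    else s.jEst + avg fun i => fderiv ℝ (g (b.2.1 i)) z - fderiv ℝ (g (b.2.1 i)) s.zPrev
  let fEst : E p :=
    if t % h.tau = 0 then avg fun i => gradient (f (b.2.2 i)) gEst
    else s.fEst + avg fun i => gradient (f (b.2.2 i)) gEst - gradient (f (b.2.2 i)) s.gEst
  let gradEst : E d := ContinuousLinearMap.adjoint jEst fEst
  let xTilde : E d := prox (h.lam t) r (s.x - h.lam t • gradEst)
  let theta : ℝ := min (h.eps * h.lam t / ‖xTilde - s.x‖) (1 / 2)
  let xNext : E d := (1 - theta) • s.x + theta • xTilde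
  { x := xNext
    y := z + (h.beta t / h.lam t) • (xNext - s.x)
    zPrev := z
    gEst := gEst
    jEst := jEst
    fEst := fEst }

/-- State at the beginning of iteration `t`, for a given sequence of samples. -/
def state {d p : ℕ} {ι κ : Type*} (f : κ → E p → ℝ) (g : ι → E d → E p) (r : E d → ℝ)
    (h : Hyper) (x0 : E d) {m : BatchSizes} (b : ∀ t, Batch ι κ (m.A t) (m.A' t) (m.B t)) :
    ℕ → State d p
  | 0 => initState x0
  | t + 1 => step f g r h t (b t) (state f g r h x0 b t)

/-- The iterate `z_t`. -/
def iterZ {d p : ℕ} {ι κ : Type*} (f : κ → E p → ℝ) (g : ι → E d → E p) (r : E d → ℝ)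
    (h : Hyper) (x0 : E d) {m : BatchSizes} (b : ∀ t, Batch ι κ (m.A t) (m.A' t) (m.B t))
    (t : ℕ) : E d :=
  query h t (state f g r h x0 b t)

/-- `‖G_{lam_ζ}(z_ζ)‖` for the output `z_ζ`, as a random variable. -/
def outputNorm {d p : ℕ} {ι κ Ω : Type*} (f : κ → E p → ℝ) (g : ι → E d → E p)
    (F r : E d → ℝ) (h : Hyper) (x0 : E d) {m : BatchSizes}
    (S : ∀ t, Ω → Batch ι κ (m.A t) (m.A' t) (m.B t)) {T : ℕ} (ζ : Ω → Fin T) (ω : Ω) : ℝ :=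
  ‖gradMap F r (h.lam (ζ ω)) (iterZ f g r h x0 (fun t => S t ω) (ζ ω))‖

/-- Number of evaluations of `g_ξ`, `g_ξ'`, `∇f_η` in `T` iterations: one per sample in the
iterations with `t mod tau = 0`, two per sample in the others. -/
def evaluations (tau : ℕ) (m : BatchSizes) (T : ℕ) : ℕ :=
  ∑ t ∈ Finset.range T, (if t % tau = 0 then 1 else 2) * (m.A t + m.A' t + m.B t)

/-! ### Sampling -/

/-- The batches of iterations `0, …, T-1` have the given laws, the three batches of an iteration
and the batches of different iterations are independent, and `ζ` is uniform on `{0, …, T-1}` and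
independent of all the batches. -/
structure IsSampling {Ω : Type*} [MeasurableSpace Ω] (P : Measure Ω)
    {ι κ : Type*} [MeasurableSpace ι] [MeasurableSpace κ] (T : ℕ) (m : BatchSizes)
    (lawA : ∀ t, Measure (Fin (m.A t) → ι)) (lawA' : ∀ t, Measure (Fin (m.A' t) → ι))
    (lawB : ∀ t, Measure (Fin (m.B t) → κ))
    (S : ∀ t, Ω → Batch ι κ (m.A t) (m.A' t) (m.B t)) (ζ : Ω → Fin T) : Prop where
  meas : ∀ t < T, Measurable (S t)
  law : ∀ t < T, P.map (S t) = (lawA t).prod ((lawA' t).prod (lawB t))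
  indep : iIndepFun (fun (t : Fin T) => S t) P
  zeta_meas : Measurable ζ
  zeta_law : P.map ζ = uniformOn Set.univ
  zeta_indep : IndepFun ζ (fun ω (t : Fin T) => S t ω) P

/-- Law of a batch of size `m` from `{1, …, n}`, listed in some order: the whole set (`full`, in
a random order, on which the algorithm does not depend), otherwise `m` independent uniform indices
(`repl = true`) or a uniformly random subset of size `m` (`repl = false`). -/
def finiteLaw (repl full : Bool) (m n : ℕ) : Measure (Fin m → Fin n) :=
  if full then uniformOn {v | Function.Bijective v}
  else if repl then uniformOn Set.univ
  else uniformOn {v | Function.Injective v}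

/-- Samples of MVRC-2 for the finite-sum problem: full batches if `t mod tau = 0`, otherwise
batch sizes between `b₁ tau` and `b₂ tau`. -/
structure IsFiniteSumRun {Ω : Type*} [MeasurableSpace Ω] (P : Measure Ω) (N n : ℕ) (repl : Bool)
    (b₁ b₂ : ℝ) (tau T : ℕ) (m : BatchSizes)
    (S : ∀ t, Ω → Batch (Fin n) (Fin N) (m.A t) (m.A' t) (m.B t)) (ζ : Ω → Fin T) : Prop where
  size_reset : ∀ t < T, t % tau = 0 → m.A t = n ∧ m.A' t = n ∧ m.B t = N
  size_inner : ∀ t < T, t % tau ≠ 0 →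
    (b₁ * tau ≤ m.A t ∧ m.A t ≤ b₂ * tau) ∧ (b₁ * tau ≤ m.A' t ∧ m.A' t ≤ b₂ * tau) ∧
      (b₁ * tau ≤ m.B t ∧ m.B t ≤ b₂ * tau)
  sampling : IsSampling P T m
    (fun t => finiteLaw repl (t % tau = 0) (m.A t) n)
    (fun t => finiteLaw repl (t % tau = 0) (m.A' t) n)
    (fun t => finiteLaw repl (t % tau = 0) (m.B t) N) S ζ

/-- Samples of MVRC-2 for the online problem: independent samples from the laws `μ` of `ξ` and `ν`
of `η`, with batch sizes of order `⌈a⌉`, `⌈a'⌉`, `⌈b⌉` if `t mod tau = 0`, otherwise of order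
`tau`. -/
structure IsOnlineRun {Ω : Type*} [MeasurableSpace Ω] (P : Measure Ω)
    {Ξ H : Type*} [MeasurableSpace Ξ] [MeasurableSpace H] (μ : Measure Ξ) (ν : Measure H)
    (a a' b b₁ b₂ : ℝ) (tau T : ℕ) (m : BatchSizes)
    (S : ∀ t, Ω → Batch Ξ H (m.A t) (m.A' t) (m.B t)) (ζ : Ω → Fin T) : Prop where
  size_reset : ∀ t < T, t % tau = 0 →
    (b₁ * ⌈a⌉₊ ≤ m.A t ∧ m.A t ≤ b₂ * ⌈a⌉₊) ∧ (b₁ * ⌈a'⌉₊ ≤ m.A' t ∧ m.A' t ≤ b₂ * ⌈a'⌉₊) ∧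
      (b₁ * ⌈b⌉₊ ≤ m.B t ∧ m.B t ≤ b₂ * ⌈b⌉₊)
  size_inner : ∀ t < T, t % tau ≠ 0 →
    (b₁ * tau ≤ m.A t ∧ m.A t ≤ b₂ * tau) ∧ (b₁ * tau ≤ m.A' t ∧ m.A' t ≤ b₂ * tau) ∧
      (b₁ * tau ≤ m.B t ∧ m.B t ≤ b₂ * tau)
  sampling : IsSampling P T m (fun _ => Measure.pi fun _ => μ) (fun _ => Measure.pi fun _ => μ)
    (fun _ => Measure.pi fun _ => ν) S ζ

/-! ### The problems and their assumptions -/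

/-- `f(y) = (1/N) ∑ f_k(y)` or `g(x) = (1/n) ∑ g_i(x)`. -/
def finMean {V W : Type*} [AddCommGroup W] [Module ℝ W] {n : ℕ} (u : Fin n → V → W) (x : V) : W :=
  avg fun i => u i x

/-- `f(y) = E f_η(y)` or `g(x) = E g_ξ(x)`. -/
def expMean {Ξ V W : Type*} [MeasurableSpace Ξ] [NormedAddCommGroup W] [NormedSpace ℝ W]
    (μ : Measure Ξ) (u : Ξ → V → W) (x : V) : W :=
  ∫ ξ, u ξ x ∂μ

/-- The objective `Φ = f ∘ g + r`. -/
def objective {d p : ℕ} (fbar : E p → ℝ) (gbar : E d → E p) (r : E d → ℝ) (x : E d) : ℝ :=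
  fbar (gbar x) + r x

/-- `Φ(x₀) - inf Φ`. -/
def gap {d : ℕ} (Φ : E d → ℝ) (x0 : E d) : ℝ := Φ x0 - ⨅ x, Φ x

/-- `L_F = l_g² L_f + l_f L_g`. -/
def LF (lf Lf lg Lg : ℝ) : ℝ := lg ^ 2 * Lf + lf * Lg

/-- Smoothness of the components, convexity of `r`, boundedness below of the objective `Φ`. -/
structure Regular {d p : ℕ} {ι κ : Type*} (f : κ → E p → ℝ) (g : ι → E d → E p)
    (r Φ : E d → ℝ) (lf Lf lg Lg : ℝ) : Prop where
  lf_pos : 0 < lf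
  Lf_pos : 0 < Lf
  lg_pos : 0 < lg
  Lg_pos : 0 < Lg
  f_diff : ∀ k, Differentiable ℝ (f k)
  f_lip : ∀ k y y', |f k y - f k y'| ≤ lf * ‖y - y'‖
  f_grad_lip : ∀ k y y', ‖gradient (f k) y - gradient (f k) y'‖ ≤ Lf * ‖y - y'‖
  g_diff : ∀ i, Differentiable ℝ (g i)
  g_lip : ∀ i x x', ‖g i x - g i x'‖ ≤ lg * ‖x - x'‖
  g_jac_lip : ∀ i x x', frob (fderiv ℝ (g i) x - fderiv ℝ (g i) x') ≤ Lg * ‖x - x'‖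
  r_convex : ConvexOn ℝ Set.univ r
  bddBelow : BddBelow (Set.range Φ)

/-- Well-posedness of the expectations in the online problem and the variance bounds. -/
structure VarianceBounds {d p : ℕ} {Ξ H : Type*} [MeasurableSpace Ξ] [MeasurableSpace H]
    (μ : Measure Ξ) (ν : Measure H) (f : H → E p → ℝ) (g : Ξ → E d → E p)
    (σg σg' σf' : ℝ) : Prop where
  σg_pos : 0 < σg
  σg'_pos : 0 < σg'
  σf'_pos : 0 < σf'
  g_meas : ∀ x, Measurable fun ξ => g ξ x
  f_meas : ∀ y, Measurable fun η => f η y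
  g_int : ∀ x, Integrable (fun ξ => g ξ x) μ
  f_int : ∀ y, Integrable (fun η => f η y) ν
  g_sq_int : ∀ x, Integrable (fun ξ => ‖g ξ x - expMean μ g x‖ ^ 2) μ
  g_var : ∀ x, ∫ ξ, ‖g ξ x - expMean μ g x‖ ^ 2 ∂μ ≤ σg ^ 2
  g_jac_sq_int : ∀ x,
    Integrable (fun ξ => frob (fderiv ℝ (g ξ) x - fderiv ℝ (expMean μ g) x) ^ 2) μ
  g_jac_var : ∀ x, ∫ ξ, frob (fderiv ℝ (g ξ) x - fderiv ℝ (expMean μ g) x) ^ 2 ∂μ ≤ σg' ^ 2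
  f_grad_sq_int : ∀ y,
    Integrable (fun η => ‖gradient (f η) y - gradient (expMean ν f) y‖ ^ 2) ν
  f_grad_var : ∀ y, ∫ η, ‖gradient (f η) y - gradient (expMean ν f) y‖ ^ 2 ∂ν ≤ σf' ^ 2

end

end MVRC

open MVRC

/-! The damped step moves `x_t` by at most `ε λ_t`, whatever the samples are. With `β ≤ λ_t ≤ (1 +
α) β` this forces `‖y_t - x_t‖ ≤ ε β` by induction, hence `‖z_t - x_t‖ ≤ ε β` and `‖z_{t+1} - z_t‖ ≤
2 ε β` surely (`norm_step_y_sub_x_le`, `norm_query_step_sub_le`).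

Since consecutive query points are that close, a recursive update of an estimator adds to its
squared error, in conditional expectation, at most a multiple of `ε² / tau`: the batch has at least
`b₁ tau` nonpositively correlated samples, each bounded by a Lipschitz constant times `2 ε β`
(`IsBatchLaw.lintegral_norm_sq_avg_sub_le_of_bound`). Over a period of `tau` iterations these
increments add up to the order of the error after a reset (`lintegral_err_le`). So the scaled total
error has bounded expectation (`lintegral_errTotal_le`), and `norm_gradEst_sub_le` turns this into
an expected gradient error of order `ε`.

On the deterministic side, the variational inequality of the proximal point and the smoothness of
`F` give a descent inequality: `ε ‖x̃_{t+1} - x_t‖` is at most the decrease of `Φ`, plus `ε λ_t`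
times the gradient error, plus terms of order `ε² β` (`mul_norm_proxPoint_sub_le`). Nonexpansiveness
of the prox bounds the gradient mapping at `z_t` by `‖x̃_{t+1} - x_t‖ / λ_t`, the gradient error and
`O(ε)` (`norm_gradMap_le`). Summing over `t` telescopes `Φ`, and averaging over the independent time
`ζ` gives the rate (`integral_outputNorm_le`).

Both problems are instances of one statement about expectations; a finite sum is the expectation
under the uniform law. For the complexity, the accuracy parameter is a fixed fraction of `ε` and `T`
is of order `1 + L_F (Φ(x₀) - Φ*) / ε²`. The period is chosen so that resets and inner iterations
cost the same order. -/

namespace MVRC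

open Filter Topology

/-! ### The proximal mapping -/

section Prox

variable {d : ℕ} {r : E d → ℝ}

/-- A convex function decreases at most linearly. -/
lemma exists_linear_lower_bound (hr : ConvexOn ℝ Set.univ r) (x : E d) :
    ∃ a b : ℝ, ∀ y, a - b * ‖y - x‖ ≤ r y := by
  have hc : Continuous r := by
    rw [← continuousOn_univ]
    exact hr.continuousOn isOpen_univ
  obtain ⟨M, hM⟩ := ((isCompact_closedBall x 1).image hc).bddBelow
  have hM' : ∀ y, ‖y - x‖ ≤ 1 → M ≤ r y := fun y hy =>
    hM ⟨y, by simpa [dist_eq_norm] using hy, rfl⟩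
  refine ⟨M, |r x - M|, fun y => ?_⟩
  rcases le_total ‖y - x‖ 1 with h | h
  · have := hM' y h
    nlinarith [abs_nonneg (r x - M), norm_nonneg (y - x)]
  · set R := ‖y - x‖ with hR
    have hR0 : 0 < R := by linarith
    have hconv := hr.2 (Set.mem_univ x) (Set.mem_univ y)
      (show 0 ≤ 1 - 1 / R by rw [sub_nonneg, div_le_one hR0]; exact h)
      (show 0 ≤ 1 / R by positivity) (by ring)
    -- The point of the segment from `x` to `y` at distance one from `x` lies in the ball where `M`
    -- is a lower bound.
    have hu : M ≤ r ((1 - 1 / R) • x + (1 / R) • y) := by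
      apply hM'
      have : (1 - 1 / R) • x + (1 / R) • y - x = (1 / R) • (y - x) := by module
      rw [this, norm_smul, ← hR, Real.norm_of_nonneg (by positivity)]
      field_simp
      exact le_rfl
    simp only [smul_eq_mul] at hconv
    have h2 : M * R ≤ (R - 1) * r x + r y := by
      have := mul_le_mul_of_nonneg_right (hu.trans hconv) hR0.le
      have e : ((1 - 1 / R) * r x + 1 / R * r y) * R = (R - 1) * r x + r y := by
        field_simp
      linarith
    nlinarith [le_abs_self (r x - M), neg_abs_le (r x - M), hM' x (by simp)]

/-- The quadratic term beats the linear lower bound of `r`, so the objective is continuous and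
coercive in finite dimension. -/
lemma exists_prox {lam : ℝ} (hlam : 0 < lam) (hr : ConvexOn ℝ Set.univ r) (x : E d) :
    ∃ y : E d, ∀ y' : E d,
      r y + 1 / (2 * lam) * ‖y - x‖ ^ 2 ≤ r y' + 1 / (2 * lam) * ‖y' - x‖ ^ 2 := by
  have hc : Continuous r := by
    rw [← continuousOn_univ]
    exact hr.continuousOn isOpen_univ
  obtain ⟨a, b, hab⟩ := exists_linear_lower_bound hr x
  have hcont : Continuous fun y => r y + 1 / (2 * lam) * ‖y - x‖ ^ 2 := by fun_prop
  refine hcont.exists_forall_le ?_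
  have h1 : Tendsto (fun y : E d => ‖y - x‖) (cocompact _) atTop := by
    have := tendsto_norm_cocompact_atTop (E := E d)
    have h2 : Tendsto (fun y : E d => y - x) (cocompact _) (cocompact _) :=
      (Homeomorph.subRight x).isClosedEmbedding.tendsto_cocompact
    exact this.comp h2
  have h2 : Tendsto (fun s : ℝ => a + s * (-b + 1 / (2 * lam) * s)) atTop atTop := by
    apply tendsto_atTop_add_const_left
    apply tendsto_id.atTop_mul_atTop₀
    apply tendsto_atTop_add_const_left
    exact tendsto_id.const_mul_atTop (by positivity)
  refine tendsto_atTop_mono (fun y => ?_) (h2.comp h1)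
  have := hab y
  simp only [Function.comp]
  nlinarith

lemma prox_spec {lam : ℝ} (hlam : 0 < lam) (hr : ConvexOn ℝ Set.univ r) (x y' : E d) :
    r (prox lam r x) + 1 / (2 * lam) * ‖prox lam r x - x‖ ^ 2
      ≤ r y' + 1 / (2 * lam) * ‖y' - x‖ ^ 2 :=
  Classical.epsilon_spec (exists_prox hlam hr x) y'

/-- Variational inequality characterizing the proximal point. -/
lemma prox_variational {lam : ℝ} (hlam : 0 < lam) (hr : ConvexOn ℝ Set.univ r) (w y : E d) :
    r (prox lam r w) + 1 / lam * inner ℝ (w - prox lam r w) (y - prox lam r w) ≤ r y := by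
  set q := prox lam r w with hq
  -- Compare `q` with the point `(1 - s) q + s y`, use convexity of `r`, and divide by `s`; the
  -- excess is of order `s` and vanishes as `s → 0`.
  have key : ∀ s : ℝ, 0 < s → s ≤ 1 →
      r q + 1 / lam * inner ℝ (w - q) (y - q) ≤ r y + s * (1 / (2 * lam) * ‖y - q‖ ^ 2) := by
    intro s hs hs1
    have h1 := prox_spec hlam hr w ((1 - s) • q + s • y)
    rw [← hq] at h1
    have h2 := hr.2 (Set.mem_univ q) (Set.mem_univ y)
      (show 0 ≤ 1 - s by linarith) hs.le (by ring)
    simp only [smul_eq_mul] at h2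
    have e : (1 - s) • q + s • y - w = s • (y - q) - (w - q) := by module
    have e3 : ‖q - w‖ = ‖w - q‖ := norm_sub_rev _ _
    rw [e, e3, norm_sub_sq_real (s • (y - q)) (w - q), norm_smul, real_inner_smul_left,
      Real.norm_of_nonneg hs.le, real_inner_comm (w - q) (y - q)] at h1
    have h3 : s * (r q + 1 / lam * inner ℝ (w - q) (y - q))
        ≤ s * (r y + s * (1 / (2 * lam) * ‖y - q‖ ^ 2)) := by
      have e2 : 1 / lam = 2 * (1 / (2 * lam)) := by field_simp
      rw [e2]
      nlinarith
    exact le_of_mul_le_mul_left h3 hs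
  have hlim : Tendsto (fun s : ℝ => r y + s * (1 / (2 * lam) * ‖y - q‖ ^ 2)) (𝓝[>] 0)
      (𝓝 (r y + 0 * (1 / (2 * lam) * ‖y - q‖ ^ 2))) := by
    apply Tendsto.mono_left _ nhdsWithin_le_nhds
    exact Continuous.tendsto (by fun_prop) 0
  rw [zero_mul, add_zero] at hlim
  refine ge_of_tendsto hlim ?_
  filter_upwards [Ioc_mem_nhdsGT (zero_lt_one (α := ℝ))] with s hs
  exact key s hs.1 hs.2

/-- Adding the two variational inequalities, each tested at the other proximal point, gives `‖q -
q'‖² ≤ ⟪w - w', q - q'⟫`; Cauchy–Schwarz concludes. -/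
lemma prox_nonexpansive {lam : ℝ} (hlam : 0 < lam) (hr : ConvexOn ℝ Set.univ r) (w w' : E d) :
    ‖prox lam r w - prox lam r w'‖ ≤ ‖w - w'‖ := by
  have h1 := prox_variational hlam hr w (prox lam r w')
  have h2 := prox_variational hlam hr w' (prox lam r w)
  set q := prox lam r w
  set q' := prox lam r w'
  have h3 : 1 / lam * (inner ℝ (w - q) (q' - q) + inner ℝ (w' - q') (q - q')) ≤ 1 / lam * 0 := by
    linarith
  have h4 := le_of_mul_le_mul_left h3 (by positivity)
  have e : inner ℝ (w - q) (q' - q) + inner ℝ (w' - q') (q - q')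
      = ‖q - q'‖ ^ 2 - inner ℝ (w - w') (q - q') := by
    rw [← real_inner_self_eq_norm_sq]
    simp only [inner_sub_left, inner_sub_right]
    ring
  have h5 := real_inner_le_norm (w - w') (q - q')
  by_contra! hlt
  nlinarith [norm_nonneg (w - w'), norm_nonneg (q - q')]

lemma continuous_prox {lam : ℝ} (hlam : 0 < lam) (hr : ConvexOn ℝ Set.univ r) :
    Continuous (prox lam r) := by
  refine (LipschitzWith.of_dist_le_mul (K := 1) fun w w' => ?_).continuous
  simpa [dist_eq_norm] using prox_nonexpansive hlam hr w w'

end Prox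

/-! ### The Frobenius norm -/

section Frobenius

/-- The columns of a linear map, in the Hilbert space whose norm is the Frobenius norm. -/
noncomputable def cols (d p : ℕ) : (E d →L[ℝ] E p) →L[ℝ] PiLp 2 (fun _ : Fin d => E p) :=
  (PiLp.continuousLinearEquiv 2 ℝ (fun _ : Fin d => E p)).symm.toContinuousLinearMap.comp
    (ContinuousLinearMap.pi fun j =>
      ContinuousLinearMap.apply ℝ (E p) (EuclideanSpace.single j (1 : ℝ)))

lemma norm_cols {d p : ℕ} (A : E d →L[ℝ] E p) : ‖cols d p A‖ = frob A := by
  rw [PiLp.norm_eq_of_L2]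
  rfl

lemma sum_smul_single {d : ℕ} (x : E d) : x = ∑ j, x j • EuclideanSpace.single j (1 : ℝ) := by
  ext i
  simp [Finset.sum_apply, Pi.single_apply]

/-- Cauchy–Schwarz on the columns. Variances of Jacobians need the Hilbertian Frobenius norm, while
the gradient estimates use the operator norm. -/
lemma opNorm_le_frob {d p : ℕ} (A : E d →L[ℝ] E p) : ‖A‖ ≤ frob A := by
  refine A.opNorm_le_bound (Real.sqrt_nonneg _) fun x => ?_
  calc ‖A x‖ = ‖∑ j, x j • A (EuclideanSpace.single j 1)‖ := by
        conv_lhs => rw [sum_smul_single x]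
        simp
    _ ≤ ∑ j, ‖A (EuclideanSpace.single j 1)‖ * ‖x j‖ := by
        refine (norm_sum_le _ _).trans (Finset.sum_le_sum fun j _ => ?_)
        rw [norm_smul, mul_comm]
    _ ≤ frob A * ‖x‖ := by
        rw [EuclideanSpace.norm_eq]
        exact Real.sum_mul_le_sqrt_mul_sqrt _ _ _

end Frobenius

/-! ### Expectations of smooth functions -/

section Mean

variable {ι W : Type*} [MeasurableSpace ι] {μ : Measure ι} {d : ℕ}
  [NormedAddCommGroup W] [NormedSpace ℝ W]

lemma clm_eq_sum (A : E d →L[ℝ] W) :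
    A = ∑ j, ContinuousLinearMap.smulRight (EuclideanSpace.proj j : E d →L[ℝ] ℝ)
      (A (EuclideanSpace.single j 1)) := by
  ext x
  conv_lhs => rw [sum_smul_single x]
  simp

variable [MeasurableSpace W] [BorelSpace W] [SecondCountableTopology W]

/-- Each directional derivative is a pointwise limit of the measurable difference quotients with
step `1 / n`, and the derivative is a finite combination of its columns. -/
lemma measurable_fderiv_index {u : ι → E d → W} (hm : ∀ x, Measurable fun i => u i x)
    (hd : ∀ i, Differentiable ℝ (u i)) (x : E d) :
    Measurable fun i => fderiv ℝ (u i) x := by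
  have h1 : ∀ v : E d, Measurable fun i => fderiv ℝ (u i) x v := by
    intro v
    refine measurable_of_tendsto_metrizable
      (f := fun (n : ℕ) i => (n : ℝ) • (u i (x + (n : ℝ)⁻¹ • v) - u i x))
      (fun n => ((hm _).sub (hm _)).const_smul _) ?_
    rw [tendsto_pi_nhds]
    intro i
    exact ((hd i x).hasFDerivAt.lim_real v).comp tendsto_natCast_atTop_atTop
  have h2 : (fun i => fderiv ℝ (u i) x) = fun i => ∑ j, ContinuousLinearMap.smulRightL ℝ (E d) W
      (EuclideanSpace.proj j : E d →L[ℝ] ℝ) (fderiv ℝ (u i) x (EuclideanSpace.single j 1)) := by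
    funext i
    exact clm_eq_sum _
  rw [h2]
  refine Finset.measurable_sum _ fun j _ => ?_
  exact (ContinuousLinearMap.continuous _).measurable.comp (h1 _)

omit [MeasurableSpace W] [BorelSpace W] [SecondCountableTopology W] in
lemma norm_fderiv_le_of_lip {u : E d → W} {K : ℝ} (hK : 0 ≤ K)
    (hl : ∀ x x', ‖u x - u x'‖ ≤ K * ‖x - x'‖) (x : E d) : ‖fderiv ℝ u x‖ ≤ K := by
  have : LipschitzWith ⟨K, hK⟩ u := LipschitzWith.of_dist_le_mul fun x y => by
    rw [dist_eq_norm, dist_eq_norm]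
    exact hl x y
  exact norm_fderiv_le_of_lipschitz ℝ this

lemma integrable_fderiv_index [IsProbabilityMeasure μ] {u : ι → E d → W} {K : ℝ} (hK : 0 ≤ K)
    (hm : ∀ x, Measurable fun i => u i x) (hd : ∀ i, Differentiable ℝ (u i))
    (hl : ∀ i x x', ‖u i x - u i x'‖ ≤ K * ‖x - x'‖) (x : E d) :
    Integrable (fun i => fderiv ℝ (u i) x) μ :=
  Integrable.of_bound (measurable_fderiv_index hm hd x).aestronglyMeasurable K
    (ae_of_all _ fun i => norm_fderiv_le_of_lip hK (hl i) x)

/-- Differentiation under the integral sign: the common Lipschitz constant `K` dominates all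
difference quotients. -/
lemma hasFDerivAt_expMean [IsProbabilityMeasure μ] {u : ι → E d → W} {K : ℝ}
    (hm : ∀ x, Measurable fun i => u i x) (hint : ∀ x, Integrable (fun i => u i x) μ)
    (hd : ∀ i, Differentiable ℝ (u i)) (hl : ∀ i x x', ‖u i x - u i x'‖ ≤ K * ‖x - x'‖)
    (x : E d) : HasFDerivAt (expMean μ u) (∫ i, fderiv ℝ (u i) x ∂μ) x :=
  (hasFDerivAt_integral_of_dominated_loc_of_lip' (s := Set.univ) (bound := fun _ => K)
    univ_mem (fun x _ => (hm x).aestronglyMeasurable) (hint x)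
    (measurable_fderiv_index hm hd x).aestronglyMeasurable
    (ae_of_all _ fun i y _ => hl i y x) (integrable_const _)
    (ae_of_all _ fun i => (hd i x).hasFDerivAt)).2

omit [MeasurableSpace W] [BorelSpace W] [SecondCountableTopology W] in
lemma norm_expMean_sub_le [IsProbabilityMeasure μ] {u : ι → E d → W} {K : ℝ}
    (hint : ∀ x, Integrable (fun i => u i x) μ)
    (hl : ∀ i x x', ‖u i x - u i x'‖ ≤ K * ‖x - x'‖) (x x' : E d) :
    ‖expMean μ u x - expMean μ u x'‖ ≤ K * ‖x - x'‖ := by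
  rw [expMean, expMean, ← integral_sub (hint _) (hint _)]
  simpa using norm_integral_le_of_norm_le_const (μ := μ) (C := K * ‖x - x'‖)
    (ae_of_all _ fun i => hl i x x')

end Mean

lemma integral_gradient {ι : Type*} [MeasurableSpace ι] {μ : Measure ι} {d : ℕ}
    [IsProbabilityMeasure μ] {u : ι → E d → ℝ} {K : ℝ}
    (hm : ∀ x, Measurable fun i => u i x) (hint : ∀ x, Integrable (fun i => u i x) μ)
    (hd : ∀ i, Differentiable ℝ (u i)) (hl : ∀ i x x', |u i x - u i x'| ≤ K * ‖x - x'‖)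
    (x : E d) : gradient (expMean μ u) x = ∫ i, gradient (u i) x ∂μ := by
  simp only [gradient]
  rw [(hasFDerivAt_expMean hm hint hd hl x).fderiv]
  exact ((InnerProductSpace.toDual ℝ (E d)).symm.toContinuousLinearEquiv.integral_comp_comm
    (fun i => fderiv ℝ (u i) x)).symm

lemma measurable_gradient_index {ι : Type*} [MeasurableSpace ι] {d : ℕ} {u : ι → E d → ℝ}
    (hm : ∀ x, Measurable fun i => u i x) (hd : ∀ i, Differentiable ℝ (u i)) (x : E d) :
    Measurable fun i => gradient (u i) x :=
  (InnerProductSpace.toDual ℝ (E d)).symm.continuous.measurable.comp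
    (measurable_fderiv_index hm hd x)

lemma norm_gradient_le_of_lip {d : ℕ} {u : E d → ℝ} {K : ℝ} (hK : 0 ≤ K)
    (hl : ∀ x x', |u x - u x'| ≤ K * ‖x - x'‖) (x : E d) : ‖gradient u x‖ ≤ K := by
  simp only [gradient, LinearIsometryEquiv.norm_map]
  exact norm_fderiv_le_of_lip hK hl x

/-! ### Smoothness of the composite function `F = f ∘ g`. -/

/-- Smoothness of the outer function and the inner map of a composition. -/
structure SmoothPair {d p : ℕ} (f : E p → ℝ) (g : E d → E p) (lf Lf lg Lg : ℝ) : Prop where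
  lf_pos : 0 < lf
  Lf_pos : 0 < Lf
  lg_pos : 0 < lg
  Lg_pos : 0 < Lg
  f_diff : Differentiable ℝ f
  g_diff : Differentiable ℝ g
  norm_gradient_le : ∀ y, ‖gradient f y‖ ≤ lf
  norm_gradient_sub_le : ∀ y y', ‖gradient f y - gradient f y'‖ ≤ Lf * ‖y - y'‖
  norm_fderiv_le : ∀ x, ‖fderiv ℝ g x‖ ≤ lg
  norm_sub_le : ∀ x x', ‖g x - g x'‖ ≤ lg * ‖x - x'‖
  norm_fderiv_sub_le : ∀ x x', ‖fderiv ℝ g x - fderiv ℝ g x'‖ ≤ Lg * ‖x - x'‖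

lemma norm_adjoint_apply_le {d p : ℕ} (A : E d →L[ℝ] E p) (v : E p) :
    ‖ContinuousLinearMap.adjoint A v‖ ≤ ‖A‖ * ‖v‖ := by
  simpa using (ContinuousLinearMap.adjoint A).le_opNorm v

/-- A product rule for the bilinear map `(A, v) ↦ A* v`. It serves both the Lipschitz bound of `∇F`
and the error of the gradient estimate. -/
lemma norm_adjoint_sub_le {d p : ℕ} (A B : E d →L[ℝ] E p) (v w : E p) :
    ‖ContinuousLinearMap.adjoint A v - ContinuousLinearMap.adjoint B w‖
      ≤ ‖A - B‖ * ‖v‖ + ‖B‖ * ‖v - w‖ := by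
  have e : ContinuousLinearMap.adjoint A v - ContinuousLinearMap.adjoint B w
      = ContinuousLinearMap.adjoint (A - B) v + ContinuousLinearMap.adjoint B (v - w) := by
    simp
  rw [e]
  exact (norm_add_le _ _).trans
    (add_le_add (norm_adjoint_apply_le _ _) (norm_adjoint_apply_le _ _))

namespace SmoothPair

variable {d p : ℕ} {f : E p → ℝ} {g : E d → E p} {lf Lf lg Lg : ℝ}

lemma LF_pos (h : SmoothPair f g lf Lf lg Lg) : 0 < LF lf Lf lg Lg := by
  have := h.lf_pos; have := h.Lf_pos; have := h.lg_pos; have := h.Lg_pos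
  unfold LF; positivity

lemma hasGradientAt_comp (h : SmoothPair f g lf Lf lg Lg) (x : E d) :
    HasGradientAt (fun x => f (g x))
      (ContinuousLinearMap.adjoint (fderiv ℝ g x) (gradient f (g x))) x := by
  rw [hasGradientAt_iff_hasFDerivAt]
  have h1 := ((h.f_diff (g x)).hasGradientAt.hasFDerivAt).comp x (h.g_diff x).hasFDerivAt
  have e : InnerProductSpace.toDual ℝ (E d)
      (ContinuousLinearMap.adjoint (fderiv ℝ g x) (gradient f (g x)))
      = (InnerProductSpace.toDual ℝ (E p) (gradient f (g x))).comp (fderiv ℝ g x) := by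
    ext v
    simp only [ContinuousLinearMap.comp_apply, InnerProductSpace.toDual_apply_apply,
      ContinuousLinearMap.adjoint_inner_left]
  rw [e]
  exact h1

lemma gradient_comp (h : SmoothPair f g lf Lf lg Lg) (x : E d) :
    gradient (fun x => f (g x)) x
      = ContinuousLinearMap.adjoint (fderiv ℝ g x) (gradient f (g x)) :=
  (h.hasGradientAt_comp x).gradient

/-- Varying the Jacobian costs `Lg * lf`, and varying the outer gradient through `g` costs `lg * (Lf
* lg)`; the sum is `LF`. -/
lemma norm_gradient_comp_sub_le (h : SmoothPair f g lf Lf lg Lg) (x x' : E d) :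
    ‖gradient (fun x => f (g x)) x - gradient (fun x => f (g x)) x'‖
      ≤ LF lf Lf lg Lg * ‖x - x'‖ := by
  rw [h.gradient_comp, h.gradient_comp]
  refine (norm_adjoint_sub_le _ _ _ _).trans ?_
  have h1 : ‖fderiv ℝ g x - fderiv ℝ g x'‖ * ‖gradient f (g x)‖ ≤ Lg * ‖x - x'‖ * lf :=
    mul_le_mul (h.norm_fderiv_sub_le _ _) (h.norm_gradient_le _) (norm_nonneg _)
      (mul_nonneg h.Lg_pos.le (norm_nonneg _))
  have h2 : ‖gradient f (g x) - gradient f (g x')‖ ≤ Lf * (lg * ‖x - x'‖) :=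
    (h.norm_gradient_sub_le _ _).trans (mul_le_mul_of_nonneg_left (h.norm_sub_le _ _) h.Lf_pos.le)
  have h3 := mul_le_mul (h.norm_fderiv_le x') h2 (norm_nonneg _) h.lg_pos.le
  unfold LF
  linarith

/-- Mean value inequality on the ball of radius `‖y - x‖`, where the gradient differs from its value
at `x` by at most `LF * ‖y - x‖`. The sharper factor `1 / 2` is not needed. -/
lemma comp_le_linear (h : SmoothPair f g lf Lf lg Lg) (x y : E d) :
    f (g y) ≤ f (g x) + inner ℝ (gradient (fun x => f (g x)) x) (y - x)
      + LF lf Lf lg Lg * ‖y - x‖ ^ 2 := by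
  have h1 := (convex_closedBall x ‖y - x‖).norm_image_sub_le_of_norm_hasFDerivWithin_le'
    (f := fun x => f (g x)) (φ := InnerProductSpace.toDual ℝ (E d) (gradient (fun x => f (g x)) x))
    (C := LF lf Lf lg Lg * ‖y - x‖) (x := x) (y := y)
    (f' := fun z => InnerProductSpace.toDual ℝ (E d) (gradient (fun x => f (g x)) z))
    (fun z _ => (by
      rw [h.gradient_comp]
      exact (h.hasGradientAt_comp z).hasFDerivAt.hasFDerivWithinAt)) (fun z hz => by
      rw [← map_sub, LinearIsometryEquiv.norm_map]
      refine (h.norm_gradient_comp_sub_le z x).trans ?_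
      refine mul_le_mul_of_nonneg_left ?_ h.LF_pos.le
      simpa [dist_eq_norm] using hz)
    (by simp) (by simp [dist_eq_norm])
  rw [Real.norm_eq_abs, InnerProductSpace.toDual_apply_apply] at h1
  have := le_abs_self (f (g y) - f (g x) - inner ℝ (gradient (fun x => f (g x)) x) (y - x))
  nlinarith

end SmoothPair

/-- Once derivative and expectation are exchanged, each Lipschitz bound of the components passes to
the mean by the triangle inequality for integrals. -/
lemma Regular.smoothPair {d p : ℕ} {ι κ : Type*} [MeasurableSpace ι] [MeasurableSpace κ]
    {μ : Measure ι} {ν : Measure κ} [IsProbabilityMeasure μ] [IsProbabilityMeasure ν]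
    {f : κ → E p → ℝ} {g : ι → E d → E p} {r Φ : E d → ℝ} {lf Lf lg Lg : ℝ}
    (h : Regular f g r Φ lf Lf lg Lg)
    (g_meas : ∀ x, Measurable fun i => g i x) (f_meas : ∀ y, Measurable fun k => f k y)
    (g_int : ∀ x, Integrable (fun i => g i x) μ) (f_int : ∀ y, Integrable (fun k => f k y) ν) :
    SmoothPair (expMean ν f) (expMean μ g) lf Lf lg Lg where
  lf_pos := h.lf_pos
  Lf_pos := h.Lf_pos
  lg_pos := h.lg_pos
  Lg_pos := h.Lg_pos
  f_diff y := (hasFDerivAt_expMean f_meas f_int h.f_diff h.f_lip y).differentiableAt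
  g_diff x := (hasFDerivAt_expMean g_meas g_int h.g_diff h.g_lip x).differentiableAt
  norm_gradient_le :=
    norm_gradient_le_of_lip h.lf_pos.le (norm_expMean_sub_le f_int h.f_lip)
  norm_gradient_sub_le y y' := by
    have hi : ∀ y, Integrable (fun k => gradient (f k) y) ν := fun y =>
      Integrable.of_bound (measurable_gradient_index f_meas h.f_diff y).aestronglyMeasurable lf
        (ae_of_all _ fun k => norm_gradient_le_of_lip h.lf_pos.le (h.f_lip k) y)
    rw [integral_gradient f_meas f_int h.f_diff h.f_lip,
      integral_gradient f_meas f_int h.f_diff h.f_lip, ← integral_sub (hi _) (hi _)]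
    simpa using norm_integral_le_of_norm_le_const (μ := ν)
      (ae_of_all _ fun k => h.f_grad_lip k y y')
  norm_fderiv_le := norm_fderiv_le_of_lip h.lg_pos.le (norm_expMean_sub_le g_int h.g_lip)
  norm_sub_le := norm_expMean_sub_le g_int h.g_lip
  norm_fderiv_sub_le x x' := by
    have hi := integrable_fderiv_index (μ := μ) h.lg_pos.le g_meas h.g_diff h.g_lip
    rw [(hasFDerivAt_expMean g_meas g_int h.g_diff h.g_lip x).fderiv,
      (hasFDerivAt_expMean g_meas g_int h.g_diff h.g_lip x').fderiv, ← integral_sub (hi _) (hi _)]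
    simpa using norm_integral_le_of_norm_le_const (μ := μ)
      (ae_of_all _ fun i => (opNorm_le_frob _).trans (h.g_jac_lip i x x'))

lemma norm_avg_le {V : Type*} [NormedAddCommGroup V] [NormedSpace ℝ V] {m : ℕ} {v : Fin m → V}
    {K : ℝ} (hK : 0 ≤ K) (hv : ∀ i, ‖v i‖ ≤ K) : ‖avg v‖ ≤ K := by
  have h1 : ‖∑ i, v i‖ ≤ m * K := by
    simpa using norm_sum_le_of_le Finset.univ fun i _ => hv i
  rw [avg, norm_smul, Real.norm_of_nonneg (by positivity)]
  rcases Nat.eq_zero_or_pos m with rfl | hm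
  · simpa using hK
  · have : (0 : ℝ) < m := by exact_mod_cast hm
    rw [one_div, inv_mul_le_iff₀ this]
    exact h1

/-- Admissible constant momentum and step sizes. -/
structure Admissible (h : Hyper) (α β : ℝ) : Prop where
  eps_pos : 0 < h.eps
  alpha_pos : 0 < α
  alpha_le : α ≤ 1
  beta_pos : 0 < β
  alpha_eq : ∀ t, h.alpha t = α
  beta_eq : ∀ t, h.beta t = β
  le_lam : ∀ t, β ≤ h.lam t
  lam_le : ∀ t, h.lam t ≤ (1 + α) * β

namespace Admissible

variable {h : Hyper} {α β : ℝ}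

lemma lam_pos (ha : Admissible h α β) (t : ℕ) : 0 < h.lam t := ha.beta_pos.trans_le (ha.le_lam t)

lemma lam_le_two_mul (ha : Admissible h α β) (t : ℕ) : h.lam t ≤ 2 * β :=
  (ha.lam_le t).trans (by nlinarith [ha.alpha_le, ha.beta_pos])

end Admissible

/-! ### One iteration: sure distance bounds and descent of the objective. -/

section Iteration

variable {d p : ℕ} {ι κ : Type*} (f : κ → E p → ℝ) (g : ι → E d → E p) (r : E d → ℝ)
  (h : Hyper) (t : ℕ) {mA mA' mB : ℕ} (b : Batch ι κ mA mA' mB) (s : State d p)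

/-- The estimate of the gradient of `F` stored in a state. -/
noncomputable def State.gradEst {d p : ℕ} (s : State d p) : E d :=
  ContinuousLinearMap.adjoint s.jEst s.fEst

/-- The proximal point computed from `x` and a gradient estimate `v`. -/
noncomputable def proxPoint {d : ℕ} (r : E d → ℝ) (lam : ℝ) (x v : E d) : E d :=
  prox lam r (x - lam • v)

/-- The damping factor of the normalized step. -/
noncomputable def damping (a D : ℝ) : ℝ := min (a / D) (1 / 2)

lemma damping_le_half (a D : ℝ) : damping a D ≤ 1 / 2 := min_le_right _ _

lemma damping_nonneg {a D : ℝ} (ha : 0 ≤ a) (hD : 0 ≤ D) : 0 ≤ damping a D :=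
  le_min (by positivity) (by norm_num)

lemma damping_mul_le {a D : ℝ} (ha : 0 ≤ a) (hD : 0 ≤ D) : damping a D * D ≤ a := by
  rcases hD.eq_or_lt with rfl | hD
  · simpa using ha
  · calc damping a D * D ≤ a / D * D := mul_le_mul_of_nonneg_right (min_le_left _ _) hD.le
      _ = a := div_mul_cancel₀ _ hD.ne'

/-- If the step is normalized, `θ D²` equals `a D`; if the cap `1 / 2` is active, the claim is `(a -
D)² ≥ 0`. This makes the descent linear in `D` in both cases. -/
lemma le_damping_mul_sq {a D : ℝ} (hD : 0 ≤ D) :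
    a * D - a ^ 2 / 2 ≤ damping a D * D ^ 2 := by
  unfold damping
  rcases le_total (a / D) (1 / 2) with h1 | h1
  · rw [min_eq_left h1]
    rcases hD.eq_or_lt with rfl | hD
    · simp; positivity
    · have : a / D * D ^ 2 = a * D := by field_simp
      nlinarith [sq_nonneg a]
  · rw [min_eq_right h1]
    nlinarith [sq_nonneg (a - D)]

lemma step_zPrev : (step f g r h t b s).zPrev = query h t s := rfl

lemma step_gEst : (step f g r h t b s).gEst =
    if t % h.tau = 0 then avg fun i => g (b.1 i) (query h t s)
    else s.gEst + avg fun i => g (b.1 i) (query h t s) - g (b.1 i) s.zPrev := rfl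

lemma step_jEst : (step f g r h t b s).jEst =
    if t % h.tau = 0 then avg fun i => fderiv ℝ (g (b.2.1 i)) (query h t s)
    else s.jEst + avg fun i =>
      fderiv ℝ (g (b.2.1 i)) (query h t s) - fderiv ℝ (g (b.2.1 i)) s.zPrev := rfl

lemma step_fEst : (step f g r h t b s).fEst =
    if t % h.tau = 0 then avg fun i => gradient (f (b.2.2 i)) (step f g r h t b s).gEst
    else s.fEst + avg fun i => gradient (f (b.2.2 i)) (step f g r h t b s).gEst
      - gradient (f (b.2.2 i)) s.gEst := rfl

lemma step_x : (step f g r h t b s).x =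
    (1 - damping (h.eps * h.lam t)
        ‖proxPoint r (h.lam t) s.x (step f g r h t b s).gradEst - s.x‖) • s.x +
      damping (h.eps * h.lam t)
        ‖proxPoint r (h.lam t) s.x (step f g r h t b s).gradEst - s.x‖ •
      proxPoint r (h.lam t) s.x (step f g r h t b s).gradEst := rfl

lemma step_y : (step f g r h t b s).y =
    query h t s + (h.beta t / h.lam t) • ((step f g r h t b s).x - s.x) := rfl

variable {f g r h t b s} {α β : ℝ}

/-- The purpose of the damping: the move is bounded for every sample, not only in expectation. -/
lemma norm_step_x_sub_le (ha : Admissible h α β) :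
    ‖(step f g r h t b s).x - s.x‖ ≤ h.eps * h.lam t := by
  have h0 : 0 ≤ h.eps * h.lam t := (mul_pos ha.eps_pos (ha.lam_pos t)).le
  rw [step_x]
  set q := proxPoint r (h.lam t) s.x (step f g r h t b s).gradEst
  set θ := damping (h.eps * h.lam t) ‖q - s.x‖ with hθ
  have e : (1 - θ) • s.x + θ • q - s.x = θ • (q - s.x) := by module
  rw [e, norm_smul, Real.norm_of_nonneg (damping_nonneg h0 (norm_nonneg _))]
  exact damping_mul_le h0 (norm_nonneg _)

lemma query_sub_x (ha : Admissible h α β) : query h t s - s.x = (1 - α) • (s.y - s.x) := by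
  rw [query, ha.alpha_eq]
  module

lemma norm_query_sub_x_le (ha : Admissible h α β) (hs : ‖s.y - s.x‖ ≤ h.eps * β) :
    ‖query h t s - s.x‖ ≤ h.eps * β := by
  rw [query_sub_x ha, norm_smul, Real.norm_of_nonneg (by linarith [ha.alpha_le])]
  nlinarith [norm_nonneg (s.y - s.x), ha.alpha_pos]

/-- Here `y' - x' = (1 - α) (y - x) - (1 - β / λ) (x' - x)`, and the second term has norm at most `ε
(λ - β) ≤ α ε β`. The upper limit `(1 + α) β` for the step size is exactly what makes the bound
reproduce itself. -/
lemma norm_step_y_sub_x_le (ha : Admissible h α β) (hs : ‖s.y - s.x‖ ≤ h.eps * β) :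
    ‖(step f g r h t b s).y - (step f g r h t b s).x‖ ≤ h.eps * β := by
  have hm := norm_step_x_sub_le (f := f) (g := g) (r := r) (b := b) (s := s) (t := t) ha
  have hl := ha.lam_pos t
  rw [step_y, ha.beta_eq]
  set x' := (step f g r h t b s).x
  have hq := query_sub_x (t := t) (s := s) ha
  have e : query h t s + (β / h.lam t) • (x' - s.x) - x'
      = (1 - α) • (s.y - s.x) - (1 - β / h.lam t) • (x' - s.x) := by
    rw [← hq]
    module
  have h1 : 0 ≤ 1 - β / h.lam t := by
    rw [sub_nonneg, div_le_one hl]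
    exact ha.le_lam t
  rw [e]
  refine (norm_sub_le _ _).trans ?_
  rw [norm_smul, norm_smul, Real.norm_of_nonneg h1,
    Real.norm_of_nonneg (sub_nonneg.2 ha.alpha_le)]
  have h2 : (1 - β / h.lam t) * ‖x' - s.x‖ ≤ (1 - β / h.lam t) * (h.eps * h.lam t) :=
    mul_le_mul_of_nonneg_left hm h1
  have h3 : (1 - β / h.lam t) * (h.eps * h.lam t) = h.eps * (h.lam t - β) := by
    field_simp
  have h4 : h.eps * (h.lam t - β) ≤ h.eps * (α * β) :=
    mul_le_mul_of_nonneg_left (by linarith [ha.lam_le t]) ha.eps_pos.le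
  have h5 := mul_le_mul_of_nonneg_left hs (sub_nonneg.2 ha.alpha_le)
  linarith

/-- The displacement of the query point is `(β / λ) (x' - x) - α (y' - x')`, and both terms have
norm at most `ε β`. -/
lemma norm_query_step_sub_le (ha : Admissible h α β) (hs : ‖s.y - s.x‖ ≤ h.eps * β) (t' : ℕ) :
    ‖query h t' (step f g r h t b s) - (step f g r h t b s).zPrev‖ ≤ 2 * (h.eps * β) := by
  have hm := norm_step_x_sub_le (f := f) (g := g) (r := r) (b := b) (s := s) (t := t) ha
  have hyx := norm_step_y_sub_x_le (f := f) (g := g) (r := r) (b := b) (t := t) ha hs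
  have hl := ha.lam_pos t
  have e : query h t' (step f g r h t b s) - (step f g r h t b s).zPrev
      = (β / h.lam t) • ((step f g r h t b s).x - s.x)
        - α • ((step f g r h t b s).y - (step f g r h t b s).x) := by
    have := step_y f g r h t b s
    rw [ha.beta_eq] at this
    rw [query, ha.alpha_eq, step_zPrev, eq_sub_of_add_eq this.symm]
    module
  rw [e]
  refine (norm_sub_le _ _).trans ?_
  have h1 : 0 ≤ β / h.lam t := (div_pos ha.beta_pos hl).le
  rw [norm_smul, norm_smul, Real.norm_of_nonneg h1, Real.norm_of_nonneg ha.alpha_pos.le]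
  have h2 := mul_le_mul_of_nonneg_left hm h1
  have h3 : β / h.lam t * (h.eps * h.lam t) = h.eps * β := by field_simp
  have h4 := mul_le_mul ha.alpha_le hyx (norm_nonneg _) zero_le_one
  linarith

variable {fbar : E p → ℝ} {gbar : E d → E p} {lf Lf lg Lg : ℝ}

/-- Descent of the objective in one iteration, for a gradient estimate at `z`. -/
lemma mul_norm_proxPoint_sub_le (hsm : SmoothPair fbar gbar lf Lf lg Lg)
    (hr : ConvexOn ℝ Set.univ r) (ha : Admissible h α β) (z : E d) :
    h.eps * ‖proxPoint r (h.lam t) s.x (step f g r h t b s).gradEst - s.x‖ ≤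
      objective fbar gbar r s.x - objective fbar gbar r (step f g r h t b s).x
      + h.eps * h.lam t * (‖(step f g r h t b s).gradEst - gradient (fun x => fbar (gbar x)) z‖
        + LF lf Lf lg Lg * ‖z - s.x‖)
      + LF lf Lf lg Lg * (h.eps * h.lam t) ^ 2 + h.eps ^ 2 * h.lam t / 2 := by
  have hl := ha.lam_pos t
  have h0 : 0 < h.eps * h.lam t := mul_pos ha.eps_pos hl
  have hmove := norm_step_x_sub_le (f := f) (g := g) (r := r) (b := b) (s := s) (t := t) ha
  have hdesc := hsm.comp_le_linear s.x (step f g r h t b s).x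
  have hx := step_x f g r h t b s
  set v := (step f g r h t b s).gradEst
  set x' := (step f g r h t b s).x
  set q := proxPoint r (h.lam t) s.x v with hq
  set D := ‖q - s.x‖ with hD
  set θ := damping (h.eps * h.lam t) D
  set G := gradient (fun x => fbar (gbar x))
  have hθ0 : 0 ≤ θ := damping_nonneg h0.le (norm_nonneg _)
  have hθ1 : θ ≤ 1 / 2 := damping_le_half _ _
  have hθD : θ * D ≤ h.eps * h.lam t := damping_mul_le h0.le (norm_nonneg _)
  have hθD2 := le_damping_mul_sq (a := h.eps * h.lam t) (D := D) (norm_nonneg _)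
  -- Testing the variational inequality of `q` at the current iterate bounds `r q + ⟪v, q - x⟫` by
  -- `r x - D² / λ`.
  have hvar := prox_variational hl hr (s.x - h.lam t • v) s.x
  rw [show prox (h.lam t) r (s.x - h.lam t • v) = q from rfl] at hvar
  have e1 : inner ℝ (s.x - h.lam t • v - q) (s.x - q)
      = D ^ 2 + h.lam t * inner ℝ v (q - s.x) := by
    have : s.x - h.lam t • v - q = -(q - s.x) - h.lam t • v := by module
    rw [this, ← neg_sub q s.x, inner_neg_right, inner_sub_left, inner_neg_left,
      real_inner_self_eq_norm_sq, real_inner_smul_left]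
    ring
  rw [e1] at hvar
  have hvar' : r q + D ^ 2 / h.lam t + inner ℝ v (q - s.x) ≤ r s.x := by
    have : 1 / h.lam t * (D ^ 2 + h.lam t * inner ℝ v (q - s.x))
        = D ^ 2 / h.lam t + inner ℝ v (q - s.x) := by field_simp
    linarith
  have hconv := hr.2 (Set.mem_univ s.x) (Set.mem_univ q) (show 0 ≤ 1 - θ by linarith) hθ0 (by ring)
  rw [← hx] at hconv
  simp only [smul_eq_mul] at hconv
  have hxs : x' - s.x = θ • (q - s.x) := by
    rw [hx]; module
  have hin : inner ℝ (G s.x) (x' - s.x) = θ * inner ℝ v (q - s.x)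
      + θ * inner ℝ (G s.x - v) (q - s.x) := by
    rw [hxs, real_inner_smul_right, inner_sub_left]; ring
  have hcs : inner ℝ (G s.x - v) (q - s.x) ≤ ‖G s.x - v‖ * D := real_inner_le_norm _ _
  -- The descent takes place at `x`, while `v` estimates the gradient at `z`; the Lipschitz bound of
  -- `∇F` pays for the difference.
  have herr : ‖G s.x - v‖ ≤ ‖v - G z‖ + LF lf Lf lg Lg * ‖z - s.x‖ := by
    have e : G s.x - v = -(v - G z) - (G z - G s.x) := by abel
    rw [e]
    refine (norm_sub_le _ _).trans ?_
    rw [norm_neg]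
    exact add_le_add_right (hsm.norm_gradient_comp_sub_le _ _) _
  have hsq : ‖x' - s.x‖ ^ 2 ≤ (h.eps * h.lam t) ^ 2 := pow_le_pow_left₀ (norm_nonneg _) hmove 2
  have hq1 : h.eps * D - h.eps ^ 2 * h.lam t / 2 ≤ θ * (D ^ 2 / h.lam t) := by
    have : θ * (D ^ 2 / h.lam t) = θ * D ^ 2 / h.lam t := by ring
    rw [this, le_div_iff₀ hl]
    calc _ = h.eps * h.lam t * D - (h.eps * h.lam t) ^ 2 / 2 := by ring
      _ ≤ _ := hθD2
  have hq2 : θ * inner ℝ (G s.x - v) (q - s.x)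
      ≤ h.eps * h.lam t * (‖v - G z‖ + LF lf Lf lg Lg * ‖z - s.x‖) := by
    calc θ * inner ℝ (G s.x - v) (q - s.x) ≤ θ * (‖G s.x - v‖ * D) :=
          mul_le_mul_of_nonneg_left hcs hθ0
      _ = θ * D * ‖G s.x - v‖ := by ring
      _ ≤ _ := mul_le_mul hθD herr (norm_nonneg _) h0.le
  have hq3 := mul_le_mul_of_nonneg_left hvar' hθ0
  have hq4 := mul_le_mul_of_nonneg_left hsq hsm.LF_pos.le
  unfold objective
  linarith

/-- Insert the proximal point computed from `x` and `v`; by nonexpansiveness it differs from the one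
at `z` by at most `‖z - x‖ + lam * ‖v - ∇F z‖`. -/
lemma norm_gradMap_le {F : E d → ℝ} {lam : ℝ} (hlam : 0 < lam) (hr : ConvexOn ℝ Set.univ r)
    (x z v : E d) :
    ‖gradMap F r lam z‖ ≤
      (2 * ‖z - x‖ + ‖proxPoint r lam x v - x‖) / lam + ‖v - gradient F z‖ := by
  have h1 := prox_nonexpansive hlam hr (x - lam • v) (z - lam • gradient F z)
  have e1 : x - lam • v - (z - lam • gradient F z) = -(z - x) - lam • (v - gradient F z) := by
    module
  have h2 : ‖x - lam • v - (z - lam • gradient F z)‖ ≤ ‖z - x‖ + lam * ‖v - gradient F z‖ := by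
    rw [e1]
    refine (norm_sub_le _ _).trans ?_
    rw [norm_neg, norm_smul, Real.norm_of_nonneg hlam.le]
  have e2 : z - prox lam r (z - lam • gradient F z) = (z - x) - (proxPoint r lam x v - x)
      + (prox lam r (x - lam • v) - prox lam r (z - lam • gradient F z)) := by
    rw [proxPoint]; abel
  have h3 : ‖z - prox lam r (z - lam • gradient F z)‖ ≤
      2 * ‖z - x‖ + ‖proxPoint r lam x v - x‖ + lam * ‖v - gradient F z‖ := by
    rw [e2]
    refine (norm_add_le _ _).trans ?_
    have := norm_sub_le (z - x) (proxPoint r lam x v - x)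
    linarith
  rw [gradMap, norm_smul, Real.norm_of_nonneg (by positivity), one_div, inv_mul_le_iff₀ hlam]
  calc _ ≤ _ := h3
    _ = _ := by field_simp

/-- One iteration bounds the gradient mapping at the query point. -/
lemma norm_gradMap_query_le (hsm : SmoothPair fbar gbar lf Lf lg Lg)
    (hr : ConvexOn ℝ Set.univ r) (ha : Admissible h α β) (hs : ‖s.y - s.x‖ ≤ h.eps * β)
    {c₂ : ℝ} (hc : LF lf Lf lg Lg * β ≤ c₂) :
    ‖gradMap (fun x => fbar (gbar x)) r (h.lam t) (query h t s)‖ ≤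
      (objective fbar gbar r s.x - objective fbar gbar r (step f g r h t b s).x) / (h.eps * β)
      + (3 * ‖(step f g r h t b s).gradEst - gradient (fun x => fbar (gbar x)) (query h t s)‖
        + (6 * c₂ + 3) * h.eps) := by
  have hl := ha.lam_pos t
  have hβ := ha.beta_pos
  have he := ha.eps_pos
  have h1 := norm_gradMap_le (F := fun x => fbar (gbar x)) hl hr s.x (query h t s)
    (step f g r h t b s).gradEst
  have h2 := mul_norm_proxPoint_sub_le (f := f) (g := g) (t := t) (b := b) (s := s) hsm hr ha
    (query h t s)
  have h3 := norm_query_sub_x_le (t := t) ha hs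
  set D := ‖proxPoint r (h.lam t) s.x (step f g r h t b s).gradEst - s.x‖
  set e := ‖(step f g r h t b s).gradEst - gradient (fun x => fbar (gbar x)) (query h t s)‖
  set Δ := objective fbar gbar r s.x - objective fbar gbar r (step f g r h t b s).x
  set L := LF lf Lf lg Lg
  have hL : 0 < L := hsm.LF_pos
  have he0 : 0 ≤ e := norm_nonneg _
  have hD0 : 0 ≤ D := norm_nonneg _
  have hl2 := ha.lam_le_two_mul t
  have k1 : (2 * ‖query h t s - s.x‖ + D) / h.lam t ≤ 2 * h.eps + D / β := by
    rw [add_div]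
    refine add_le_add ?_ (div_le_div_of_nonneg_left hD0 hβ (ha.le_lam t))
    rw [div_le_iff₀ hl]
    nlinarith [ha.le_lam t]
  have k2 : L * ‖query h t s - s.x‖ ≤ c₂ * h.eps := by
    calc _ ≤ L * (h.eps * β) := mul_le_mul_of_nonneg_left h3 hL.le
      _ = (L * β) * h.eps := by ring
      _ ≤ _ := mul_le_mul_of_nonneg_right hc he.le
  have hc0 : 0 ≤ c₂ := (mul_pos hL hβ).le.trans hc
  -- With `λ ≤ 2 β` and `L β ≤ c₂`, the gradient shift from `z` to `x` contributes `2 c₂`, the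
  -- smoothness term `4 c₂`, and the damping loss `1`.
  have k3 : h.eps * D ≤ Δ + h.eps * β * (2 * e + (6 * c₂ + 1) * h.eps) := by
    have a1 : h.eps * h.lam t * (e + L * ‖query h t s - s.x‖)
        ≤ h.eps * (2 * β) * (e + c₂ * h.eps) := by
      gcongr
    have a2 : L * (h.eps * h.lam t) ^ 2 ≤ 4 * (h.eps ^ 2 * β) * c₂ := by
      calc L * (h.eps * h.lam t) ^ 2 ≤ L * (h.eps * (2 * β)) ^ 2 := by gcongr
        _ = 4 * (h.eps ^ 2 * β) * (L * β) := by ring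
        _ ≤ _ := by gcongr
    have a3 : h.eps ^ 2 * h.lam t / 2 ≤ h.eps ^ 2 * β := by
      have : h.eps ^ 2 * h.lam t ≤ h.eps ^ 2 * (2 * β) := by gcongr
      linarith
    linarith
  have k4 : D / β ≤ Δ / (h.eps * β) + (2 * e + (6 * c₂ + 1) * h.eps) := by
    have : D / β = h.eps * D / (h.eps * β) := by field_simp
    rw [this, div_add' _ _ _ (by positivity)]
    gcongr
    linarith
  linarith

end Iteration

/-! ### Estimation errors and the telescoping sum along a trajectory. -/

section Trajectory

variable {d p : ℕ} {ι κ : Type*} {f : κ → E p → ℝ} {g : ι → E d → E p} {r : E d → ℝ}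
  {h : Hyper} {x0 : E d} {m : BatchSizes} {b : ∀ t, Batch ι κ (m.A t) (m.A' t) (m.B t)}
  {α β : ℝ} {fbar : E p → ℝ} {gbar : E d → E p} {lf Lf lg Lg : ℝ}

lemma norm_state_y_sub_x_le (ha : Admissible h α β) (t : ℕ) :
    ‖(state f g r h x0 b t).y - (state f g r h x0 b t).x‖ ≤ h.eps * β := by
  induction t with
  | zero => simpa [state, initState] using (mul_pos ha.eps_pos ha.beta_pos).le
  | succ t ih => exact norm_step_y_sub_x_le ha ih

lemma norm_query_state_sub_le (ha : Admissible h α β) (t : ℕ) :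
    ‖query h (t + 1) (state f g r h x0 b (t + 1)) - (state f g r h x0 b (t + 1)).zPrev‖
      ≤ 2 * (h.eps * β) :=
  norm_query_step_sub_le ha (norm_state_y_sub_x_le ha t) _

/-- Squared error of the estimate of the inner map in a state. -/
noncomputable def errG {d p : ℕ} (gbar : E d → E p) (s : State d p) : ℝ :=
  ‖s.gEst - gbar s.zPrev‖ ^ 2

/-- Squared error of the estimate of the Jacobian in a state. -/
noncomputable def errJ {d p : ℕ} (gbar : E d → E p) (s : State d p) : ℝ :=
  ‖cols d p (s.jEst - fderiv ℝ gbar s.zPrev)‖ ^ 2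

/-- Squared error of the estimate of the outer gradient in a state. -/
noncomputable def errF {d p : ℕ} (fbar : E p → ℝ) (s : State d p) : ℝ :=
  ‖s.fEst - gradient fbar s.gEst‖ ^ 2

/-- Total squared error, scaled. -/
noncomputable def errTotal {d p : ℕ} (fbar : E p → ℝ) (gbar : E d → E p) (lf Lf lg ε : ℝ)
    (s : State d p) : ℝ :=
  (lf / ε) ^ 2 * errJ gbar s + (2 * (lg / ε) ^ 2 * errF fbar s
    + 2 * (lg * Lf / ε) ^ 2 * errG gbar s)

/-- Let `A` and `Q` be the Jacobian error and the outer gradient error, scaled by `lf / ε` and `lg /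
ε`. The error is at most `ε (A + Q + A Q)`, where the cross term needs `ε ≤ lf * lg`. Then `A + Q +
A Q ≤ 1 + A² + Q²` leaves only squares, whose expectations are controlled. -/
lemma norm_gradEst_sub_le (hsm : SmoothPair fbar gbar lf Lf lg Lg) {ε : ℝ} (hε : 0 < ε)
    (hε' : ε ≤ lf * lg) (s : State d p) :
    ‖s.gradEst - gradient (fun x => fbar (gbar x)) s.zPrev‖
      ≤ ε * (1 + errTotal fbar gbar lf Lf lg ε s) := by
  have hlf := hsm.lf_pos
  have hlg := hsm.lg_pos
  have hLf := hsm.Lf_pos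
  rw [hsm.gradient_comp, State.gradEst]
  refine (norm_adjoint_sub_le _ _ _ _).trans ?_
  set v := gradient fbar (gbar s.zPrev)
  set a := ‖cols d p (s.jEst - fderiv ℝ gbar s.zPrev)‖ with ha
  set q1 := ‖s.fEst - gradient fbar s.gEst‖ with hq1
  set q2 := ‖s.gEst - gbar s.zPrev‖ with hq2
  have ha' : ‖s.jEst - fderiv ℝ gbar s.zPrev‖ ≤ a := by
    rw [ha, norm_cols]; exact opNorm_le_frob _
  have hq : ‖s.fEst - v‖ ≤ q1 + Lf * q2 := by
    have e : s.fEst - v = (s.fEst - gradient fbar s.gEst) + (gradient fbar s.gEst - v) := by abel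
    rw [e]
    exact (norm_add_le _ _).trans (add_le_add_right (hsm.norm_gradient_sub_le _ _) _)
  have hf : ‖s.fEst‖ ≤ lf + (q1 + Lf * q2) := by
    have e : s.fEst = v + (s.fEst - v) := by abel
    rw [e]
    exact (norm_add_le _ _).trans (add_le_add (hsm.norm_gradient_le _) hq)
  have ha0 : 0 ≤ a := norm_nonneg _
  have hq10 : 0 ≤ q1 := norm_nonneg _
  have hq20 : 0 ≤ q2 := norm_nonneg _
  have h1 : ‖s.jEst - fderiv ℝ gbar s.zPrev‖ * ‖s.fEst‖ ≤ a * (lf + (q1 + Lf * q2)) :=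
    mul_le_mul ha' hf (norm_nonneg _) ha0
  have h2 : ‖fderiv ℝ gbar s.zPrev‖ * ‖s.fEst - v‖ ≤ lg * (q1 + Lf * q2) :=
    mul_le_mul (hsm.norm_fderiv_le _) hq (norm_nonneg _) hlg.le
  set A := lf / ε * a with hA
  set Q := lg / ε * (q1 + Lf * q2) with hQ
  have hA0 : 0 ≤ A := by positivity
  have hQ0 : 0 ≤ Q := by positivity
  have e1 : a * lf = ε * A := by rw [hA]; field_simp
  have e2 : lg * (q1 + Lf * q2) = ε * Q := by rw [hQ]; field_simp
  have e3 : a * (q1 + Lf * q2) ≤ ε * (A * Q) := by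
    have : ε * (A * Q) = (lf * lg / ε) * (a * (q1 + Lf * q2)) := by
      rw [hA, hQ]; field_simp
    rw [this]
    refine le_mul_of_one_le_left (by positivity) ?_
    rw [one_le_div hε]; exact hε'
  have e4 : A ^ 2 + Q ^ 2 ≤ errTotal fbar gbar lf Lf lg ε s := by
    have : Q ^ 2 ≤ 2 * (lg / ε) ^ 2 * q1 ^ 2 + 2 * (lg * Lf / ε) ^ 2 * q2 ^ 2 := by
      have : (lg * Lf / ε) = lg / ε * Lf := by ring
      rw [hQ, this]
      nlinarith [mul_nonneg (sq_nonneg (lg / ε)) (sq_nonneg (q1 - Lf * q2))]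
    unfold errTotal errJ errF errG
    rw [← ha, ← hq1, ← hq2, hA]
    linarith [mul_pow (lf / ε) a 2]
  have e5 : A + Q + A * Q ≤ 1 + (A ^ 2 + Q ^ 2) := by
    nlinarith [sq_nonneg (A - 1), sq_nonneg (Q - 1), sq_nonneg (A - Q)]
  calc _ ≤ ε * (A + Q + A * Q) := by linarith
    _ ≤ _ := mul_le_mul_of_nonneg_left (by linarith) hε.le

/-- Sum of the gradient mappings along a trajectory. -/
lemma sum_norm_gradMap_le (hsm : SmoothPair fbar gbar lf Lf lg Lg)
    (hr : ConvexOn ℝ Set.univ r) (ha : Admissible h α β)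
    (hbdd : BddBelow (Set.range (objective fbar gbar r))) (hε : h.eps ≤ lf * lg)
    {c₁ c₂ : ℝ} (hc₁ : 0 < c₁) (hc₁' : c₁ ≤ LF lf Lf lg Lg * β) (hc₂ : LF lf Lf lg Lg * β ≤ c₂)
    (T : ℕ) :
    ∑ t ∈ Finset.range T,
        ‖gradMap (fun x => fbar (gbar x)) r (h.lam t) (iterZ f g r h x0 b t)‖ ≤
      LF lf Lf lg Lg * gap (objective fbar gbar r) x0 / (c₁ * h.eps)
      + ∑ t ∈ Finset.range T, (3 * h.eps *
          errTotal fbar gbar lf Lf lg h.eps (state f g r h x0 b (t + 1))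
          + (6 * c₂ + 6) * h.eps) := by
  set Φ := objective fbar gbar r
  have he := ha.eps_pos
  have hβ := ha.beta_pos
  -- Three times the gradient error is at most `3 ε (1 + errTotal)`, which raises `6 c₂ + 3` to `6
  -- c₂ + 6`.
  have h1 : ∀ t, ‖gradMap (fun x => fbar (gbar x)) r (h.lam t) (iterZ f g r h x0 b t)‖ ≤
      (Φ (state f g r h x0 b t).x - Φ (state f g r h x0 b (t + 1)).x) / (h.eps * β)
      + (3 * h.eps * errTotal fbar gbar lf Lf lg h.eps (state f g r h x0 b (t + 1))
          + (6 * c₂ + 6) * h.eps) := by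
    intro t
    have k1 := norm_gradMap_query_le (f := f) (g := g) (t := t) (b := b t) hsm hr ha
      (norm_state_y_sub_x_le (f := f) (g := g) (r := r) (x0 := x0) (b := b) ha t) hc₂
    have k2 := norm_gradEst_sub_le hsm he hε (state f g r h x0 b (t + 1))
    have k3 : (state f g r h x0 b (t + 1)).zPrev = query h t (state f g r h x0 b t) := rfl
    rw [k3] at k2
    have k4 : state f g r h x0 b (t + 1) = step f g r h t (b t) (state f g r h x0 b t) := rfl
    rw [← k4] at k1
    unfold iterZ
    linarith
  refine (Finset.sum_le_sum fun t _ => h1 t).trans ?_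
  rw [Finset.sum_add_distrib]
  refine add_le_add_left ?_ _
  rw [← Finset.sum_div, Finset.sum_range_sub' (fun t => Φ (state f g r h x0 b t).x)]
  have h2 : Φ (state f g r h x0 b 0).x - Φ (state f g r h x0 b T).x ≤ gap Φ x0 := by
    have : ⨅ x, Φ x ≤ Φ (state f g r h x0 b T).x := ciInf_le hbdd _
    simp only [gap, state, initState] at *
    linarith
  have hgap : 0 ≤ gap Φ x0 := sub_nonneg.2 (ciInf_le hbdd _)
  -- The lower bound `c₁ ≤ L_F β` replaces `1 / β` by `L_F / c₁`.
  calc _ ≤ gap Φ x0 / (h.eps * β) := by gcongr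
    _ ≤ _ := by
      rw [div_le_div_iff₀ (by positivity) (by positivity)]
      have := mul_le_mul_of_nonneg_left hc₁' (mul_nonneg hgap he.le)
      linarith

end Trajectory

/-- `ρ` is the law of `m` samples with law `μ` each, which are pairwise nonpositively
correlated. -/
structure IsBatchLaw {ι : Type*} [MeasurableSpace ι] (μ : Measure ι) {m : ℕ}
    (ρ : Measure (Fin m → ι)) : Prop where
  prob : IsProbabilityMeasure ρ
  marginal : ∀ i, MeasurePreserving (fun v => v i) ρ μ
  integral_mul_nonpos : ∀ i j, i ≠ j → ∀ u : ι → ℝ, MemLp u 2 μ → ∫ x, u x ∂μ = 0 →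
    ∫ v, u (v i) * u (v j) ∂ρ ≤ 0

/-! ### Second moments of batch averages. -/

section Variance

variable {ι : Type*} [MeasurableSpace ι] {μ : Measure ι} {m : ℕ} {ρ : Measure (Fin m → ι)}

lemma IsBatchLaw.memLp {V : Type*} [NormedAddCommGroup V] (h : IsBatchLaw μ ρ) {u : ι → V}
    (hu : MemLp u 2 μ) (i : Fin m) : MemLp (fun v => u (v i)) 2 ρ :=
  hu.comp_measurePreserving (h.marginal i)

lemma IsBatchLaw.integral_apply {V : Type*} [NormedAddCommGroup V] [NormedSpace ℝ V]
    (h : IsBatchLaw μ ρ) {u : ι → V} (hu : AEStronglyMeasurable u μ) (i : Fin m) :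
    ∫ v, u (v i) ∂ρ = ∫ x, u x ∂μ := by
  rw [← (h.marginal i).map_eq] at hu ⊢
  rw [integral_map (h.marginal i).measurable.aemeasurable hu]

lemma IsBatchLaw.memLp_avg {V : Type*} [NormedAddCommGroup V] [NormedSpace ℝ V]
    (h : IsBatchLaw μ ρ) {u : ι → V} (hu : MemLp u 2 μ) (a : V) :
    MemLp (fun v => a + avg fun i => u (v i)) 2 ρ := by
  have := h.prob
  exact (memLp_const a).add ((memLp_finsetSum _ fun i _ => h.memLp hu i).const_smul _)

/-- Expand the square: the terms linear in the samples have mean zero, the `m` diagonal terms give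
the variance over `m`, and the off-diagonal ones are nonpositive. -/
lemma IsBatchLaw.integral_sq_avg_le_real (h : IsBatchLaw μ ρ) (hm : 0 < m) {u : ι → ℝ}
    (hu : MemLp u 2 μ) (hu0 : ∫ x, u x ∂μ = 0) (a : ℝ) :
    ∫ v, (a + avg fun i => u (v i)) ^ 2 ∂ρ ≤ a ^ 2 + 1 / m * ∫ x, u x ^ 2 ∂μ := by
  have := h.prob
  have hm' : (0 : ℝ) < m := by exact_mod_cast hm
  have hi : ∀ i, Integrable (fun v : Fin m → ι => u (v i)) ρ := fun i =>
    (h.memLp hu i).integrable (by norm_num)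
  have hij : ∀ i j, Integrable (fun v : Fin m → ι => u (v i) * u (v j)) ρ := fun i j =>
    (h.memLp hu i).integrable_mul (h.memLp hu j)
  have e : ∀ v : Fin m → ι, (a + avg fun i => u (v i)) ^ 2
      = a ^ 2 + ((2 * a / m) * ∑ i, u (v i) + (1 / m) ^ 2 * ∑ i, ∑ j, u (v i) * u (v j)) := by
    intro v
    rw [← Finset.sum_mul_sum, avg, smul_eq_mul]
    ring
  simp_rw [e]
  rw [integral_add (integrable_const _), integral_add, integral_const_mul, integral_const_mul,
    integral_finsetSum _ (fun i _ => hi i),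
    integral_finsetSum _ (fun i _ => integrable_finsetSum _ fun j _ => hij i j)]
  rotate_left
  · exact (integrable_finsetSum _ fun i _ => hi i).const_mul _
  · exact (integrable_finsetSum _ fun i _ => integrable_finsetSum _ fun j _ => hij i j).const_mul _
  · exact ((integrable_finsetSum _ fun i _ => hi i).const_mul _).add
      ((integrable_finsetSum _ fun i _ => integrable_finsetSum _ fun j _ => hij i j).const_mul _)
  have h1 : ∀ i, ∫ v : Fin m → ι, u (v i) ∂ρ = 0 := fun i => by
    rw [h.integral_apply hu.1 i, hu0]
  have h2 : ∀ i, ∫ v : Fin m → ι, ∑ j, u (v i) * u (v j) ∂ρ ≤ ∫ x, u x ^ 2 ∂μ := by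
    intro i
    rw [integral_finsetSum _ (fun j _ => hij i j), ← Finset.add_sum_erase _ _ (Finset.mem_univ i)]
    have h3 : ∫ v : Fin m → ι, u (v i) * u (v i) ∂ρ = ∫ x, u x ^ 2 ∂μ := by
      have := h.integral_apply (u := fun x => u x ^ 2) (hu.1.pow 2) i
      rw [← this]
      exact integral_congr_ae (ae_of_all _ fun v => by simp only; ring)
    have h4 : ∑ j ∈ Finset.univ.erase i, ∫ v : Fin m → ι, u (v i) * u (v j) ∂ρ ≤ 0 :=
      Finset.sum_nonpos fun j hj =>
        h.integral_mul_nonpos i j (Finset.ne_of_mem_erase hj).symm u hu hu0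
    linarith
  have h5 : ∑ i, ∫ v : Fin m → ι, ∑ j, u (v i) * u (v j) ∂ρ ≤ m * ∫ x, u x ^ 2 ∂μ := by
    simpa using Finset.sum_le_sum fun (i : Fin m) (_ : i ∈ Finset.univ) => h2 i
  simp only [h1, Finset.sum_const_zero, mul_zero, zero_add, integral_const, probReal_univ,
    one_smul]
  have h6 := mul_le_mul_of_nonneg_left h5 (by positivity : (0 : ℝ) ≤ (1 / m) ^ 2)
  have h7 : (1 / (m : ℝ)) ^ 2 * (m * ∫ x, u x ^ 2 ∂μ) = 1 / m * ∫ x, u x ^ 2 ∂μ := by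
    field_simp
  linarith

lemma IsBatchLaw.isProbabilityMeasure (h : IsBatchLaw μ ρ) (hm : 0 < m) :
    IsProbabilityMeasure μ := by
  have := h.prob
  rw [← (h.marginal ⟨0, hm⟩).map_eq]
  exact Measure.isProbabilityMeasure_map (h.marginal ⟨0, hm⟩).measurable.aemeasurable

variable {V : Type*} [NormedAddCommGroup V] [InnerProductSpace ℝ V] [FiniteDimensional ℝ V]

/-- The real case applied to each coordinate in an orthonormal basis; hence correlations are only
needed for real functions. -/
lemma IsBatchLaw.integral_norm_sq_avg_le (h : IsBatchLaw μ ρ) (hm : 0 < m) {u : ι → V}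
    (hu : MemLp u 2 μ) (hu0 : ∫ x, u x ∂μ = 0) (a : V) :
    ∫ v, ‖a + avg fun i => u (v i)‖ ^ 2 ∂ρ ≤ ‖a‖ ^ 2 + 1 / m * ∫ x, ‖u x‖ ^ 2 ∂μ := by
  have := h.prob
  have hμ : IsProbabilityMeasure μ := h.isProbabilityMeasure hm
  set b := stdOrthonormalBasis ℝ V
  have hn : ∀ x : V, ‖x‖ ^ 2 = ∑ k, inner ℝ (b k) x ^ 2 := fun x => by
    rw [← b.sum_sq_norm_inner_right x]
    simp
  have hk : ∀ k, MemLp (fun x => inner ℝ (b k) (u x)) 2 μ := fun k => hu.const_inner (b k)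
  have hk0 : ∀ k, ∫ x, inner ℝ (b k) (u x) ∂μ = 0 := fun k => by
    rw [integral_inner (hu.integrable (by norm_num)), hu0, inner_zero_right]
  have e : ∀ v : Fin m → ι, ∀ k, inner ℝ (b k) (a + avg fun i => u (v i))
      = inner ℝ (b k) a + avg fun i => inner ℝ (b k) (u (v i)) := by
    intro v k
    rw [inner_add_right, avg, real_inner_smul_right, inner_sum, avg, smul_eq_mul]
  simp_rw [hn, e]
  rw [integral_finsetSum _ fun k _ => (h.memLp_avg (hk k) _).integrable_sq,
    integral_finsetSum _ fun k _ => (hk k).integrable_sq, Finset.mul_sum,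
    ← Finset.sum_add_distrib]
  exact Finset.sum_le_sum fun k _ => h.integral_sq_avg_le_real hm (hk k) (hk0 k) _

lemma avg_sub_const {V : Type*} [AddCommGroup V] [Module ℝ V] {m : ℕ} (hm : 0 < m)
    (v : Fin m → V) (c : V) : (avg fun i => v i - c) = avg v - c := by
  have : (m : ℝ) ≠ 0 := by exact_mod_cast hm.ne'
  rw [avg, Finset.sum_sub_distrib, smul_sub, avg]
  simp only [Finset.sum_const, Finset.card_univ, Fintype.card_fin, ← Nat.cast_smul_eq_nsmul ℝ,
    smul_smul]
  rw [one_div_mul_cancel this, one_smul]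

/-- The vector `a` stands for the error inherited from the preceding iteration, and is `0` at a
reset. Lower integrals spare integrability proofs when these bounds are iterated. -/
lemma IsBatchLaw.lintegral_norm_sq_avg_sub_le (h : IsBatchLaw μ ρ) (hm : 0 < m) {u : ι → V}
    {c : V} (hu : MemLp (fun x => u x - c) 2 μ) (hc : ∫ x, u x ∂μ = c) (hi : Integrable u μ)
    {σ : ℝ} (hσ : ∫ x, ‖u x - c‖ ^ 2 ∂μ ≤ σ ^ 2) (a : V) :
    ∫⁻ v, ENNReal.ofReal (‖a + ((avg fun i => u (v i)) - c)‖ ^ 2) ∂ρ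
      ≤ ENNReal.ofReal (‖a‖ ^ 2 + σ ^ 2 / m) := by
  have := h.prob
  have hμ : IsProbabilityMeasure μ := h.isProbabilityMeasure hm
  simp_rw [← avg_sub_const hm]
  have hu0 : ∫ x, u x - c ∂μ = 0 := by
    rw [integral_sub hi (integrable_const _), hc]
    simp
  rw [← ofReal_integral_eq_lintegral_ofReal]
  · refine ENNReal.ofReal_le_ofReal ((h.integral_norm_sq_avg_le hm hu hu0 a).trans ?_)
    have : 1 / (m : ℝ) * ∫ x, ‖u x - c‖ ^ 2 ∂μ ≤ 1 / m * σ ^ 2 :=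
      mul_le_mul_of_nonneg_left hσ (by positivity)
    rw [one_div_mul_eq_div (m : ℝ) (σ ^ 2)] at this
    linarith
  · exact (h.memLp_avg hu a).norm.integrable_sq
  · exact ae_of_all _ fun v => by positivity

/-- The centered samples are bounded by `2 * K`, a crude bound for the standard deviation that
suffices for increments. -/
lemma IsBatchLaw.lintegral_norm_sq_avg_sub_le_of_bound (h : IsBatchLaw μ ρ) (hm : 0 < m)
    {u : ι → V} (hs : AEStronglyMeasurable u μ) {K : ℝ} (hK : ∀ x, ‖u x‖ ≤ K) (a : V) :
    ∫⁻ v, ENNReal.ofReal (‖a + ((avg fun i => u (v i)) - ∫ x, u x ∂μ)‖ ^ 2) ∂ρ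
      ≤ ENNReal.ofReal (‖a‖ ^ 2 + (2 * K) ^ 2 / m) := by
  have hμ : IsProbabilityMeasure μ := h.isProbabilityMeasure hm
  have hi : Integrable u μ := Integrable.of_bound hs K (ae_of_all _ hK)
  have hc : ‖∫ x, u x ∂μ‖ ≤ K := by
    simpa using norm_integral_le_of_norm_le_const (μ := μ) (ae_of_all _ hK)
  have hb : ∀ x, ‖u x - ∫ x, u x ∂μ‖ ≤ 2 * K := fun x =>
    (norm_sub_le _ _).trans (by linarith [hK x])
  refine h.lintegral_norm_sq_avg_sub_le hm
    (MemLp.of_bound (hs.sub aestronglyMeasurable_const) (2 * K) (ae_of_all _ hb)) rfl hi ?_ a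
  have := integral_mono_of_nonneg (μ := μ) (g := fun _ => (2 * K) ^ 2)
    (ae_of_all _ fun x => by positivity) (integrable_const _)
    (ae_of_all _ fun x => pow_le_pow_left₀ (norm_nonneg _) (hb x) 2)
  simpa using this

end Variance

/-! ### Independent samples, uniform subsets and full batches. -/

section Laws

lemma isBatchLaw_pi {ι : Type*} [MeasurableSpace ι] (μ : Measure ι) [IsProbabilityMeasure μ]
    (m : ℕ) : IsBatchLaw μ (Measure.pi fun _ : Fin m => μ) where
  prob := inferInstance
  marginal i := measurePreserving_eval (fun _ : Fin m => μ) i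
  integral_mul_nonpos i j hij u hu hu0 := by
    have h1 : iIndepFun (fun (i : Fin m) (v : Fin m → ι) => u (v i)) (Measure.pi fun _ => μ) :=
      iIndepFun_pi fun _ => hu.1.aemeasurable
    have hm := measurePreserving_eval (fun _ : Fin m => μ)
    have h2 := (h1.indepFun hij).integral_mul_eq_mul_integral
      (hu.comp_measurePreserving (hm i)).1 (hu.comp_measurePreserving (hm j)).1
    have h3 : ∫ v : Fin m → ι, u (v i) ∂(Measure.pi fun _ => μ) = ∫ x, u x ∂μ := by
      have hu1 := hu.1
      conv_rhs => rw [← (hm i).map_eq]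
      rw [← (hm i).map_eq] at hu1
      rw [integral_map (hm i).measurable.aemeasurable hu1]
    simp only [Pi.mul_apply] at h2
    rw [hu0] at h3
    refine le_of_eq (h2.trans ?_)
    rw [h3, zero_mul]

lemma uniformOn_univ_singleton {α : Type*} [Fintype α] [MeasurableSpace α]
    [MeasurableSingletonClass α] (x : α) :
    uniformOn (Set.univ : Set α) {x} = (Fintype.card α : ENNReal)⁻¹ := by
  rw [uniformOn_univ, Measure.count_singleton, one_div]

lemma integral_uniformOn_univ {n : ℕ} (hn : 0 < n) {V : Type*} [NormedAddCommGroup V]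
    [NormedSpace ℝ V] [CompleteSpace V] (u : Fin n → V) :
    ∫ i, u i ∂(uniformOn (Set.univ : Set (Fin n))) = avg u := by
  have : Nonempty (Fin n) := ⟨⟨0, hn⟩⟩
  rw [integral_fintype Integrable.of_finite, avg, Finset.smul_sum]
  refine Finset.sum_congr rfl fun i _ => ?_
  rw [Measure.real, uniformOn_univ_singleton]
  simp

lemma uniformOn_univ_pi (m n : ℕ) (hn : 0 < n) :
    uniformOn (Set.univ : Set (Fin m → Fin n))
      = Measure.pi fun _ : Fin m => uniformOn (Set.univ : Set (Fin n)) := by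
  have : Nonempty (Fin n) := ⟨⟨0, hn⟩⟩
  refine Measure.ext_of_singleton fun v => ?_
  rw [Measure.pi_singleton, uniformOn_univ_singleton]
  simp [uniformOn_univ_singleton, ENNReal.inv_pow]

lemma isBatchLaw_uniformOn_univ (m n : ℕ) (hn : 0 < n) :
    IsBatchLaw (uniformOn (Set.univ : Set (Fin n)))
      (uniformOn (Set.univ : Set (Fin m → Fin n))) := by
  have : Nonempty (Fin n) := ⟨⟨0, hn⟩⟩
  rw [uniformOn_univ_pi m n hn]
  exact isBatchLaw_pi _ m

/-- For fixed `k`, composing with a transposition shows that the sum `c l` is the same for all `l ≠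
k`. The sums over all `l` add up to zero and `c k` is a sum of squares, so the common value is
nonpositive. -/
lemma sum_perm_mul_nonpos {n : ℕ} {u : Fin n → ℝ} (hu : ∑ i, u i = 0) {k l : Fin n}
    (hkl : k ≠ l) : ∑ σ : Equiv.Perm (Fin n), u (σ k) * u (σ l) ≤ 0 := by
  set c : Fin n → ℝ := fun l => ∑ σ : Equiv.Perm (Fin n), u (σ k) * u (σ l) with hc
  have h1 : ∀ l' ∈ Finset.univ.erase k, c l' = c l := by
    intro l' hl'
    have hl' := Finset.ne_of_mem_erase hl'
    refine Fintype.sum_equiv (Equiv.mulRight (Equiv.swap l l')) _ _ fun σ => ?_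
    simp [Equiv.swap_apply_of_ne_of_ne hkl hl'.symm]
  have h2 : ∑ l', c l' = 0 := by
    rw [hc, Finset.sum_comm]
    refine Finset.sum_eq_zero fun σ _ => ?_
    rw [← Finset.mul_sum, Equiv.sum_comp σ u, hu, mul_zero]
  rw [← Finset.add_sum_erase _ _ (Finset.mem_univ k), Finset.sum_congr rfl h1,
    Finset.sum_const, nsmul_eq_mul] at h2
  have h3 : 0 ≤ c k := Finset.sum_nonneg fun σ _ => mul_self_nonneg _
  have h4 : (0 : ℝ) < (Finset.univ.erase k).card := by
    exact_mod_cast Finset.card_pos.2 ⟨l, Finset.mem_erase.2 ⟨hkl.symm, Finset.mem_univ _⟩⟩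
  change c l ≤ 0
  by_contra! h5
  nlinarith [mul_pos h4 h5]

lemma measurePreserving_uniformOn {α : Type*} [Finite α] [MeasurableSpace α]
    [MeasurableSingletonClass α] (e : α ≃ α) {s : Set α} (hs : ∀ v, e v ∈ s ↔ v ∈ s) :
    MeasurePreserving e (uniformOn s) (uniformOn s) := by
  refine ⟨measurable_of_countable _, Measure.ext_of_singleton fun v => ?_⟩
  rw [Measure.map_apply (measurable_of_countable _) (MeasurableSet.singleton v)]
  have h1 : e ⁻¹' {v} = {e.symm v} := by
    ext w; simp [Equiv.eq_symm_apply]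
  have hms : MeasurableSet s := s.toFinite.measurableSet
  rw [h1, uniformOn, cond_apply hms, cond_apply hms]
  congr 1
  by_cases hv : v ∈ s
  · have hv' : e.symm v ∈ s := by rw [← hs]; simpa using hv
    rw [Set.inter_eq_self_of_subset_right (by simpa using hv'),
      Set.inter_eq_self_of_subset_right (by simpa using hv)]
    simp
  · have hv' : e.symm v ∉ s := by rw [← hs]; simpa using hv
    rw [Set.inter_singleton_eq_empty.2 hv', Set.inter_singleton_eq_empty.2 hv]

/-- The law is invariant under relabelling of the indices. Transpositions make the marginals
uniform, and averaging over all permutations reduces the correlation to `sum_perm_mul_nonpos`. -/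
lemma isBatchLaw_uniformOn_injective {m n : ℕ} (hn : 0 < n) (hmn : m ≤ n) :
    IsBatchLaw (uniformOn (Set.univ : Set (Fin n)))
      (uniformOn {v : Fin m → Fin n | Function.Injective v}) := by
  have : Nonempty (Fin n) := ⟨⟨0, hn⟩⟩
  set s := {v : Fin m → Fin n | Function.Injective v}
  set ρ := uniformOn s with hρ
  have hms : MeasurableSet s := s.toFinite.measurableSet
  have hprob : IsProbabilityMeasure ρ :=
    isProbabilityMeasure_uniformOn s.toFinite ⟨Fin.castLE hmn, Fin.castLE_injective hmn⟩
  have hinv : ∀ σ : Equiv.Perm (Fin n), MeasurePreserving (fun v : Fin m → Fin n => σ ∘ v) ρ ρ :=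
    fun σ => measurePreserving_uniformOn (Equiv.arrowCongr (Equiv.refl _) σ) fun v => by
      simp only [s, Set.mem_ofPred_eq]
      exact σ.injective.of_comp_iff _
  have hmeas : ∀ i, Measurable fun v : Fin m → Fin n => v i := fun i => measurable_of_countable _
  refine ⟨hprob, fun i => ⟨hmeas i, ?_⟩, fun i j hij u _ hu0 => ?_⟩
  · have h1 : ∀ k l, ρ.map (fun v => v i) {k} = ρ.map (fun v => v i) {l} := by
      intro k l
      rw [Measure.map_apply (hmeas i) (MeasurableSet.singleton _),
        Measure.map_apply (hmeas i) (MeasurableSet.singleton _),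
        ← (hinv (Equiv.swap k l)).measure_preimage (Set.toFinite _).measurableSet.nullMeasurableSet]
      congr 1
      ext v
      simp only [Set.mem_preimage, Function.comp, Set.mem_singleton_iff]
      rw [Equiv.swap_apply_eq_iff, Equiv.swap_apply_left]
    have hp : IsProbabilityMeasure (ρ.map fun v => v i) :=
      Measure.isProbabilityMeasure_map (hmeas i).aemeasurable
    refine Measure.ext_of_singleton fun k => ?_
    rw [uniformOn_univ_singleton, Fintype.card_fin]
    have h2 : ∑ l, ρ.map (fun v => v i) {l} = 1 := by
      rw [sum_measure_singleton, Finset.coe_univ, measure_univ]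
    rw [Finset.sum_congr rfl fun l _ => h1 l k, Finset.sum_const, Finset.card_univ,
      Fintype.card_fin, nsmul_eq_mul, mul_comm] at h2
    exact ENNReal.eq_inv_of_mul_eq_one_left h2
  · rw [integral_uniformOn_univ hn] at hu0
    have hu : ∑ k, u k = 0 := by
      have : (n : ℝ) ≠ 0 := by exact_mod_cast hn.ne'
      simpa [avg, this] using hu0
    have h1 : ∀ σ : Equiv.Perm (Fin n),
        ∫ v, u (σ (v i)) * u (σ (v j)) ∂ρ = ∫ v, u (v i) * u (v j) ∂ρ := fun σ => by
      have := integral_map (μ := ρ) (hinv σ).measurable.aemeasurable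
        (f := fun v => u (v i) * u (v j)) (measurable_of_countable _).aestronglyMeasurable
      rw [(hinv σ).map_eq] at this
      exact this.symm
    have h2 : ∫ v, ∑ σ : Equiv.Perm (Fin n), u (σ (v i)) * u (σ (v j)) ∂ρ
        = Fintype.card (Equiv.Perm (Fin n)) * ∫ v, u (v i) * u (v j) ∂ρ := by
      rw [integral_finsetSum _ fun _ _ => Integrable.of_finite, Finset.sum_congr rfl fun σ _ => h1 σ,
        Finset.sum_const, Finset.card_univ, nsmul_eq_mul]
    have h3 : ∫ v, ∑ σ : Equiv.Perm (Fin n), u (σ (v i)) * u (σ (v j)) ∂ρ ≤ 0 := by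
      refine integral_nonpos_of_ae ?_
      filter_upwards [ae_cond_mem (μ := Measure.count) hms] with v hv
      exact sum_perm_mul_nonpos hu (hv.ne hij)
    have h4 : (0 : ℝ) < Fintype.card (Equiv.Perm (Fin n)) := by
      exact_mod_cast Fintype.card_pos
    by_contra! h5
    nlinarith [mul_pos h4 h5]

/-- A batch that is an enumeration of the whole index set has the exact average. -/
lemma lintegral_uniformOn_bijective {n : ℕ} {V : Type*} [NormedAddCommGroup V] [NormedSpace ℝ V]
    (u : Fin n → V) :
    ∫⁻ v, ENNReal.ofReal (‖(avg fun i => u (v i)) - avg u‖ ^ 2)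
      ∂(uniformOn {v : Fin n → Fin n | Function.Bijective v}) = 0 := by
  rw [lintegral_eq_zero_iff (measurable_of_countable _)]
  filter_upwards [ae_cond_mem (μ := Measure.count) (Set.toFinite
    {v : Fin n → Fin n | Function.Bijective v}).measurableSet] with v hv
  have : ∑ i, u (v i) = ∑ i, u i := hv.sum_comp u
  simp [avg, this]

lemma isProbabilityMeasure_uniformOn_bijective (n : ℕ) :
    IsProbabilityMeasure (uniformOn {v : Fin n → Fin n | Function.Bijective v}) :=
  isProbabilityMeasure_uniformOn (Set.toFinite _) ⟨id, Function.bijective_id⟩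

end Laws

/-! ### Measurability of one iteration in the state and the batch. -/

section Measurability

variable {d p : ℕ}

noncomputable instance : MeasurableSpace (State d p) :=
  MeasurableSpace.comap (fun s => (s.x, s.y, s.zPrev, s.gEst, s.jEst, s.fEst)) inferInstance

lemma State.measurable_tuple :
    Measurable fun s : State d p => (s.x, s.y, s.zPrev, s.gEst, s.jEst, s.fEst) :=
  comap_measurable _

lemma State.measurable_x : Measurable fun s : State d p => s.x := State.measurable_tuple.fst

lemma State.measurable_y : Measurable fun s : State d p => s.y := State.measurable_tuple.snd.fst

lemma State.measurable_zPrev : Measurable fun s : State d p => s.zPrev :=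
  State.measurable_tuple.snd.snd.fst

lemma State.measurable_gEst : Measurable fun s : State d p => s.gEst :=
  State.measurable_tuple.snd.snd.snd.fst

lemma State.measurable_jEst : Measurable fun s : State d p => s.jEst :=
  State.measurable_tuple.snd.snd.snd.snd.fst

lemma State.measurable_fEst : Measurable fun s : State d p => s.fEst :=
  State.measurable_tuple.snd.snd.snd.snd.snd

lemma State.measurable_of_fields {α : Type*} [MeasurableSpace α] {u : α → State d p}
    (hx : Measurable fun a => (u a).x) (hy : Measurable fun a => (u a).y)
    (hz : Measurable fun a => (u a).zPrev) (hg : Measurable fun a => (u a).gEst)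
    (hj : Measurable fun a => (u a).jEst) (hf : Measurable fun a => (u a).fEst) :
    Measurable u := by
  rw [measurable_comap_iff]
  exact hx.prodMk (hy.prodMk (hz.prodMk (hg.prodMk (hj.prodMk hf))))

lemma measurable_avg {α V : Type*} [MeasurableSpace α] [NormedAddCommGroup V] [NormedSpace ℝ V]
    [MeasurableSpace V] [BorelSpace V] [SecondCountableTopology V] {m : ℕ} {u : Fin m → α → V}
    (hu : ∀ i, Measurable (u i)) : Measurable fun a => avg fun i => u i a :=
  (Finset.measurable_sum _ fun i _ => hu i).const_smul _

lemma measurable_query (h : Hyper) (t : ℕ) : Measurable (query h t : State d p → E d) := by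
  unfold query
  exact (State.measurable_y.const_smul (1 - h.alpha (t + 1))).add
    (State.measurable_x.const_smul (h.alpha (t + 1)))

/-- Expresses the gradient estimate through the columns of `A`, from which joint measurability is
evident. -/
lemma adjoint_eq_sum (A : E d →L[ℝ] E p) (v : E p) :
    ContinuousLinearMap.adjoint A v
      = ∑ j, (inner ℝ (A (EuclideanSpace.single j 1)) v : ℝ) • EuclideanSpace.single j (1 : ℝ) := by
  conv_lhs => rw [sum_smul_single (ContinuousLinearMap.adjoint A v)]
  refine Finset.sum_congr rfl fun j _ => ?_
  rw [← ContinuousLinearMap.adjoint_inner_right, EuclideanSpace.inner_single_left]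
  simp

lemma measurable_adjoint_apply {α : Type*} [MeasurableSpace α] {A : α → E d →L[ℝ] E p}
    {v : α → E p} (hA : Measurable A) (hv : Measurable v) :
    Measurable fun a => ContinuousLinearMap.adjoint (A a) (v a) := by
  simp_rw [adjoint_eq_sum]
  refine Finset.measurable_sum _ fun j _ => ?_
  have h1 : Measurable fun a => A a (EuclideanSpace.single j 1) :=
    (ContinuousLinearMap.apply ℝ (E p)
      (EuclideanSpace.single j (1 : ℝ))).continuous.measurable.comp hA
  exact (h1.inner hv).smul_const _

lemma continuous_of_lip {V W : Type*} [NormedAddCommGroup V] [NormedAddCommGroup W] {u : V → W}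
    {K : ℝ} (h : ∀ x x', ‖u x - u x'‖ ≤ K * ‖x - x'‖) : Continuous u := by
  have : LipschitzWith (Real.toNNReal K) u := LipschitzWith.of_dist_le_mul fun x y => by
    rw [dist_eq_norm, dist_eq_norm]
    exact (h x y).trans (mul_le_mul_of_nonneg_right (Real.le_coe_toNNReal K) (norm_nonneg _))
  exact this.continuous

variable {ι κ : Type*} [MeasurableSpace ι] [MeasurableSpace κ] {f : κ → E p → ℝ}
  {g : ι → E d → E p} {r Φ : E d → ℝ} {lf Lf lg Lg : ℝ}

omit [MeasurableSpace ι] [MeasurableSpace κ] in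
lemma Regular.norm_jac_sub_le (hreg : Regular f g r Φ lf Lf lg Lg) (i : ι) (x x' : E d) :
    ‖fderiv ℝ (g i) x - fderiv ℝ (g i) x'‖ ≤ Lg * ‖x - x'‖ :=
  (opNorm_le_frob _).trans (hreg.g_jac_lip i x x')

-- A Carathéodory function, continuous in the point and measurable in the index, is jointly
-- measurable. This is needed because the query point is itself random.
omit [MeasurableSpace κ] in
lemma Regular.measurable_g (hreg : Regular f g r Φ lf Lf lg Lg)
    (g_meas : ∀ x, Measurable fun i => g i x) {α : Type*} [MeasurableSpace α] {u : α → ι}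
    {z : α → E d} (hu : Measurable u) (hz : Measurable z) : Measurable fun a => g (u a) (z a) :=
  (measurable_uncurry_of_continuous_of_measurable (u := fun x i => g i x)
    (fun i => continuous_of_lip (hreg.g_lip i)) g_meas).comp (hz.prodMk hu)

omit [MeasurableSpace κ] in
lemma Regular.measurable_fderiv (hreg : Regular f g r Φ lf Lf lg Lg)
    (g_meas : ∀ x, Measurable fun i => g i x) {α : Type*} [MeasurableSpace α] {u : α → ι}
    {z : α → E d} (hu : Measurable u) (hz : Measurable z) :
    Measurable fun a => fderiv ℝ (g (u a)) (z a) :=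
  (measurable_uncurry_of_continuous_of_measurable (u := fun x i => fderiv ℝ (g i) x)
    (fun i => continuous_of_lip (hreg.norm_jac_sub_le i))
    (measurable_fderiv_index g_meas hreg.g_diff)).comp (hz.prodMk hu)

omit [MeasurableSpace ι] in
lemma Regular.measurable_gradient (hreg : Regular f g r Φ lf Lf lg Lg)
    (f_meas : ∀ y, Measurable fun k => f k y) {α : Type*} [MeasurableSpace α] {u : α → κ}
    {y : α → E p} (hu : Measurable u) (hy : Measurable y) :
    Measurable fun a => gradient (f (u a)) (y a) :=
  (measurable_uncurry_of_continuous_of_measurable (u := fun y k => gradient (f k) y)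
    (fun k => continuous_of_lip (hreg.f_grad_lip k))
    (measurable_gradient_index f_meas hreg.f_diff)).comp (hy.prodMk hu)

/-- The arbitrary space `Y` covers three uses: a frozen state, the product of states and batches,
and `Ω` with the σ-algebra of the past. -/
lemma Regular.measurable_step (hreg : Regular f g r Φ lf Lf lg Lg)
    (g_meas : ∀ x, Measurable fun i => g i x) (f_meas : ∀ y, Measurable fun k => f k y)
    (h : Hyper) {t : ℕ} (ht : 0 < h.lam t) {mA mA' mB : ℕ} {Y : Type*} [MeasurableSpace Y]
    {u : Y → State d p} {b : Y → Batch ι κ mA mA' mB} (hs : Measurable u) (hb : Measurable b) :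
    Measurable fun q => step f g r h t (b q) (u q) := by
  have hA : ∀ i, Measurable fun q => (b q).1 i := fun i =>
    (measurable_pi_apply i).comp hb.fst
  have hA' : ∀ i, Measurable fun q => (b q).2.1 i := fun i =>
    (measurable_pi_apply i).comp hb.snd.fst
  have hB : ∀ i, Measurable fun q => (b q).2.2 i := fun i =>
    (measurable_pi_apply i).comp hb.snd.snd
  have hq : Measurable fun q => query h t (u q) :=
    (measurable_query h t).comp hs
  have hz := State.measurable_zPrev.comp hs
  have hg : Measurable fun q =>
      (step f g r h t (b q) (u q)).gEst := by
    simp only [step_gEst]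
    split_ifs
    · exact measurable_avg fun i => hreg.measurable_g g_meas (hA i) hq
    · exact (State.measurable_gEst.comp hs).add (measurable_avg fun i =>
        (hreg.measurable_g g_meas (hA i) hq).sub (hreg.measurable_g g_meas (hA i) hz))
  have hj : Measurable fun q =>
      (step f g r h t (b q) (u q)).jEst := by
    simp only [step_jEst]
    split_ifs
    · exact measurable_avg fun i => hreg.measurable_fderiv g_meas (hA' i) hq
    · exact (State.measurable_jEst.comp hs).add (measurable_avg fun i =>
        (hreg.measurable_fderiv g_meas (hA' i) hq).sub (hreg.measurable_fderiv g_meas (hA' i) hz))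
  have hf : Measurable fun q =>
      (step f g r h t (b q) (u q)).fEst := by
    simp only [step_fEst]
    split_ifs
    · exact measurable_avg fun i => hreg.measurable_gradient f_meas (hB i) hg
    · exact (State.measurable_fEst.comp hs).add (measurable_avg fun i =>
        (hreg.measurable_gradient f_meas (hB i) hg).sub
          (hreg.measurable_gradient f_meas (hB i) (State.measurable_gEst.comp hs)))
  have hv : Measurable fun q =>
      (step f g r h t (b q) (u q)).gradEst :=
    measurable_adjoint_apply hj hf
  have hxs := State.measurable_x.comp hs
  have hp : Measurable fun q =>
      proxPoint r (h.lam t) (u q).x (step f g r h t (b q) (u q)).gradEst :=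
    (continuous_prox ht hreg.r_convex).measurable.comp (hxs.sub (hv.const_smul (h.lam t)))
  have hθ : Measurable fun q =>
      damping (h.eps * h.lam t)
        ‖proxPoint r (h.lam t) (u q).x (step f g r h t (b q) (u q)).gradEst - (u q).x‖ :=
    (measurable_const.div (hp.sub hxs).norm).min measurable_const
  have hx : Measurable fun q =>
      (step f g r h t (b q) (u q)).x := by
    simp only [step_x]
    exact ((measurable_const.sub hθ).smul hxs).add (hθ.smul hp)
  refine State.measurable_of_fields hx ?_ hq hg hj hf
  simp only [step_y]
  exact hq.add ((hx.sub hxs).const_smul (h.beta t / h.lam t))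

end Measurability

/-! ### Independence of past and present, and the recursion for expected errors. -/

section Independence

variable {d p : ℕ} {ι κ : Type*} [MeasurableSpace ι] [MeasurableSpace κ] {f : κ → E p → ℝ}
  {g : ι → E d → E p} {r Φ : E d → ℝ} {lf Lf lg Lg : ℝ} {h : Hyper} {x0 : E d}
  {Ω : Type*} [mΩ : MeasurableSpace Ω] {P : Measure Ω} {T : ℕ} {m : BatchSizes}
  {S : ∀ t, Ω → Batch ι κ (m.A t) (m.A' t) (m.B t)}

/-- The σ-algebra generated by the batches of the iterations before `t`. -/
@[reducible] def past (S : ∀ t, Ω → Batch ι κ (m.A t) (m.A' t) (m.B t)) (T t : ℕ) : MeasurableSpace Ω :=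
  ⨆ i ∈ {i : Fin T | (i : ℕ) < t}, MeasurableSpace.comap (S i) inferInstance

omit mΩ in
lemma past_mono {t t' : ℕ} (htt : t ≤ t') : past S T t ≤ past S T t' :=
  biSup_mono fun _ hi => lt_of_lt_of_le hi htt

omit mΩ in
lemma measurable_batch_past {t : ℕ} (ht : t < T) : Measurable[past S T (t + 1)] (S t) := by
  have h1 : MeasurableSpace.comap (S t) inferInstance ≤ past S T (t + 1) :=
    le_iSup₂_of_le (f := fun (i : Fin T) (_ : i ∈ {i : Fin T | (i : ℕ) < t + 1}) =>
      MeasurableSpace.comap (S i) inferInstance) ⟨t, ht⟩ (Nat.lt_succ_self t) le_rfl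
  exact measurable_iff_comap_le.2 h1

omit mΩ in
lemma measurable_state_past (hreg : Regular f g r Φ lf Lf lg Lg)
    (g_meas : ∀ x, Measurable fun i => g i x) (f_meas : ∀ y, Measurable fun k => f k y)
    (hlam : ∀ t, 0 < h.lam t) {t : ℕ} (ht : t ≤ T) :
    Measurable[past S T t] fun ω => state f g r h x0 (fun t => S t ω) t := by
  induction t with
  | zero => exact @measurable_const _ _ _ (past S T 0) _
  | succ t ih =>
    have h1 := (ih (by omega)).mono (past_mono (Nat.le_succ t)) le_rfl
    have h2 := measurable_batch_past (S := S) (T := T) (t := t) (by omega)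
    simp only [state]
    let _ : MeasurableSpace Ω := past S T (t + 1)
    exact hreg.measurable_step g_meas f_meas h (hlam t) h1 h2

lemma past_le (hS : ∀ t < T, Measurable (S t)) (t : ℕ) : past S T t ≤ mΩ :=
  iSup₂_le fun i _ => (hS i i.2).comap_le

/-- The state depends only on batches with index below `t`, a set of indices disjoint from `{t}`. -/
lemma indepFun_state (hreg : Regular f g r Φ lf Lf lg Lg)
    (g_meas : ∀ x, Measurable fun i => g i x) (f_meas : ∀ y, Measurable fun k => f k y)
    (hlam : ∀ t, 0 < h.lam t) (hS : ∀ t < T, Measurable (S t))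
    (hind : iIndepFun (fun t : Fin T => S t) P) {t : ℕ} (ht : t < T) :
    IndepFun (fun ω => state f g r h x0 (fun t => S t ω) t) (S t) P := by
  have h1 := indep_iSup_of_disjoint (fun i : Fin T => (hS i i.2).comap_le) hind.iIndep
    (S := {i : Fin T | (i : ℕ) < t}) (T := {⟨t, ht⟩}) (by simp)
  rw [iSup_singleton] at h1
  exact indep_of_indep_of_le_left h1
    (measurable_iff_comap_le.1 (measurable_state_past hreg g_meas f_meas hlam ht.le))

/-- Fubini for the product law of state and batch. It plays the role of conditioning on the past. -/
lemma lintegral_state_batch [IsProbabilityMeasure P] (hreg : Regular f g r Φ lf Lf lg Lg)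
    (g_meas : ∀ x, Measurable fun i => g i x) (f_meas : ∀ y, Measurable fun k => f k y)
    (hlam : ∀ t, 0 < h.lam t) (hS : ∀ t < T, Measurable (S t))
    (hind : iIndepFun (fun t : Fin T => S t) P) {t : ℕ} (ht : t < T)
    {φ : State d p × Batch ι κ (m.A t) (m.A' t) (m.B t) → ENNReal} (hφ : Measurable φ) :
    ∫⁻ ω, φ (state f g r h x0 (fun t => S t ω) t, S t ω) ∂P
      = ∫⁻ ω, ∫⁻ b, φ (state f g r h x0 (fun t => S t ω) t, b) ∂(P.map (S t)) ∂P := by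
  have hst : Measurable fun ω => state f g r h x0 (fun t => S t ω) t :=
    (measurable_state_past hreg g_meas f_meas hlam ht.le).mono (past_le hS t) le_rfl
  have h1 := (indepFun_state (x0 := x0) hreg g_meas f_meas hlam hS hind ht).map_prod_eq_prod_map_map
    hst.aemeasurable (hS t ht).aemeasurable
  have : IsProbabilityMeasure (P.map (S t)) :=
    Measure.isProbabilityMeasure_map (hS t ht).aemeasurable
  rw [← lintegral_map (f := fun q => φ q) hφ (hst.prodMk (hS t ht)), h1, lintegral_prod _ hφ.aemeasurable,
    lintegral_map _ hst]
  exact hφ.lintegral_prod_right'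

/-- Bound on the expectation of a nonnegative error that is reset every `tau` iterations and grows
by at most `D / tau` in expectation in the others. -/
lemma lintegral_err_le [IsProbabilityMeasure P] (hreg : Regular f g r Φ lf Lf lg Lg)
    (g_meas : ∀ x, Measurable fun i => g i x) (f_meas : ∀ y, Measurable fun k => f k y)
    {α β : ℝ} (ha : Admissible h α β) (hS : ∀ t < T, Measurable (S t))
    (hind : iIndepFun (fun t : Fin T => S t) P) (htau : 0 < h.tau)
    {err : State d p → ℝ} (herr : Measurable err) (herr0 : ∀ s, 0 ≤ err s) {V D : ℝ}
    (hV : 0 ≤ V) (hD : 0 ≤ D)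
    (hreset : ∀ t < T, t % h.tau = 0 → ∀ s,
      ∫⁻ b, ENNReal.ofReal (err (step f g r h t b s)) ∂(P.map (S t)) ≤ ENNReal.ofReal V)
    (hinner : ∀ t < T, t % h.tau ≠ 0 → ∀ s, ‖query h t s - s.zPrev‖ ≤ 2 * (h.eps * β) →
      ∫⁻ b, ENNReal.ofReal (err (step f g r h t b s)) ∂(P.map (S t))
        ≤ ENNReal.ofReal (err s + D / h.tau)) {t : ℕ} (ht : t < T) :
    ∫⁻ ω, ENNReal.ofReal (err (state f g r h x0 (fun t => S t ω) (t + 1))) ∂P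
      ≤ ENNReal.ofReal (V + D) := by
  have hτ : (0 : ℝ) < h.tau := by exact_mod_cast htau
  have hstep : ∀ t < T, ∫⁻ ω, ENNReal.ofReal (err (state f g r h x0 (fun t => S t ω) (t + 1))) ∂P
      = ∫⁻ ω, ∫⁻ b, ENNReal.ofReal (err (step f g r h t b
          (state f g r h x0 (fun t => S t ω) t))) ∂(P.map (S t)) ∂P := fun t ht =>
    lintegral_state_batch hreg g_meas f_meas ha.lam_pos hS hind ht
      (φ := fun q => ENNReal.ofReal (err (step f g r h t q.2 q.1)))
      (herr.comp (hreg.measurable_step g_meas f_meas h (ha.lam_pos t) measurable_fst measurable_snd)).ennreal_ofReal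
  -- The bound is sharpened for the induction: `t % tau` counts the updates since the last reset,
  -- each adding `D / tau`.
  have key : ∀ t, t < T →
      ∫⁻ ω, ENNReal.ofReal (err (state f g r h x0 (fun t => S t ω) (t + 1))) ∂P
        ≤ ENNReal.ofReal (V + (t % h.tau : ℕ) * (D / h.tau)) := by
    intro t
    induction t with
    | zero =>
      intro h0
      rw [hstep 0 h0]
      refine (lintegral_mono fun ω => hreset 0 h0 (Nat.zero_mod _) _).trans ?_
      simp
    | succ t ih =>
      intro ht
      rw [hstep _ ht]
      by_cases hmod : (t + 1) % h.tau = 0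
      · refine (lintegral_mono fun ω => hreset _ ht hmod _).trans ?_
        simp [hmod]
      · refine (lintegral_mono fun ω => hinner _ ht hmod _ (norm_query_state_sub_le ha t)).trans ?_
        -- As `t + 1` is no multiple of `tau`, the remainder does not wrap around.
        have e : ((t + 1) % h.tau : ℕ) = t % h.tau + 1 := by
          have h1 := Nat.div_add_mod t h.tau
          have h2 := Nat.mod_lt t htau
          rcases Nat.lt_or_ge (t % h.tau + 1) h.tau with h3 | h3
          · rw [Nat.add_mod, Nat.mod_eq_of_lt (by omega : 1 < h.tau), Nat.mod_eq_of_lt h3]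
          · exfalso
            apply hmod
            have : t + 1 = h.tau * (t / h.tau + 1) := by
              rw [Nat.mul_add]; omega
            rw [this, Nat.mul_mod_right]
        have h4 : ∀ s : State d p, ENNReal.ofReal (err s + D / h.tau)
            = ENNReal.ofReal (err s) + ENNReal.ofReal (D / h.tau) := fun s =>
          ENNReal.ofReal_add (herr0 s) (by positivity)
        simp_rw [h4]
        rw [lintegral_add_right _ measurable_const]
        simp only [lintegral_const, measure_univ, mul_one]
        refine (add_le_add_left (ih (by omega)) _).trans ?_
        rw [← ENNReal.ofReal_add (by positivity) (by positivity), e]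
        refine ENNReal.ofReal_le_ofReal (le_of_eq ?_)
        push_cast
        ring
  refine (key t ht).trans (ENNReal.ofReal_le_ofReal ?_)
  have h1 : ((t % h.tau : ℕ) : ℝ) ≤ h.tau := by exact_mod_cast (Nat.mod_lt t htau).le
  have h2 : ((t % h.tau : ℕ) : ℝ) * (D / h.tau) ≤ h.tau * (D / h.tau) := by gcongr
  have h3 : (h.tau : ℝ) * (D / h.tau) = D := by field_simp
  linarith

end Independence

/-! ### Measurability and sign of the squared errors. -/

section ErrorMeasurability

variable {d p : ℕ} {fbar : E p → ℝ} {gbar : E d → E p} {lf Lf lg Lg : ℝ}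

lemma SmoothPair.measurable_errG (h : SmoothPair fbar gbar lf Lf lg Lg) :
    Measurable (errG gbar) :=
  ((State.measurable_gEst.sub
    (h.g_diff.continuous.measurable.comp State.measurable_zPrev)).norm).pow_const 2

lemma SmoothPair.measurable_errJ (h : SmoothPair fbar gbar lf Lf lg Lg) :
    Measurable (errJ gbar) := by
  have h1 : Measurable fun s : State d p => s.jEst - fderiv ℝ gbar s.zPrev :=
    State.measurable_jEst.sub
      ((continuous_of_lip h.norm_fderiv_sub_le).measurable.comp State.measurable_zPrev)
  have h2 : Measurable fun A : E d →L[ℝ] E p => ‖cols d p A‖ ^ 2 :=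
    ((cols d p).continuous.norm.pow 2).measurable
  exact h2.comp h1

lemma SmoothPair.measurable_errF (h : SmoothPair fbar gbar lf Lf lg Lg) :
    Measurable (errF fbar : State d p → ℝ) :=
  ((State.measurable_fEst.sub
    ((continuous_of_lip h.norm_gradient_sub_le).measurable.comp
      State.measurable_gEst)).norm).pow_const 2

lemma errG_nonneg (s : State d p) : 0 ≤ errG gbar s := by unfold errG; positivity

lemma errJ_nonneg (s : State d p) : 0 ≤ errJ gbar s := by unfold errJ; positivity

lemma errF_nonneg (s : State d p) : 0 ≤ errF fbar s := by unfold errF; positivity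

end ErrorMeasurability

/-! ### Expected errors after one iteration from a fixed state. -/

lemma lintegral_prod_of_fst {X Y : Type*} [MeasurableSpace X] [MeasurableSpace Y] (ρ : Measure X)
    (ρ' : Measure Y) [IsProbabilityMeasure ρ] [IsProbabilityMeasure ρ'] {φ : X → ENNReal}
    (hφ : Measurable φ) : ∫⁻ q, φ q.1 ∂(ρ.prod ρ') = ∫⁻ x, φ x ∂ρ :=
  measurePreserving_fst.lintegral_comp hφ

lemma lintegral_prod_of_snd {X Y : Type*} [MeasurableSpace X] [MeasurableSpace Y] (ρ : Measure X)
    (ρ' : Measure Y) [IsProbabilityMeasure ρ] [IsProbabilityMeasure ρ'] {φ : Y → ENNReal}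
    (hφ : Measurable φ) : ∫⁻ q, φ q.2 ∂(ρ.prod ρ') = ∫⁻ y, φ y ∂ρ' :=
  measurePreserving_snd.lintegral_comp hφ

/-- Used for the outer gradient, whose error depends on the first batch through the inner estimate:
with the first two batches frozen, only the third is random. -/
lemma lintegral_prod_prod_le {X Y Z : Type*} [MeasurableSpace X] [MeasurableSpace Y]
    [MeasurableSpace Z] (ρ : Measure X) (ρ' : Measure Y) (ρ'' : Measure Z)
    [IsProbabilityMeasure ρ] [IsProbabilityMeasure ρ'] [IsProbabilityMeasure ρ'']
    {φ : X × Y × Z → ENNReal} (hφ : Measurable φ) {R : ENNReal}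
    (h : ∀ a a', ∫⁻ b, φ (a, a', b) ∂ρ'' ≤ R) : ∫⁻ q, φ q ∂(ρ.prod (ρ'.prod ρ'')) ≤ R := by
  rw [lintegral_prod _ hφ.aemeasurable]
  have h1 : ∀ a, ∫⁻ q, φ (a, q) ∂(ρ'.prod ρ'') ≤ R := by
    intro a
    have hm : Measurable fun q => φ (a, q) := hφ.comp (measurable_const.prodMk measurable_id)
    rw [lintegral_prod _ hm.aemeasurable]
    exact (lintegral_mono fun a' => h a a').trans (by simp)
  exact (lintegral_mono h1).trans (by simp)

section OneStep

variable {d p : ℕ} {ι κ : Type*} [MeasurableSpace ι] [MeasurableSpace κ]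
  {μ : Measure ι} {ν : Measure κ} [IsProbabilityMeasure μ] [IsProbabilityMeasure ν]
  {f : κ → E p → ℝ} {g : ι → E d → E p} {r Φ : E d → ℝ} {lf Lf lg Lg : ℝ} {h : Hyper} {t : ℕ}
  {mA mA' mB : ℕ} {ρA : Measure (Fin mA → ι)} {ρA' : Measure (Fin mA' → ι)}
  {ρB : Measure (Fin mB → κ)} [IsProbabilityMeasure ρA] [IsProbabilityMeasure ρA']
  [IsProbabilityMeasure ρB]

omit [IsProbabilityMeasure μ] in
lemma lintegral_errG_reset (g_meas : ∀ x, Measurable fun i => g i x) (ht : t % h.tau = 0) {V : ℝ}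
    (hV : ∀ z, ∫⁻ v, ENNReal.ofReal (‖(avg fun i => g (v i) z) - expMean μ g z‖ ^ 2) ∂ρA
      ≤ ENNReal.ofReal V) (s : State d p) :
    ∫⁻ b, ENNReal.ofReal (errG (expMean μ g) (step f g r h t b s)) ∂(ρA.prod (ρA'.prod ρB))
      ≤ ENNReal.ofReal V := by
  simp only [errG, step_gEst, if_pos ht, step_zPrev]
  rw [lintegral_prod_of_fst ρA (ρA'.prod ρB) (φ := fun v : Fin mA → ι => ENNReal.ofReal
    (‖(avg fun i => g (v i) (query h t s)) - expMean μ g (query h t s)‖ ^ 2))]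
  · exact hV _
  · exact (((measurable_avg fun i => (g_meas _).comp (measurable_pi_apply i)).sub_const
      _).norm.pow_const 2).ennreal_ofReal

omit [IsProbabilityMeasure μ] in
lemma lintegral_errJ_reset (hreg : Regular f g r Φ lf Lf lg Lg)
    (g_meas : ∀ x, Measurable fun i => g i x) (ht : t % h.tau = 0) {V : ℝ}
    (hV : ∀ z, ∫⁻ v, ENNReal.ofReal
      (‖cols d p ((avg fun i => fderiv ℝ (g (v i)) z) - fderiv ℝ (expMean μ g) z)‖ ^ 2) ∂ρA'
      ≤ ENNReal.ofReal V) (s : State d p) :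
    ∫⁻ b, ENNReal.ofReal (errJ (expMean μ g) (step f g r h t b s)) ∂(ρA.prod (ρA'.prod ρB))
      ≤ ENNReal.ofReal V := by
  simp only [errJ, step_jEst, if_pos ht, step_zPrev]
  have h2 : Measurable fun A : E d →L[ℝ] E p => ENNReal.ofReal (‖cols d p A‖ ^ 2) :=
    ((cols d p).continuous.norm.pow 2).measurable.ennreal_ofReal
  have hm : Measurable fun v : Fin mA' → ι => ENNReal.ofReal
      (‖cols d p ((avg fun i => fderiv ℝ (g (v i)) (query h t s))
        - fderiv ℝ (expMean μ g) (query h t s))‖ ^ 2) :=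
    h2.comp ((measurable_avg fun i =>
      (measurable_fderiv_index g_meas hreg.g_diff _).comp (measurable_pi_apply i)).sub_const _)
  rw [lintegral_prod_of_snd ρA (ρA'.prod ρB) (φ := fun b : (Fin mA' → ι) × (Fin mB → κ) =>
    ENNReal.ofReal (‖cols d p ((avg fun i => fderiv ℝ (g (b.1 i)) (query h t s))
      - fderiv ℝ (expMean μ g) (query h t s))‖ ^ 2)) (hm.comp measurable_fst),
    lintegral_prod_of_fst ρA' ρB hm]
  exact hV _

-- Once the first batch is frozen, the inner estimate is a fixed point `y`, and `hV` is uniform in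
-- `y`.
omit [IsProbabilityMeasure μ] [IsProbabilityMeasure ν] in
lemma lintegral_errF_reset (hreg : Regular f g r Φ lf Lf lg Lg)
    (hsm : SmoothPair (expMean ν f) (expMean μ g) lf Lf lg Lg)
    (g_meas : ∀ x, Measurable fun i => g i x) (f_meas : ∀ y, Measurable fun k => f k y)
    (hlam : 0 < h.lam t) (ht : t % h.tau = 0) {V : ℝ}
    (hV : ∀ y, ∫⁻ v, ENNReal.ofReal
      (‖(avg fun i => gradient (f (v i)) y) - gradient (expMean ν f) y‖ ^ 2) ∂ρB
      ≤ ENNReal.ofReal V) (s : State d p) :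
    ∫⁻ b, ENNReal.ofReal (errF (expMean ν f) (step f g r h t b s)) ∂(ρA.prod (ρA'.prod ρB))
      ≤ ENNReal.ofReal V := by
  have hm : Measurable fun b : Batch ι κ mA mA' mB =>
      ENNReal.ofReal (errF (expMean ν f) (step f g r h t b s)) :=
    (hsm.measurable_errF.comp
      (hreg.measurable_step g_meas f_meas h hlam measurable_const measurable_id)).ennreal_ofReal
  refine lintegral_prod_prod_le _ _ _ hm fun a a' => ?_
  simp only [errF, step_fEst, step_gEst, if_pos ht]
  exact hV _

lemma add_sq_div_le {K b₁ a : ℝ} {τ m : ℕ} (hτ : 0 < τ) (hb : 0 < b₁) (hm : b₁ * τ ≤ m) :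
    a + (2 * K) ^ 2 / m ≤ a + (2 * K) ^ 2 / b₁ / τ := by
  have : (0 : ℝ) < τ := by exact_mod_cast hτ
  rw [div_div]
  gcongr

lemma pos_of_mul_le {b₁ : ℝ} {τ m : ℕ} (hτ : 0 < τ) (hb : 0 < b₁) (hm : b₁ * τ ≤ m) : 0 < m := by
  have h1 : (0 : ℝ) < τ := by exact_mod_cast hτ
  have h2 : (0 : ℝ) < m := (mul_pos hb h1).trans_le hm
  exact_mod_cast h2

-- The new error is the old error plus a centered batch average of `g(z_t) - g(z_{t-1})`, whose
-- samples are bounded by `lg * δ`.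
omit [IsProbabilityMeasure μ] in
lemma lintegral_errG_inner (hreg : Regular f g r Φ lf Lf lg Lg)
    (g_meas : ∀ x, Measurable fun i => g i x) (g_int : ∀ x, Integrable (fun i => g i x) μ)
    (hτ : 0 < h.tau) (ht : t % h.tau ≠ 0) (hρ : IsBatchLaw μ ρA) {b₁ : ℝ} (hb : 0 < b₁)
    (hm : b₁ * h.tau ≤ mA) {δ : ℝ} (s : State d p) (hs : ‖query h t s - s.zPrev‖ ≤ δ) :
    ∫⁻ b, ENNReal.ofReal (errG (expMean μ g) (step f g r h t b s)) ∂(ρA.prod (ρA'.prod ρB))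
      ≤ ENNReal.ofReal (errG (expMean μ g) s + (2 * (lg * δ)) ^ 2 / b₁ / h.tau) := by
  refine le_trans (le_of_eq ?_) ((hρ.lintegral_norm_sq_avg_sub_le_of_bound
    (u := fun i => g i (query h t s) - g i s.zPrev) (K := lg * δ)
    (pos_of_mul_le hτ hb hm) ((g_meas _).sub (g_meas _)).aestronglyMeasurable (fun i =>
      (hreg.g_lip i _ _).trans (mul_le_mul_of_nonneg_left hs hreg.lg_pos.le))
    (s.gEst - expMean μ g s.zPrev)).trans (ENNReal.ofReal_le_ofReal (add_sq_div_le hτ hb hm)))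
  rw [integral_sub (g_int _) (g_int _)]
  simp only [errG, step_gEst, if_neg ht, step_zPrev]
  rw [← lintegral_prod_of_fst ρA (ρA'.prod ρB)]
  · refine lintegral_congr fun b => ?_
    congr 3
    unfold expMean
    abel
  · exact ((((measurable_avg fun i => ((g_meas _).sub (g_meas _)).comp
      (measurable_pi_apply i)).sub_const _).const_add _).norm.pow_const 2).ennreal_ofReal

lemma map_avg {V W : Type*} [NormedAddCommGroup V] [NormedSpace ℝ V] [NormedAddCommGroup W]
    [NormedSpace ℝ W] (L : V →L[ℝ] W) {m : ℕ} (v : Fin m → V) :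
    L (avg v) = avg fun i => L (v i) := by
  simp [avg]

/-- The same recursion as for `errG`, carried out on columns so that the variance bound applies in a
Hilbert space. -/
lemma lintegral_errJ_inner (hreg : Regular f g r Φ lf Lf lg Lg)
    (g_meas : ∀ x, Measurable fun i => g i x) (g_int : ∀ x, Integrable (fun i => g i x) μ)
    (hτ : 0 < h.tau) (ht : t % h.tau ≠ 0) (hρ : IsBatchLaw μ ρA') {b₁ : ℝ} (hb : 0 < b₁)
    (hm : b₁ * h.tau ≤ mA') {δ : ℝ} (s : State d p) (hs : ‖query h t s - s.zPrev‖ ≤ δ) :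
    ∫⁻ b, ENNReal.ofReal (errJ (expMean μ g) (step f g r h t b s)) ∂(ρA.prod (ρA'.prod ρB))
      ≤ ENNReal.ofReal (errJ (expMean μ g) s + (2 * (Lg * δ)) ^ 2 / b₁ / h.tau) := by
  have hJm := measurable_fderiv_index g_meas hreg.g_diff
  have hJi := integrable_fderiv_index (μ := μ) hreg.lg_pos.le g_meas hreg.g_diff hreg.g_lip
  have hJc : ∫ i, cols d p (fderiv ℝ (g i) (query h t s) - fderiv ℝ (g i) s.zPrev) ∂μ
      = cols d p (∫ i, (fderiv ℝ (g i) (query h t s) - fderiv ℝ (g i) s.zPrev) ∂μ) :=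
    (cols d p).integral_comp_comm ((hJi _).sub (hJi _))
  have hJd : ∀ x, fderiv ℝ (expMean μ g) x = ∫ i, fderiv ℝ (g i) x ∂μ := fun x =>
    (hasFDerivAt_expMean g_meas g_int hreg.g_diff hreg.g_lip x).fderiv
  refine le_trans (le_of_eq ?_) ((hρ.lintegral_norm_sq_avg_sub_le_of_bound
    (u := fun i => cols d p (fderiv ℝ (g i) (query h t s) - fderiv ℝ (g i) s.zPrev))
    (K := Lg * δ) (pos_of_mul_le hτ hb hm)
    ((cols d p).continuous.comp_aestronglyMeasurable ((hJm _).sub (hJm _)).aestronglyMeasurable)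
    (fun i => by
      rw [norm_cols]
      exact (hreg.g_jac_lip i _ _).trans (mul_le_mul_of_nonneg_left hs hreg.Lg_pos.le))
    (cols d p (s.jEst - fderiv ℝ (expMean μ g) s.zPrev))).trans
      (ENNReal.ofReal_le_ofReal (add_sq_div_le hτ hb hm)))
  rw [hJc, integral_sub (hJi _) (hJi _),
    ← hJd, ← hJd]
  simp only [errJ, step_jEst, if_neg ht, step_zPrev]
  have h2 : Measurable fun A : E d →L[ℝ] E p => ENNReal.ofReal (‖cols d p A‖ ^ 2) :=
    ((cols d p).continuous.norm.pow 2).measurable.ennreal_ofReal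
  have hme : Measurable fun v : Fin mA' → ι => ENNReal.ofReal (‖cols d p (s.jEst +
      (avg fun i => fderiv ℝ (g (v i)) (query h t s) - fderiv ℝ (g (v i)) s.zPrev)
        - fderiv ℝ (expMean μ g) (query h t s))‖ ^ 2) :=
    h2.comp (((measurable_avg fun i => ((hJm _).sub (hJm _)).comp
      (measurable_pi_apply i)).const_add _).sub_const _)
  rw [lintegral_prod_of_snd ρA (ρA'.prod ρB) (φ := fun b : (Fin mA' → ι) × (Fin mB → κ) =>
    ENNReal.ofReal (‖cols d p (s.jEst + (avg fun i => fderiv ℝ (g (b.1 i)) (query h t s)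
      - fderiv ℝ (g (b.1 i)) s.zPrev) - fderiv ℝ (expMean μ g) (query h t s))‖ ^ 2))
      (hme.comp measurable_fst), lintegral_prod_of_fst ρA' ρB hme]
  refine lintegral_congr fun v => ?_
  rw [← map_avg, ← map_sub, ← map_add]
  congr 4
  abel

-- With the first batch frozen, the inner estimate has moved by at most `lg * δ`, as it is updated
-- by an average of increments. So each sampled gradient difference is bounded by `Lf * (lg * δ)`.
omit [IsProbabilityMeasure μ] in
lemma lintegral_errF_inner (hreg : Regular f g r Φ lf Lf lg Lg)
    (hsm : SmoothPair (expMean ν f) (expMean μ g) lf Lf lg Lg)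
    (g_meas : ∀ x, Measurable fun i => g i x) (f_meas : ∀ y, Measurable fun k => f k y)
    (f_int : ∀ y, Integrable (fun k => f k y) ν) (hlam : 0 < h.lam t)
    (hτ : 0 < h.tau) (ht : t % h.tau ≠ 0) (hρ : IsBatchLaw ν ρB) {b₁ : ℝ} (hb : 0 < b₁)
    (hm : b₁ * h.tau ≤ mB) {δ : ℝ} (s : State d p) (hs : ‖query h t s - s.zPrev‖ ≤ δ) :
    ∫⁻ b, ENNReal.ofReal (errF (expMean ν f) (step f g r h t b s)) ∂(ρA.prod (ρA'.prod ρB))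
      ≤ ENNReal.ofReal (errF (expMean ν f) s + (2 * (Lf * (lg * δ))) ^ 2 / b₁ / h.tau) := by
  have hfm := measurable_gradient_index f_meas hreg.f_diff
  have hfi : ∀ y, Integrable (fun k => gradient (f k) y) ν := fun y =>
    Integrable.of_bound (hfm y).aestronglyMeasurable lf
      (ae_of_all _ fun k => norm_gradient_le_of_lip hreg.lf_pos.le (hreg.f_lip k) y)
  have hfd := integral_gradient (μ := ν) f_meas f_int hreg.f_diff hreg.f_lip
  have hme : Measurable fun b : Batch ι κ mA mA' mB =>
      ENNReal.ofReal (errF (expMean ν f) (step f g r h t b s)) :=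
    (hsm.measurable_errF.comp
      (hreg.measurable_step g_meas f_meas h hlam measurable_const measurable_id)).ennreal_ofReal
  refine lintegral_prod_prod_le _ _ _ hme fun a a' => ?_
  set y := s.gEst + avg fun i => g (a i) (query h t s) - g (a i) s.zPrev with hy
  have hyG : ∀ b, (step f g r h t ((a, a', b) : Batch ι κ mA mA' mB) s).gEst = y := fun b => by
    rw [step_gEst, if_neg ht]
  have hd : ‖y - s.gEst‖ ≤ lg * δ := by
    rw [hy, add_sub_cancel_left]
    exact norm_avg_le (mul_nonneg hreg.lg_pos.le ((norm_nonneg _).trans hs)) fun i =>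
      (hreg.g_lip _ _ _).trans (mul_le_mul_of_nonneg_left hs hreg.lg_pos.le)
  refine le_trans (le_of_eq ?_) ((hρ.lintegral_norm_sq_avg_sub_le_of_bound
    (u := fun k => gradient (f k) y - gradient (f k) s.gEst) (K := Lf * (lg * δ))
    (pos_of_mul_le hτ hb hm) ((hfm _).sub (hfm _)).aestronglyMeasurable (fun k =>
      (hreg.f_grad_lip k _ _).trans (mul_le_mul_of_nonneg_left hd hreg.Lf_pos.le))
    (s.fEst - gradient (expMean ν f) s.gEst)).trans
      (ENNReal.ofReal_le_ofReal (add_sq_div_le hτ hb hm)))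
  rw [integral_sub (hfi _) (hfi _), ← hfd, ← hfd]
  refine lintegral_congr fun b => ?_
  rw [errF, step_fEst, hyG, if_neg ht]
  congr 3
  abel

end OneStep

/-- A sampling whose estimators have controlled second moments: after a reset the errors of the
three estimators have the order of `ε`, and otherwise the batches have size at least `b₁ tau` and
are nonpositively correlated. -/
structure IsControlledSampling {d p : ℕ} {Ω ι κ : Type*} [MeasurableSpace Ω] [MeasurableSpace ι]
    [MeasurableSpace κ] (P : Measure Ω) (μ : Measure ι) (ν : Measure κ)
    (f : κ → E p → ℝ) (g : ι → E d → E p) (lf Lf lg b₁ ε : ℝ) (tau T : ℕ) (m : BatchSizes)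
    (lawA : ∀ t, Measure (Fin (m.A t) → ι)) (lawA' : ∀ t, Measure (Fin (m.A' t) → ι))
    (lawB : ∀ t, Measure (Fin (m.B t) → κ))
    (S : ∀ t, Ω → Batch ι κ (m.A t) (m.A' t) (m.B t)) (ζ : Ω → Fin T) : Prop where
  sampling : IsSampling P T m lawA lawA' lawB S ζ
  prob_A : ∀ t < T, IsProbabilityMeasure (lawA t)
  prob_A' : ∀ t < T, IsProbabilityMeasure (lawA' t)
  prob_B : ∀ t < T, IsProbabilityMeasure (lawB t)
  inner_A : ∀ t < T, t % tau ≠ 0 → IsBatchLaw μ (lawA t) ∧ b₁ * tau ≤ m.A t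
  inner_A' : ∀ t < T, t % tau ≠ 0 → IsBatchLaw μ (lawA' t) ∧ b₁ * tau ≤ m.A' t
  inner_B : ∀ t < T, t % tau ≠ 0 → IsBatchLaw ν (lawB t) ∧ b₁ * tau ≤ m.B t
  reset_A : ∀ t < T, t % tau = 0 → ∀ z,
    ∫⁻ v, ENNReal.ofReal (‖(avg fun i => g (v i) z) - expMean μ g z‖ ^ 2) ∂(lawA t)
      ≤ ENNReal.ofReal ((ε / (lg * Lf)) ^ 2 / b₁)
  reset_A' : ∀ t < T, t % tau = 0 → ∀ z,
    ∫⁻ v, ENNReal.ofReal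
      (‖cols d p ((avg fun i => fderiv ℝ (g (v i)) z) - fderiv ℝ (expMean μ g) z)‖ ^ 2) ∂(lawA' t)
      ≤ ENNReal.ofReal ((ε / lf) ^ 2 / b₁)
  reset_B : ∀ t < T, t % tau = 0 → ∀ y,
    ∫⁻ v, ENNReal.ofReal
      (‖(avg fun i => gradient (f (v i)) y) - gradient (expMean ν f) y‖ ^ 2) ∂(lawB t)
      ≤ ENNReal.ofReal ((ε / lg) ^ 2 / b₁)

/-- The constant of the convergence bound. -/
noncomputable def rateConst (c₁ c₂ b₁ : ℝ) : ℝ :=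
  1 / c₁ + (6 * c₂ + 6 + 15 * ((1 + 16 * c₂ ^ 2) / b₁))

/-! ### Expected total error and convergence at the random time `ζ`. -/

section Random

variable {d p : ℕ} {ι κ : Type*} [MeasurableSpace ι] [MeasurableSpace κ] {f : κ → E p → ℝ}
  {g : ι → E d → E p} {r Φ : E d → ℝ} {lf Lf lg Lg : ℝ} {h : Hyper} {x0 : E d}
  {Ω : Type*} [mΩ : MeasurableSpace Ω] {P : Measure Ω} {T : ℕ} {m : BatchSizes}
  {S : ∀ t, Ω → Batch ι κ (m.A t) (m.A' t) (m.B t)} {ζ : Ω → Fin T}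

omit mΩ in
lemma past_le_comap :
    past S T T ≤ MeasurableSpace.comap (fun ω (t : Fin T) => S t ω) inferInstance := by
  refine iSup₂_le fun i _ => ?_
  exact ((measurable_pi_apply i).comp
    (comap_measurable (fun ω (t : Fin T) => S t ω))).comap_le

/-- Expectation of a quantity at a uniformly random time. -/
lemma lintegral_uniform_time [IsProbabilityMeasure P]
    {lawA : ∀ t, Measure (Fin (m.A t) → ι)} {lawA' : ∀ t, Measure (Fin (m.A' t) → ι)}
    {lawB : ∀ t, Measure (Fin (m.B t) → κ)} (hS : IsSampling P T m lawA lawA' lawB S ζ)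
    {H : ℕ → Ω → ENNReal} (hH : ∀ t < T, Measurable[past S T T] (H t)) :
    ∫⁻ ω, H (ζ ω) ω ∂P = (T : ENNReal)⁻¹ * ∫⁻ ω, ∑ t ∈ Finset.range T, H t ω ∂P := by
  have hle : past S T T ≤ mΩ := past_le hS.meas T
  have hHm : ∀ t < T, Measurable (H t) := fun t ht => (hH t ht).mono hle le_rfl
  -- Splitting by the value of `ζ` makes each term a product of independent factors, and each event
  -- `ζ = t` has probability `1 / T`.
  have e : ∀ ω, H (ζ ω) ω = ∑ t : Fin T, Set.indicator (ζ ⁻¹' {t}) 1 ω * H t ω := by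
    intro ω
    rw [Finset.sum_eq_single (ζ ω)]
    · simp
    · intro t _ ht
      rw [Set.indicator_of_notMem (by simpa using ht.symm), zero_mul]
    · simp
  have hset : ∀ t, MeasurableSet (ζ ⁻¹' {t}) := fun t => hS.zeta_meas (MeasurableSet.singleton t)
  have hterm : ∀ t : Fin T, Measurable fun ω =>
      Set.indicator (ζ ⁻¹' {t}) (1 : Ω → ENNReal) ω * H t ω := fun t =>
    (measurable_one.indicator (hset t)).mul (hHm t t.2)
  simp_rw [e]
  rw [lintegral_finsetSum _ fun t _ => hterm t,
    lintegral_finsetSum _ fun t ht => hHm t (Finset.mem_range.1 ht),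
    Finset.sum_range fun t => ∫⁻ ω, H t ω ∂P, Finset.mul_sum]
  refine Finset.sum_congr rfl fun t _ => ?_
  have hind : Indep (MeasurableSpace.comap ζ inferInstance) (past S T T) P :=
    indep_of_indep_of_le_right hS.zeta_indep past_le_comap
  have h1 : Measurable[MeasurableSpace.comap ζ inferInstance]
      (Set.indicator (ζ ⁻¹' {t}) (1 : Ω → ENNReal)) :=
    ((measurable_one (α := ENNReal) (β := Fin T)).indicator (MeasurableSet.singleton t)).comp
      (comap_measurable ζ)
  rw [lintegral_mul_eq_lintegral_mul_lintegral_of_independent_measurableSpace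
    hS.zeta_meas.comap_le hle hind h1 (hH t t.2), lintegral_indicator_one (hset t),
    ← Measure.map_apply hS.zeta_meas (MeasurableSet.singleton t), hS.zeta_law,
    uniformOn_univ_singleton, Fintype.card_fin]

lemma measurable_time_of_measurable {X : Type*} [MeasurableSpace X] {u : ℕ → Ω → X}
    (hζ : Measurable ζ) (hu : ∀ t < T, Measurable (u t)) : Measurable fun ω => u (ζ ω) ω :=
  (measurable_from_prod_countable_right (f := fun q : Fin T × Ω => u q.1 q.2)
    fun t => hu t t.2).comp (hζ.prodMk measurable_id)

variable {μ : Measure ι} {ν : Measure κ} [IsProbabilityMeasure μ] [IsProbabilityMeasure ν]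

/-- The recursion is applied to each of the three errors with `δ = 2 ε β`. The weights in `errTotal`
cancel the powers of `ε` and the Lipschitz constants, apart from products with `β` that are at most
`LF * β ≤ c₂`. -/
lemma lintegral_errTotal_le [IsProbabilityMeasure P] (hreg : Regular f g r Φ lf Lf lg Lg)
    (g_meas : ∀ x, Measurable fun i => g i x) (f_meas : ∀ y, Measurable fun k => f k y)
    (g_int : ∀ x, Integrable (fun i => g i x) μ) (f_int : ∀ y, Integrable (fun k => f k y) ν)
    {α β : ℝ} (ha : Admissible h α β) (htau : 0 < h.tau)
    {c₂ b₁ : ℝ} (hb : 0 < b₁) (hc₂ : LF lf Lf lg Lg * β ≤ c₂)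
    {lawA : ∀ t, Measure (Fin (m.A t) → ι)} {lawA' : ∀ t, Measure (Fin (m.A' t) → ι)}
    {lawB : ∀ t, Measure (Fin (m.B t) → κ)}
    (hS : IsControlledSampling P μ ν f g lf Lf lg b₁ h.eps h.tau T m lawA lawA' lawB S ζ)
    {t : ℕ} (ht : t < T) :
    ∫⁻ ω, ENNReal.ofReal (errTotal (expMean ν f) (expMean μ g) lf Lf lg h.eps
      (state f g r h x0 (fun t => S t ω) (t + 1))) ∂P
      ≤ ENNReal.ofReal (5 * ((1 + 16 * c₂ ^ 2) / b₁)) := by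
  have hsm := hreg.smoothPair (μ := μ) (ν := ν) g_meas f_meas g_int f_int
  have he := ha.eps_pos
  have hβ := ha.beta_pos
  have hlf := hreg.lf_pos
  have hLf := hreg.Lf_pos
  have hlg := hreg.lg_pos
  have hLg := hreg.Lg_pos
  have hstm : Measurable fun ω => state f g r h x0 (fun t => S t ω) (t + 1) :=
    (measurable_state_past hreg g_meas f_meas ha.lam_pos ht).mono (past_le hS.sampling.meas _) le_rfl
  have k1 : ∫⁻ ω, ENNReal.ofReal (errG (expMean μ g)
      (state f g r h x0 (fun t => S t ω) (t + 1))) ∂P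
      ≤ ENNReal.ofReal ((h.eps / (lg * Lf)) ^ 2 / b₁ + (2 * (lg * (2 * (h.eps * β)))) ^ 2 / b₁) := by
    refine lintegral_err_le hreg g_meas f_meas ha hS.sampling.meas hS.sampling.indep htau
      hsm.measurable_errG errG_nonneg (by positivity) (by positivity)
      (fun t ht hmod s => ?_) (fun t ht hmod s hs => ?_) ht
    all_goals
      have := hS.prob_A t ht
      have := hS.prob_A' t ht
      have := hS.prob_B t ht
      rw [hS.sampling.law t ht]
    · exact lintegral_errG_reset g_meas hmod (hS.reset_A t ht hmod) s
    · exact lintegral_errG_inner hreg g_meas g_int htau hmod (hS.inner_A t ht hmod).1 hb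
        (hS.inner_A t ht hmod).2 s hs
  have k2 : ∫⁻ ω, ENNReal.ofReal (errJ (expMean μ g)
      (state f g r h x0 (fun t => S t ω) (t + 1))) ∂P
      ≤ ENNReal.ofReal ((h.eps / lf) ^ 2 / b₁ + (2 * (Lg * (2 * (h.eps * β)))) ^ 2 / b₁) := by
    refine lintegral_err_le hreg g_meas f_meas ha hS.sampling.meas hS.sampling.indep htau
      hsm.measurable_errJ errJ_nonneg (by positivity) (by positivity)
      (fun t ht hmod s => ?_) (fun t ht hmod s hs => ?_) ht
    all_goals
      have := hS.prob_A t ht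
      have := hS.prob_A' t ht
      have := hS.prob_B t ht
      rw [hS.sampling.law t ht]
    · exact lintegral_errJ_reset hreg g_meas hmod (hS.reset_A' t ht hmod) s
    · exact lintegral_errJ_inner hreg g_meas g_int htau hmod (hS.inner_A' t ht hmod).1 hb
        (hS.inner_A' t ht hmod).2 s hs
  have k3 : ∫⁻ ω, ENNReal.ofReal (errF (expMean ν f)
      (state f g r h x0 (fun t => S t ω) (t + 1))) ∂P
      ≤ ENNReal.ofReal ((h.eps / lg) ^ 2 / b₁
        + (2 * (Lf * (lg * (2 * (h.eps * β))))) ^ 2 / b₁) := by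
    refine lintegral_err_le hreg g_meas f_meas ha hS.sampling.meas hS.sampling.indep htau
      hsm.measurable_errF errF_nonneg (by positivity) (by positivity)
      (fun t ht hmod s => ?_) (fun t ht hmod s hs => ?_) ht
    all_goals
      have := hS.prob_A t ht
      have := hS.prob_A' t ht
      have := hS.prob_B t ht
      rw [hS.sampling.law t ht]
    · exact lintegral_errF_reset hreg hsm g_meas f_meas (ha.lam_pos t) hmod (hS.reset_B t ht hmod) s
    · exact lintegral_errF_inner hreg hsm g_meas f_meas f_int (ha.lam_pos t) htau hmod
        (hS.inner_B t ht hmod).1 hb (hS.inner_B t ht hmod).2 s hs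
  have hJm : Measurable fun ω => ENNReal.ofReal (errJ (expMean μ g)
      (state f g r h x0 (fun t => S t ω) (t + 1))) :=
    (hsm.measurable_errJ.comp hstm).ennreal_ofReal
  have hFm : Measurable fun ω => ENNReal.ofReal (errF (expMean ν f)
      (state f g r h x0 (fun t => S t ω) (t + 1))) :=
    (hsm.measurable_errF.comp hstm).ennreal_ofReal
  have hGm : Measurable fun ω => ENNReal.ofReal (errG (expMean μ g)
      (state f g r h x0 (fun t => S t ω) (t + 1))) :=
    (hsm.measurable_errG.comp hstm).ennreal_ofReal
  have split : ∀ s : State d p,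
      ENNReal.ofReal (errTotal (expMean ν f) (expMean μ g) lf Lf lg h.eps s)
        = ENNReal.ofReal ((lf / h.eps) ^ 2) * ENNReal.ofReal (errJ (expMean μ g) s)
          + (ENNReal.ofReal (2 * (lg / h.eps) ^ 2) * ENNReal.ofReal (errF (expMean ν f) s)
          + ENNReal.ofReal (2 * (lg * Lf / h.eps) ^ 2) * ENNReal.ofReal (errG (expMean μ g) s)) := by
    intro s
    have a1 := errJ_nonneg (gbar := expMean μ g) s
    have a2 := errF_nonneg (fbar := expMean ν f) s
    have a3 := errG_nonneg (gbar := expMean μ g) s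
    rw [errTotal, ENNReal.ofReal_add (by positivity) (by positivity),
      ENNReal.ofReal_add (by positivity) (by positivity),
      ENNReal.ofReal_mul (p := (lf / h.eps) ^ 2) (by positivity),
      ENNReal.ofReal_mul (p := 2 * (lg / h.eps) ^ 2) (by positivity),
      ENNReal.ofReal_mul (p := 2 * (lg * Lf / h.eps) ^ 2) (by positivity)]
  simp_rw [split]
  rw [lintegral_add_left (hJm.const_mul _), lintegral_add_left (hFm.const_mul _),
    lintegral_const_mul _ hJm, lintegral_const_mul _ hFm, lintegral_const_mul _ hGm]
  refine (add_le_add (mul_le_mul_right k2 _)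
    (add_le_add (mul_le_mul_right k3 _) (mul_le_mul_right k1 _))).trans ?_
  rw [← ENNReal.ofReal_mul (by positivity), ← ENNReal.ofReal_mul (by positivity),
    ← ENNReal.ofReal_mul (by positivity), ← ENNReal.ofReal_add (by positivity) (by positivity),
    ← ENNReal.ofReal_add (by positivity) (by positivity)]
  refine ENNReal.ofReal_le_ofReal ?_
  have q1 : lf * Lg * β ≤ c₂ := by
    refine le_trans ?_ hc₂
    unfold LF
    have : 0 ≤ lg ^ 2 * Lf * β := by positivity
    linarith
  have q2 : lg ^ 2 * Lf * β ≤ c₂ := by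
    refine le_trans ?_ hc₂
    unfold LF
    have : 0 ≤ lf * Lg * β := by positivity
    linarith
  have q1' : (lf * Lg * β) ^ 2 ≤ c₂ ^ 2 := pow_le_pow_left₀ (by positivity) q1 2
  have q2' : (lg ^ 2 * Lf * β) ^ 2 ≤ c₂ ^ 2 := pow_le_pow_left₀ (by positivity) q2 2
  -- The factor `16 = (2 * 2) ^ 2` combines the centering and the displacement `2 ε β`. The three
  -- errors carry weights `1`, `2` and `2`, whence the factor `5`.
  have e1 : (lf / h.eps) ^ 2 * ((h.eps / lf) ^ 2 / b₁ + (2 * (Lg * (2 * (h.eps * β)))) ^ 2 / b₁)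
      = (1 + 16 * (lf * Lg * β) ^ 2) / b₁ := by
    field_simp; ring
  have e2 : 2 * (lg / h.eps) ^ 2 * ((h.eps / lg) ^ 2 / b₁
      + (2 * (Lf * (lg * (2 * (h.eps * β))))) ^ 2 / b₁)
      = 2 * ((1 + 16 * (lg ^ 2 * Lf * β) ^ 2) / b₁) := by
    field_simp; ring
  have e3 : 2 * (lg * Lf / h.eps) ^ 2 * ((h.eps / (lg * Lf)) ^ 2 / b₁
      + (2 * (lg * (2 * (h.eps * β)))) ^ 2 / b₁)
      = 2 * ((1 + 16 * (lg ^ 2 * Lf * β) ^ 2) / b₁) := by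
    field_simp; ring
  rw [e1, e2, e3]
  have w1 : (1 + 16 * (lf * Lg * β) ^ 2) / b₁ ≤ (1 + 16 * c₂ ^ 2) / b₁ := by gcongr
  have w2 : (1 + 16 * (lg ^ 2 * Lf * β) ^ 2) / b₁ ≤ (1 + 16 * c₂ ^ 2) / b₁ := by gcongr
  linarith

lemma continuous_gradMap {F : E d → ℝ} {lam : ℝ} (hlam : 0 < lam) (hr : ConvexOn ℝ Set.univ r)
    (hF : Continuous (gradient F)) : Continuous (gradMap F r lam) := by
  unfold gradMap
  exact (continuous_id.sub ((continuous_prox hlam hr).comp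
    (continuous_id.sub (hF.const_smul lam)))).const_smul (1 / lam)

/-- Convergence of MVRC-2 for a controlled sampling. -/
theorem integral_outputNorm_le [IsProbabilityMeasure P]
    (hreg : Regular f g r (objective (expMean ν f) (expMean μ g) r) lf Lf lg Lg)
    (g_meas : ∀ x, Measurable fun i => g i x) (f_meas : ∀ y, Measurable fun k => f k y)
    (g_int : ∀ x, Integrable (fun i => g i x) μ) (f_int : ∀ y, Integrable (fun k => f k y) ν)
    {α β : ℝ} (ha : Admissible h α β) (htau : 0 < h.tau) (hε : h.eps ≤ lf * lg)
    {c₁ c₂ b₁ : ℝ} (hb : 0 < b₁) (hc₁ : 0 < c₁) (hc₁' : c₁ ≤ LF lf Lf lg Lg * β)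
    (hc₂ : LF lf Lf lg Lg * β ≤ c₂) (hT : 0 < T)
    {lawA : ∀ t, Measure (Fin (m.A t) → ι)} {lawA' : ∀ t, Measure (Fin (m.A' t) → ι)}
    {lawB : ∀ t, Measure (Fin (m.B t) → κ)}
    (hS : IsControlledSampling P μ ν f g lf Lf lg b₁ h.eps h.tau T m lawA lawA' lawB S ζ) :
    Integrable (outputNorm f g (fun x => expMean ν f (expMean μ g x)) r h x0 S ζ) P ∧
    ∫ ω, outputNorm f g (fun x => expMean ν f (expMean μ g x)) r h x0 S ζ ω ∂P ≤
      rateConst c₁ c₂ b₁ * (h.eps + LF lf Lf lg Lg *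
        gap (objective (expMean ν f) (expMean μ g) r) x0 / (h.eps * T)) := by
  have hsm := hreg.smoothPair (μ := μ) (ν := ν) g_meas f_meas g_int f_int
  have he := ha.eps_pos
  have hT' : (0 : ℝ) < T := by exact_mod_cast hT
  have hc₂0 : 0 ≤ c₂ := hc₁.le.trans (hc₁'.trans hc₂)
  set G := LF lf Lf lg Lg * gap (objective (expMean ν f) (expMean μ g) r) x0 with hG
  have hG0 : 0 ≤ G := mul_nonneg hsm.LF_pos.le (sub_nonneg.2 (ciInf_le hreg.bddBelow _))
  set K := (1 + 16 * c₂ ^ 2) / b₁ with hK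
  have hK0 : 0 ≤ K := by positivity
  set N : ℕ → Ω → ℝ := fun t ω => ‖gradMap (fun x => expMean ν f (expMean μ g x)) r (h.lam t)
    (iterZ f g r h x0 (fun t => S t ω) t)‖ with hN
  set W : ℕ → Ω → ℝ := fun t ω => errTotal (expMean ν f) (expMean μ g) lf Lf lg h.eps
    (state f g r h x0 (fun t => S t ω) (t + 1)) with hW
  have hW0 : ∀ t ω, 0 ≤ W t ω := fun t ω => by
    have a1 := errJ_nonneg (gbar := expMean μ g) (state f g r h x0 (fun t => S t ω) (t + 1))
    have a2 := errF_nonneg (fbar := expMean ν f) (state f g r h x0 (fun t => S t ω) (t + 1))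
    have a3 := errG_nonneg (gbar := expMean μ g) (state f g r h x0 (fun t => S t ω) (t + 1))
    simp only [hW, errTotal]
    positivity
  have hNm : ∀ t < T, Measurable[past S T T] (N t) := fun t ht => by
    have h1 := (measurable_state_past (x0 := x0) (S := S) hreg g_meas f_meas ha.lam_pos
      ht.le).mono (past_mono ht.le) le_rfl
    have h2 : Measurable fun z => ‖gradMap (fun x => expMean ν f (expMean μ g x)) r (h.lam t) z‖ :=
      (continuous_gradMap (ha.lam_pos t) hreg.r_convex
        (continuous_of_lip hsm.norm_gradient_comp_sub_le)).norm.measurable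
    exact (h2.comp (measurable_query h t)).comp h1
  have hNm' : ∀ t < T, Measurable (N t) := fun t ht =>
    (hNm t ht).mono (past_le hS.sampling.meas T) le_rfl
  have hout : outputNorm f g (fun x => expMean ν f (expMean μ g x)) r h x0 S ζ
      = fun ω => N (ζ ω) ω := rfl
  have hmeas : Measurable fun ω => N (ζ ω) ω :=
    measurable_time_of_measurable hS.sampling.zeta_meas hNm'
  have hWm : ∀ t < T, Measurable fun ω => ENNReal.ofReal (W t ω) := fun t ht => by
    have hstm : Measurable fun ω => state f g r h x0 (fun t => S t ω) (t + 1) :=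
      (measurable_state_past hreg g_meas f_meas ha.lam_pos ht).mono
        (past_le hS.sampling.meas _) le_rfl
    have : Measurable (errTotal (expMean ν f) (expMean μ g) lf Lf lg h.eps) :=
      (hsm.measurable_errJ.const_mul _).add
        ((hsm.measurable_errF.const_mul _).add (hsm.measurable_errG.const_mul _))
    exact (this.comp hstm).ennreal_ofReal
  have hsum : ∫⁻ ω, ∑ t ∈ Finset.range T, ENNReal.ofReal (N t ω) ∂P
      ≤ ENNReal.ofReal (G / (c₁ * h.eps) + T * (3 * h.eps * (5 * K) + (6 * c₂ + 6) * h.eps)) := by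
    have hpt : ∀ ω, ∑ t ∈ Finset.range T, ENNReal.ofReal (N t ω)
        ≤ ENNReal.ofReal (G / (c₁ * h.eps)) + ∑ t ∈ Finset.range T,
          (ENNReal.ofReal (3 * h.eps) * ENNReal.ofReal (W t ω)
            + ENNReal.ofReal ((6 * c₂ + 6) * h.eps)) := by
      intro ω
      rw [← ENNReal.ofReal_sum_of_nonneg fun t _ => norm_nonneg _]
      refine (ENNReal.ofReal_le_ofReal (sum_norm_gradMap_le hsm hreg.r_convex ha hreg.bddBelow hε
        hc₁ hc₁' hc₂ T)).trans ?_
      have hs0 : ∀ t ∈ Finset.range T, 0 ≤ 3 * h.eps * W t ω + (6 * c₂ + 6) * h.eps :=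
        fun t _ => add_nonneg (mul_nonneg (by positivity) (hW0 t ω)) (by positivity)
      rw [ENNReal.ofReal_add (by positivity) (Finset.sum_nonneg hs0),
        ENNReal.ofReal_sum_of_nonneg hs0]
      refine add_le_add_right (Finset.sum_le_sum fun t _ => ?_) _
      rw [ENNReal.ofReal_add (mul_nonneg (by positivity) (hW0 t ω)) (by positivity),
        ENNReal.ofReal_mul (by positivity)]
    refine (lintegral_mono hpt).trans ?_
    rw [lintegral_add_left measurable_const, lintegral_finsetSum _ fun t ht =>
      ((hWm t (Finset.mem_range.1 ht)).const_mul _).add_const _]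
    have hterm : ∀ t ∈ Finset.range T, ∫⁻ ω, (ENNReal.ofReal (3 * h.eps) * ENNReal.ofReal (W t ω)
            + ENNReal.ofReal ((6 * c₂ + 6) * h.eps)) ∂P
          ≤ ENNReal.ofReal (3 * h.eps * (5 * K) + (6 * c₂ + 6) * h.eps) := by
      intro t ht
      have ht := Finset.mem_range.1 ht
      rw [lintegral_add_right _ measurable_const, lintegral_const_mul _ (hWm t ht),
        ENNReal.ofReal_add (by positivity) (by positivity),
        ENNReal.ofReal_mul (p := 3 * h.eps) (by positivity)]
      refine add_le_add (mul_le_mul_right (lintegral_errTotal_le hreg g_meas f_meas g_int f_int ha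
        htau hb hc₂ hS ht) _) (by simp)
    refine (add_le_add_right (Finset.sum_le_sum hterm) _).trans ?_
    rw [ENNReal.ofReal_add (p := G / (c₁ * h.eps)) (by positivity) (by positivity),
      ENNReal.ofReal_mul (p := (T : ℝ)) (by positivity), ENNReal.ofReal_natCast, Finset.sum_const,
      Finset.card_range, nsmul_eq_mul, lintegral_const, measure_univ, mul_one]
  have hfinal : ∫⁻ ω, ENNReal.ofReal (N (ζ ω) ω) ∂P
      ≤ ENNReal.ofReal (rateConst c₁ c₂ b₁ * (h.eps + G / (h.eps * T))) := by
    rw [lintegral_uniform_time hS.sampling (H := fun t ω => ENNReal.ofReal (N t ω))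
      fun t ht => (hNm t ht).ennreal_ofReal]
    refine (mul_le_mul_right hsum _).trans ?_
    have hTinv : (T : ENNReal)⁻¹ = ENNReal.ofReal ((T : ℝ)⁻¹) := by
      rw [ENNReal.ofReal_inv_of_pos hT', ENNReal.ofReal_natCast]
    rw [hTinv, ← ENNReal.ofReal_mul (by positivity)]
    refine ENNReal.ofReal_le_ofReal ?_
    have e1 : (T : ℝ)⁻¹ * (G / (c₁ * h.eps) + T * (3 * h.eps * (5 * K) + (6 * c₂ + 6) * h.eps))
        = 1 / c₁ * (G / (h.eps * T)) + (6 * c₂ + 6 + 15 * K) * h.eps := by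
      field_simp
      ring
    rw [e1, rateConst, ← hK]
    -- The two coefficients are merged into their sum `rateConst` by adding nonnegative cross terms.
    have p1 : 0 ≤ 1 / c₁ * h.eps := by positivity
    have p2 : 0 ≤ (6 * c₂ + 6 + 15 * K) * (G / (h.eps * T)) := by positivity
    linarith
  have hN0 : 0 ≤ᵐ[P] fun ω => N (ζ ω) ω := ae_of_all _ fun ω => norm_nonneg _
  rw [hout]
  have hint : Integrable (fun ω => N (ζ ω) ω) P := by
    refine ⟨hmeas.aestronglyMeasurable, ?_⟩
    rw [hasFiniteIntegral_iff_ofReal hN0]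
    exact hfinal.trans_lt ENNReal.ofReal_lt_top
  refine ⟨hint, ?_⟩
  rw [← ofReal_integral_eq_lintegral_ofReal hint hN0] at hfinal
  refine (ENNReal.ofReal_le_ofReal_iff ?_).1 hfinal
  have : 0 ≤ rateConst c₁ c₂ b₁ := by unfold rateConst; positivity
  positivity

end Random

/-! ### Finite sums as expectations under the uniform law. -/

section FiniteSum

lemma expMean_uniformOn {n : ℕ} (hn : 0 < n) {V W : Type*} [NormedAddCommGroup W]
    [NormedSpace ℝ W] [CompleteSpace W] (u : Fin n → V → W) :
    expMean (uniformOn (Set.univ : Set (Fin n))) u = finMean u := by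
  funext x
  exact integral_uniformOn_univ hn fun i => u i x

lemma isProbabilityMeasure_finiteLaw_full (repl : Bool) {m n : ℕ} (hmn : m = n) :
    IsProbabilityMeasure (finiteLaw repl true m n) := by
  subst hmn
  simpa [finiteLaw] using isProbabilityMeasure_uniformOn_bijective m

lemma lintegral_finiteLaw_full (repl : Bool) {m n : ℕ} (hmn : m = n) {V : Type*}
    [NormedAddCommGroup V] [NormedSpace ℝ V] (u : Fin n → V) :
    ∫⁻ v, ENNReal.ofReal (‖(avg fun i => u (v i)) - avg u‖ ^ 2) ∂(finiteLaw repl true m n) = 0 := by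
  subst hmn
  simpa only [finiteLaw, if_true] using lintegral_uniformOn_bijective u

/-- Without replacement, `m > n` leaves no injective batch and `uniformOn ∅` is the zero measure;
`h0` excludes this. -/
lemma isBatchLaw_finiteLaw {repl : Bool} {m n : ℕ} (hn : 0 < n)
    (h0 : finiteLaw repl false m n ≠ 0) :
    IsBatchLaw (uniformOn (Set.univ : Set (Fin n))) (finiteLaw repl false m n) := by
  cases repl
  · simp only [finiteLaw, Bool.false_eq_true, if_false] at h0 ⊢
    refine isBatchLaw_uniformOn_injective hn ?_
    by_contra hlt
    refine h0 ?_
    have : {v : Fin m → Fin n | Function.Injective v} = ∅ := by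
      ext v
      simp only [Set.mem_ofPred_eq, Set.mem_empty_iff_false, iff_false]
      intro hv
      exact hlt (by simpa using Fintype.card_le_of_injective v hv)
    rw [this, uniformOn_empty_meas]
  · simpa [finiteLaw] using isBatchLaw_uniformOn_univ m n hn

variable {d p N n : ℕ} {f : Fin N → E p → ℝ} {g : Fin n → E d → E p} {r Φ : E d → ℝ}
  {lf Lf lg Lg : ℝ} {Ω : Type*} [MeasurableSpace Ω] {P : Measure Ω} [IsProbabilityMeasure P]
  {T tau : ℕ} {m : BatchSizes} {S : ∀ t, Ω → Batch (Fin n) (Fin N) (m.A t) (m.A' t) (m.B t)}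
  {ζ : Ω → Fin T} {repl : Bool} {b₁ b₂ ε : ℝ}

/-- Full batches make every reset error zero, so the reset bounds hold for any `ε`. -/
lemma IsFiniteSumRun.isControlledSampling (hN : 0 < N) (hn : 0 < n)
    (hreg : Regular f g r Φ lf Lf lg Lg) (h : IsFiniteSumRun P N n repl b₁ b₂ tau T m S ζ) :
    IsControlledSampling P (uniformOn (Set.univ : Set (Fin n)))
      (uniformOn (Set.univ : Set (Fin N))) f g lf Lf lg b₁ ε tau T m
      (fun t => finiteLaw repl (t % tau = 0) (m.A t) n)
      (fun t => finiteLaw repl (t % tau = 0) (m.A' t) n)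
      (fun t => finiteLaw repl (t % tau = 0) (m.B t) N) S ζ := by
  have : Nonempty (Fin n) := ⟨⟨0, hn⟩⟩
  have : Nonempty (Fin N) := ⟨⟨0, hN⟩⟩
  -- The product of the three laws is the law of a random variable, hence nonzero; this rules out
  -- subsets larger than the index set.
  have hne : ∀ t < T, finiteLaw repl (t % tau = 0) (m.A t) n ≠ 0 ∧
      finiteLaw repl (t % tau = 0) (m.A' t) n ≠ 0 ∧
      finiteLaw repl (t % tau = 0) (m.B t) N ≠ 0 := by
    intro t ht
    have hp : IsProbabilityMeasure (P.map (S t)) :=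
      Measure.isProbabilityMeasure_map (h.sampling.meas t ht).aemeasurable
    have hne := hp.ne_zero
    rw [h.sampling.law t ht] at hne
    refine ⟨fun h0 => hne ?_, fun h0 => hne ?_, fun h0 => hne ?_⟩
    · rw [h0, Measure.zero_prod]
    · rw [h0, Measure.zero_prod, Measure.prod_zero]
    · rw [h0, Measure.prod_zero, Measure.prod_zero]
  have hfull : ∀ {t}, t % tau = 0 → decide (t % tau = 0) = true := fun ht => decide_eq_true ht
  have hpart : ∀ {t}, t % tau ≠ 0 → decide (t % tau = 0) = false := fun ht => decide_eq_false ht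
  have hgi : ∀ x, Integrable (fun i => g i x) (uniformOn (Set.univ : Set (Fin n))) :=
    fun x => Integrable.of_finite
  have hfi : ∀ y, Integrable (fun k => f k y) (uniformOn (Set.univ : Set (Fin N))) :=
    fun y => Integrable.of_finite
  have hgm : ∀ x, Measurable fun i => g i x := fun x => measurable_of_countable _
  have hfm : ∀ y, Measurable fun k => f k y := fun y => measurable_of_countable _
  have hA : ∀ t < T, t % tau ≠ 0 → IsBatchLaw (uniformOn (Set.univ : Set (Fin n)))
      (finiteLaw repl (t % tau = 0) (m.A t) n) := fun t ht hmod => by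
    have h0 := (hne t ht).1
    rw [hpart hmod] at h0 ⊢
    exact isBatchLaw_finiteLaw hn h0
  have hA' : ∀ t < T, t % tau ≠ 0 → IsBatchLaw (uniformOn (Set.univ : Set (Fin n)))
      (finiteLaw repl (t % tau = 0) (m.A' t) n) := fun t ht hmod => by
    have h0 := (hne t ht).2.1
    rw [hpart hmod] at h0 ⊢
    exact isBatchLaw_finiteLaw hn h0
  have hB : ∀ t < T, t % tau ≠ 0 → IsBatchLaw (uniformOn (Set.univ : Set (Fin N)))
      (finiteLaw repl (t % tau = 0) (m.B t) N) := fun t ht hmod => by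
    have h0 := (hne t ht).2.2
    rw [hpart hmod] at h0 ⊢
    exact isBatchLaw_finiteLaw hN h0
  refine ⟨h.sampling, fun t ht => ?_, fun t ht => ?_, fun t ht => ?_,
    fun t ht hmod => ⟨hA t ht hmod, (h.size_inner t ht hmod).1.1⟩,
    fun t ht hmod => ⟨hA' t ht hmod, (h.size_inner t ht hmod).2.1.1⟩,
    fun t ht hmod => ⟨hB t ht hmod, (h.size_inner t ht hmod).2.2.1⟩,
    fun t ht hmod z => ?_, fun t ht hmod z => ?_, fun t ht hmod y => ?_⟩
  · by_cases hmod : t % tau = 0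
    · simp only [hfull hmod]
      exact isProbabilityMeasure_finiteLaw_full _ (h.size_reset t ht hmod).1
    · exact (hA t ht hmod).prob
  · by_cases hmod : t % tau = 0
    · simp only [hfull hmod]
      exact isProbabilityMeasure_finiteLaw_full _ (h.size_reset t ht hmod).2.1
    · exact (hA' t ht hmod).prob
  · by_cases hmod : t % tau = 0
    · simp only [hfull hmod]
      exact isProbabilityMeasure_finiteLaw_full _ (h.size_reset t ht hmod).2.2
    · exact (hB t ht hmod).prob
  · simp only [hfull hmod]
    rw [expMean_uniformOn hn]
    exact (lintegral_finiteLaw_full repl (h.size_reset t ht hmod).1 fun i => g i z).trans_le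
      zero_le
  · simp only [hfull hmod]
    rw [(hasFDerivAt_expMean hgm hgi hreg.g_diff hreg.g_lip z).fderiv,
      integral_uniformOn_univ hn]
    simp only [map_sub, map_avg]
    exact (lintegral_finiteLaw_full repl (h.size_reset t ht hmod).2.1
      fun i => cols d p (fderiv ℝ (g i) z)).trans_le zero_le
  · simp only [hfull hmod]
    rw [integral_gradient hfm hfi hreg.f_diff hreg.f_lip, integral_uniformOn_univ hN]
    exact (lintegral_finiteLaw_full repl (h.size_reset t ht hmod).2.2
      fun k => gradient (f k) y).trans_le zero_le

end FiniteSum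

/-! ### Online sampling: reset batches of prescribed accuracy. -/

section Online

variable {d p : ℕ} {ι κ : Type*} [MeasurableSpace ι] [MeasurableSpace κ] {f : κ → E p → ℝ}
  {g : ι → E d → E p} {r Φ : E d → ℝ} {lf Lf lg Lg σg σg' σf' : ℝ}
  {Ω : Type*} [MeasurableSpace Ω] {P : Measure Ω} [IsProbabilityMeasure P]
  {T tau : ℕ} {m : BatchSizes} {S : ∀ t, Ω → Batch ι κ (m.A t) (m.A' t) (m.B t)}
  {ζ : Ω → Fin T} {μ : Measure ι} {ν : Measure κ} [IsProbabilityMeasure μ]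
  [IsProbabilityMeasure ν] {b₁ b₂ ε : ℝ}

/-- A batch of size at least `b₁ a σ²` has variance `σ² / k ≤ 1 / (a b₁)`. In the uses below, `a` is
the inverse square of the desired accuracy. -/
lemma lintegral_pi_avg_sub_le {V : Type*} [NormedAddCommGroup V] [InnerProductSpace ℝ V]
    [FiniteDimensional ℝ V] {u : ι → V} (hi : Integrable u μ) {c : V} (hc : ∫ x, u x ∂μ = c)
    (hsq : Integrable (fun x => ‖u x - c‖ ^ 2) μ) {σ a : ℝ} (hσ : ∫ x, ‖u x - c‖ ^ 2 ∂μ ≤ σ ^ 2)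
    (hσ0 : 0 < σ) (ha : 0 < a) (hb : 0 < b₁) {k : ℕ} (hk : b₁ * ⌈a * σ ^ 2⌉₊ ≤ k) :
    ∫⁻ v, ENNReal.ofReal (‖(avg fun i => u (v i)) - c‖ ^ 2) ∂(Measure.pi fun _ : Fin k => μ)
      ≤ ENNReal.ofReal (1 / a / b₁) := by
  have h1 : b₁ * (a * σ ^ 2) ≤ k :=
    (mul_le_mul_of_nonneg_left (Nat.le_ceil _) hb.le).trans hk
  have h2 : 0 < b₁ * (a * σ ^ 2) := by positivity
  have hk0 : 0 < k := by exact_mod_cast h2.trans_le h1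
  have h3 := (isBatchLaw_pi μ k).lintegral_norm_sq_avg_sub_le hk0
    ((memLp_two_iff_integrable_sq_norm (hi.1.sub aestronglyMeasurable_const)).2 hsq) hc hi hσ 0
  simp only [zero_add] at h3
  refine h3.trans (ENNReal.ofReal_le_ofReal ?_)
  have hk' : (0 : ℝ) < k := by exact_mod_cast hk0
  rw [norm_zero, zero_pow two_ne_zero, zero_add, div_div, div_le_div_iff₀ hk' (by positivity)]
  linarith

omit [IsProbabilityMeasure P] in
lemma IsOnlineRun.isControlledSampling (hreg : Regular f g r Φ lf Lf lg Lg)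
    (hv : VarianceBounds μ ν f g σg σg' σf') (hb : 0 < b₁) (hε : 0 < ε)
    (h : IsOnlineRun P μ ν (Lf ^ 2 * lg ^ 2 * σg ^ 2 / ε ^ 2) (lf ^ 2 * σg' ^ 2 / ε ^ 2)
          (lg ^ 2 * σf' ^ 2 / ε ^ 2) b₁ b₂ tau T m S ζ) :
    IsControlledSampling P μ ν f g lf Lf lg b₁ ε tau T m
      (fun _ => Measure.pi fun _ => μ) (fun _ => Measure.pi fun _ => μ)
      (fun _ => Measure.pi fun _ => ν) S ζ := by
  have hlf := hreg.lf_pos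
  have hLf := hreg.Lf_pos
  have hlg := hreg.lg_pos
  have hJi := integrable_fderiv_index (μ := μ) hlg.le hv.g_meas hreg.g_diff hreg.g_lip
  have hfi : ∀ y, Integrable (fun k => gradient (f k) y) ν := fun y =>
    Integrable.of_bound (measurable_gradient_index hv.f_meas hreg.f_diff y).aestronglyMeasurable lf
      (ae_of_all _ fun k => norm_gradient_le_of_lip hlf.le (hreg.f_lip k) y)
  refine ⟨h.sampling, fun t _ => inferInstance, fun t _ => inferInstance, fun t _ => inferInstance,
    fun t ht hmod => ⟨isBatchLaw_pi μ _, (h.size_inner t ht hmod).1.1⟩,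
    fun t ht hmod => ⟨isBatchLaw_pi μ _, (h.size_inner t ht hmod).2.1.1⟩,
    fun t ht hmod => ⟨isBatchLaw_pi ν _, (h.size_inner t ht hmod).2.2.1⟩,
    fun t ht hmod z => ?_, fun t ht hmod z => ?_, fun t ht hmod y => ?_⟩
  · have e : (ε / (lg * Lf)) ^ 2 / b₁ = 1 / ((Lf * lg / ε) ^ 2) / b₁ := by field_simp
    rw [e]
    refine lintegral_pi_avg_sub_le (hv.g_int z) rfl (hv.g_sq_int z) (hv.g_var z) hv.σg_pos
      (by positivity) hb ?_
    convert (h.size_reset t ht hmod).1.1 using 4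
    ring
  · have e : (ε / lf) ^ 2 / b₁ = 1 / ((lf / ε) ^ 2) / b₁ := by field_simp
    rw [e]
    simp only [map_sub, map_avg]
    have hn : ∀ i, ‖cols d p (fderiv ℝ (g i) z) - cols d p (fderiv ℝ (expMean μ g) z)‖
        = frob (fderiv ℝ (g i) z - fderiv ℝ (expMean μ g) z) := fun i => by
      rw [← map_sub, norm_cols]
    refine lintegral_pi_avg_sub_le (u := fun i => cols d p (fderiv ℝ (g i) z))
      ((cols d p).integrable_comp (hJi z)) ?_ ?_ (σ := σg') ?_ hv.σg'_pos (by positivity) hb ?_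
    · rw [(hasFDerivAt_expMean hv.g_meas hv.g_int hreg.g_diff hreg.g_lip z).fderiv]
      exact (cols d p).integral_comp_comm (hJi z)
    · simp only [hn]
      exact hv.g_jac_sq_int z
    · simp only [hn]
      exact hv.g_jac_var z
    · convert (h.size_reset t ht hmod).2.1.1 using 4
      ring
  · have e : (ε / lg) ^ 2 / b₁ = 1 / ((lg / ε) ^ 2) / b₁ := by field_simp
    rw [e]
    refine lintegral_pi_avg_sub_le (hfi y)
      (integral_gradient hv.f_meas hv.f_int hreg.f_diff hreg.f_lip y).symm (hv.f_grad_sq_int y)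
      (hv.f_grad_var y) hv.σf'_pos (by positivity) hb ?_
    convert (h.size_reset t ht hmod).2.2.1 using 4
    ring

end Online

/-! ### Counting evaluations and choosing the number of iterations. -/

section Complexity

lemma card_resets_le {tau T : ℕ} :
    (((Finset.range T).filter fun t => t % tau = 0).card : ℝ) ≤ T / tau + 1 := by
  have h1 : ((Finset.range T).filter fun t => t % tau = 0).card ≤ T / tau + 1 := by
    rw [← Finset.card_range (T / tau + 1)]
    refine Finset.card_le_card_of_injOn (fun t => t / tau) (fun t ht => ?_) fun t ht t' ht' h => ?_
    · have := (Finset.mem_filter.1 ht).1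
      have h2 : t / tau ≤ T / tau := Nat.div_le_div_right (Finset.mem_range.1 this).le
      simpa using Nat.lt_succ_of_le h2
    · have h2 := (Finset.mem_filter.1 ht).2
      have h3 := (Finset.mem_filter.1 ht').2
      rw [← Nat.div_add_mod t tau, ← Nat.div_add_mod t' tau, h2, h3]
      simpa using Or.inl h
  have h2 : ((T / tau : ℕ) : ℝ) ≤ T / tau := Nat.cast_div_le
  have h3 : (((Finset.range T).filter fun t => t % tau = 0).card : ℝ) ≤ (T / tau : ℕ) + 1 := by
    exact_mod_cast h1
  linarith

lemma evaluations_le {tau T : ℕ} {m : BatchSizes} {R b₂ : ℝ} (hR : 0 ≤ R)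
    (hb₂ : 0 ≤ b₂)
    (hreset : ∀ t < T, t % tau = 0 → (m.A t + m.A' t + m.B t : ℝ) ≤ R)
    (hinner : ∀ t < T, t % tau ≠ 0 →
      (m.A t : ℝ) ≤ b₂ * tau ∧ (m.A' t : ℝ) ≤ b₂ * tau ∧ (m.B t : ℝ) ≤ b₂ * tau) :
    (evaluations tau m T : ℝ) ≤ (T / tau + 1) * R + 6 * b₂ * tau * T := by
  -- An inner iteration evaluates three batches twice, at most `6 b₂ tau` in all; charging this at
  -- resets too only weakens the bound.
  have h1 : ∀ t ∈ Finset.range T,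
      (((if t % tau = 0 then 1 else 2) * (m.A t + m.A' t + m.B t) : ℕ) : ℝ)
        ≤ (if t % tau = 0 then R else 0) + 6 * b₂ * tau := by
    intro t ht
    have ht := Finset.mem_range.1 ht
    have h0 : 0 ≤ b₂ * tau := by positivity
    split_ifs with hmod
    · have := hreset t ht hmod
      push_cast
      linarith
    · obtain ⟨a1, a2, a3⟩ := hinner t ht hmod
      push_cast
      linarith
  unfold evaluations
  rw [Nat.cast_sum]
  refine (Finset.sum_le_sum h1).trans ?_
  rw [Finset.sum_add_distrib, ← Finset.sum_filter, Finset.sum_const, Finset.sum_const,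
    Finset.card_range, nsmul_eq_mul, nsmul_eq_mul]
  have := mul_le_mul_of_nonneg_right (card_resets_le (tau := tau) (T := T)) hR
  linarith

/-- The accuracy parameter is this fraction of the target accuracy. -/
noncomputable def shrink (C : ℝ) : ℝ := min 1 (1 / (2 * C))

lemma shrink_pos {C : ℝ} (hC : 0 < C) : 0 < shrink C := lt_min one_pos (by positivity)

lemma shrink_le_one (C : ℝ) : shrink C ≤ 1 := min_le_left _ _

/-- Each of the two terms is made at most `ε / 2`: the first by the factor `shrink C ≤ 1 / (2 C)`,
the second by `T ≥ 2 C G / (shrink C * ε²)`. Adding one to the ceiling keeps `T` positive when `G =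
0`. -/
lemma exists_iterations {C G ε : ℝ} (hC : 0 < C) (hG : 0 ≤ G) (hε : 0 < ε) :
    ∃ T : ℕ, 1 ≤ T ∧ C * (shrink C * ε + G / (shrink C * ε * T)) ≤ ε ∧
      (T : ℝ) ≤ 2 + 2 * C / shrink C * (G / ε ^ 2) := by
  have hk := shrink_pos hC
  set k := shrink C with hkdef
  have hx : 0 ≤ 2 * C * G / (k * ε * ε) := by positivity
  refine ⟨⌈2 * C * G / (k * ε * ε)⌉₊ + 1, by omega, ?_, ?_⟩
  · have h1 : C * (k * ε) ≤ ε / 2 := by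
      have : k ≤ 1 / (2 * C) := min_le_right _ _
      have h2 : C * (k * ε) ≤ C * (1 / (2 * C) * ε) := by gcongr
      have h3 : C * (1 / (2 * C) * ε) = ε / 2 := by field_simp
      linarith
    have h2 : 2 * C * G / (k * ε * ε) ≤ ((⌈2 * C * G / (k * ε * ε)⌉₊ + 1 : ℕ) : ℝ) := by
      push_cast
      linarith [Nat.le_ceil (2 * C * G / (k * ε * ε))]
    set T : ℕ := ⌈2 * C * G / (k * ε * ε)⌉₊ + 1
    have hT : (0 : ℝ) < T := by positivity
    have h3 : C * (G / (k * ε * T)) ≤ ε / 2 := by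
      rw [div_le_iff₀ (by positivity)] at h2
      rw [mul_div_assoc', div_le_iff₀ (by positivity)]
      linarith
    linarith
  · push_cast
    have h1 := (Nat.ceil_lt_add_one hx).le
    have h2 : 2 * C / k * (G / ε ^ 2) = 2 * C * G / (k * ε * ε) := by field_simp
    linarith

/-- Since `max N n ≤ 4 τ²`, a reset costs at most `12 τ²`, that is `12 τ` per iteration of a period,
the order of an inner iteration. The first reset and the constant part of `T` are absorbed in `N +
n`. -/
lemma finiteSum_cost_le {N n : ℕ} (hN : 0 < N) {T b₂ C₁ X : ℝ} (hb₂ : 0 < b₂)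
    (hC₁ : 0 ≤ C₁) (hX : 0 ≤ X) (hT0 : 0 ≤ T) (hT : T ≤ 2 + C₁ * X) :
    (T / (Nat.sqrt (max N n) : ℕ) + 1) * (2 * n + N) + 6 * b₂ * (Nat.sqrt (max N n) : ℕ) * T
      ≤ (2 + (12 + 6 * b₂) * (2 + C₁)) * (N + n + Real.sqrt (max N n : ℕ) * X) := by
  set M := max N n with hM
  have hM1 : 1 ≤ M := hN.trans_le (le_max_left _ _)
  set τ := Nat.sqrt M with hτ
  have hτ1 : 1 ≤ τ := Nat.sqrt_pos.2 hM1
  have hτ1' : (1 : ℝ) ≤ τ := by exact_mod_cast hτ1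
  have hMτ : (M : ℝ) ≤ 4 * τ ^ 2 := by
    have h1 : M < (τ + 1) * (τ + 1) := Nat.lt_succ_sqrt M
    have h2 : (M : ℝ) < (τ + 1) * (τ + 1) := by exact_mod_cast h1
    nlinarith
  have hτs : (τ : ℝ) ≤ Real.sqrt M := Real.nat_sqrt_le_real_sqrt
  have hNM : (N : ℝ) ≤ M := by exact_mod_cast le_max_left N n
  have hnM : (n : ℝ) ≤ M := by exact_mod_cast le_max_right N n
  have hMs : (M : ℝ) ≤ N + n := by
    have : M ≤ N + n := by omega
    exact_mod_cast this
  have hM1' : (1 : ℝ) ≤ M := by exact_mod_cast hM1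
  set s := Real.sqrt M with hs
  have hs0 : 0 ≤ s := Real.sqrt_nonneg _
  have hss : s ≤ N + n := by
    refine le_trans ?_ hMs
    rw [hs, Real.sqrt_le_left (by positivity)]
    nlinarith
  have h1 : T / τ * (2 * n + N) ≤ 12 * τ * T := by
    rw [div_mul_eq_mul_div, div_le_iff₀ (by positivity)]
    have : (2 * n + N : ℝ) ≤ 12 * τ ^ 2 := by linarith
    nlinarith [mul_le_mul_of_nonneg_left this hT0]
  have h2 : τ * T ≤ s * (2 + C₁ * X) := mul_le_mul hτs hT hT0 hs0
  have h3 : s * (2 + C₁ * X) ≤ (2 + C₁) * (N + n + s * X) := by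
    have hX' : 0 ≤ s * X := by positivity
    have hNn : 0 ≤ (N + n : ℝ) := by positivity
    nlinarith [mul_nonneg hC₁ hNn]
  have h4 : (12 + 6 * b₂) * (τ * T) ≤ (12 + 6 * b₂) * ((2 + C₁) * (N + n + s * X)) :=
    mul_le_mul_of_nonneg_left (h2.trans h3) (by positivity)
  have hX' : 0 ≤ s * X := by positivity
  have hN0 : (0 : ℝ) ≤ N := by positivity
  nlinarith

/-- With `Q = M² + V` and a period of order `M / ε`, a reset costs `O(Q / ε²)`, so resets and inner
iterations both cost `O(Q / (M ε))` per iteration. One extra reset remains, and `ε ≤ M` fits it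
under the same bound. -/
lemma online_cost_le {M V G ε k b₂ C₁ T : ℝ} (hV : 0 ≤ V) (hG : 0 ≤ G)
    (hε : 0 < ε) (hεM : ε ≤ M) (hk : 0 < k) (hk1 : k ≤ 1) (hb₂ : 0 < b₂) (hC₁ : 0 ≤ C₁)
    (hT0 : 0 ≤ T) (hT : T ≤ 2 + C₁ * (G / ε ^ 2)) {R : ℝ} (hR0 : 0 ≤ R)
    (hR : R ≤ b₂ * (V / (k * ε) ^ 2 + 3)) :
    (T / (⌊M / (k * ε)⌋₊ : ℕ) + 1) * R + 6 * b₂ * (⌊M / (k * ε)⌋₊ : ℕ) * T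
      ≤ (12 * b₂ / k * (2 + C₁) + 3 * b₂ / k ^ 2) * ((M ^ 2 + V) * (M + G / M)) / ε ^ 3 := by
  have hM : 0 < M := hε.trans_le hεM
  set ε' := k * ε with hε'
  have hε'0 : 0 < ε' := by positivity
  have hε'M : ε' ≤ M := by
    have : k * ε ≤ 1 * ε := by gcongr
    linarith
  set τ := ⌊M / ε'⌋₊ with hτ
  have hτle : (τ : ℝ) ≤ M / ε' := Nat.floor_le (by positivity)
  have h1le : 1 ≤ M / ε' := by rw [one_le_div hε'0]; exact hε'M
  have hτ1 : (1 : ℝ) ≤ τ := by exact_mod_cast (Nat.one_le_floor_iff _).2 h1le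
  -- The floor of a number that is at least one exceeds half of it.
  have hτge : M / ε' / 2 ≤ τ := by
    have := Nat.lt_floor_add_one (M / ε')
    rw [← hτ] at this
    linarith
  set Q := M ^ 2 + V with hQ
  have hQ0 : 0 < Q := by positivity
  have hRQ : R ≤ 3 * b₂ * (Q / ε' ^ 2) := by
    refine hR.trans ?_
    -- This absorbs the `3` that comes from rounding up three batch sizes, and is the reason for the
    -- summand `M ^ 2` in `Q`.
    have h1 : 1 ≤ M ^ 2 / ε' ^ 2 := by
      rw [one_le_div (by positivity)]
      exact pow_le_pow_left₀ hε'0.le hε'M 2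
    have h2 : Q / ε' ^ 2 = M ^ 2 / ε' ^ 2 + V / ε' ^ 2 := by rw [hQ, add_div]
    have h3 : 0 ≤ V / ε' ^ 2 := by positivity
    rw [h2]
    nlinarith
  have hTτ : T / τ ≤ 2 * T * ε' / M := by
    rw [div_le_div_iff₀ (by positivity) hM]
    have : T * M = 2 * T * ε' * (M / ε' / 2) := by field_simp
    rw [this]
    gcongr
  have s1 : (T / τ + 1) * R ≤ (2 * T * ε' / M + 1) * (3 * b₂ * (Q / ε' ^ 2)) := by
    gcongr
  have s2 : 6 * b₂ * τ * T ≤ 6 * b₂ * (M / ε') * T := by gcongr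
  have s3 : M / ε' ≤ Q / (M * ε') := by
    rw [div_le_div_iff₀ hε'0 (by positivity)]
    have : M * (M * ε') ≤ Q * ε' := by
      rw [hQ]
      nlinarith [mul_nonneg hV hε'0.le]
    exact this
  have s4 : 6 * b₂ * (M / ε') * T ≤ 6 * b₂ * (Q / (M * ε')) * T := by gcongr
  have s5 : (2 * T * ε' / M + 1) * (3 * b₂ * (Q / ε' ^ 2)) + 6 * b₂ * (Q / (M * ε')) * T
      = 12 * b₂ / k * (T * (Q / (M * ε))) + 3 * b₂ / k ^ 2 * (Q / ε ^ 2) := by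
    rw [hε']
    field_simp
    ring
  have s6 : Q / ε ^ 2 ≤ Q * (M + G / M) / ε ^ 3 := by
    rw [div_le_div_iff₀ (by positivity) (by positivity)]
    have : ε ≤ M + G / M := by
      have : 0 ≤ G / M := by positivity
      linarith
    have : Q * ε ^ 2 * ε ≤ Q * ε ^ 2 * (M + G / M) := by gcongr
    linarith
  have s7 : T * (Q / (M * ε)) ≤ (2 + C₁) * (Q * (M + G / M) / ε ^ 3) := by
    have a1 : T * (Q / (M * ε)) ≤ (2 + C₁ * (G / ε ^ 2)) * (Q / (M * ε)) := by gcongr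
    have a2 : (2 + C₁ * (G / ε ^ 2)) * (Q / (M * ε))
        = 2 * (Q / (M * ε)) + C₁ * (Q * (G / M) / ε ^ 3) := by
      field_simp
    have a3 : Q / (M * ε) ≤ Q * M / ε ^ 3 := by
      rw [div_le_div_iff₀ (by positivity) (by positivity)]
      have : Q * ε * ε ^ 2 ≤ Q * ε * M ^ 2 := by gcongr
      linarith
    have a4 : Q * (M + G / M) / ε ^ 3 = Q * M / ε ^ 3 + Q * (G / M) / ε ^ 3 := by ring
    have a5 : 0 ≤ Q * (G / M) / ε ^ 3 := by positivity
    have a6 : 0 ≤ C₁ * (Q * M / ε ^ 3) := by positivity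
    rw [a4]
    linarith
  have s8 : 12 * b₂ / k * (T * (Q / (M * ε)))
      ≤ 12 * b₂ / k * ((2 + C₁) * (Q * (M + G / M) / ε ^ 3)) :=
    mul_le_mul_of_nonneg_left s7 (by positivity)
  have s9 : 3 * b₂ / k ^ 2 * (Q / ε ^ 2) ≤ 3 * b₂ / k ^ 2 * (Q * (M + G / M) / ε ^ 3) :=
    mul_le_mul_of_nonneg_left s6 (by positivity)
  have s10 : (12 * b₂ / k * (2 + C₁) + 3 * b₂ / k ^ 2) * (Q * (M + G / M)) / ε ^ 3
      = 12 * b₂ / k * ((2 + C₁) * (Q * (M + G / M) / ε ^ 3))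
        + 3 * b₂ / k ^ 2 * (Q * (M + G / M) / ε ^ 3) := by ring
  linarith

end Complexity

/-! ### Assembly of the two convergence statements. -/

lemma rateConst_pos {c₁ c₂ b₁ : ℝ} (hc₁ : 0 < c₁) (hc₂ : 0 < c₂) (hb₁ : 0 < b₁) :
    0 < rateConst c₁ c₂ b₁ := by
  unfold rateConst
  positivity

lemma admissible_of_steps {α β c₁ ε L : ℝ} {lam : ℕ → ℝ} (tau : ℕ) (hε : 0 < ε) (hα : 0 < α)
    (hα1 : α ≤ 1) (hc₁ : 0 < c₁) (hL : 0 < L) (hβ : c₁ / L ≤ β)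
    (hlam : ∀ t, β ≤ lam t ∧ lam t ≤ (1 + α) * β) :
    Admissible ⟨ε, tau, lam, fun _ => β, fun _ => α⟩ α β where
  eps_pos := hε
  alpha_pos := hα
  alpha_le := hα1
  beta_pos := (div_pos hc₁ hL).trans_le hβ
  alpha_eq _ := rfl
  beta_eq _ := rfl
  le_lam t := (hlam t).1
  lam_le t := (hlam t).2

/-- The rate proved above is free of `α`; as `α ≤ 1`, it implies the form with `ε / α`. This is also
why the complexity constant does not depend on `α`. -/
lemma mul_add_le_mul_div_add {C C' ε α X : ℝ} (hC : 0 ≤ C) (hCC : C ≤ C') (hε : 0 ≤ ε)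
    (hα : 0 < α) (hα1 : α ≤ 1) (hX : 0 ≤ X) : C * (ε + X) ≤ C' * (ε / α + X) := by
  have : ε ≤ ε / α := le_div_self hε hα hα1
  have h0 : 0 ≤ ε / α := by positivity
  exact mul_le_mul hCC (by linarith) (by positivity) (hC.trans hCC)

section FiniteSum

variable {d p N n : ℕ} {f : Fin N → E p → ℝ} {g : Fin n → E d → E p} {r : E d → ℝ}
  {lf Lf lg Lg : ℝ} {Ω : Type*} [MeasurableSpace Ω] {P : Measure Ω} [IsProbabilityMeasure P]
  {T tau : ℕ} {m : BatchSizes} {S : ∀ t, Ω → Batch (Fin n) (Fin N) (m.A t) (m.A' t) (m.B t)}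
  {ζ : Ω → Fin T} {repl : Bool} {x0 : E d} {c₁ c₂ b₁ b₂ ε α β : ℝ} {lam : ℕ → ℝ}

/-- Convergence of MVRC-2 for the finite-sum problem. -/
theorem IsFiniteSumRun.integral_outputNorm_le (hN : 0 < N) (hn : 0 < n)
    (hreg : Regular f g r (objective (finMean f) (finMean g) r) lf Lf lg Lg)
    (hc₁ : 0 < c₁) (hb₁ : 0 < b₁) (hα : 0 < α) (hα1 : α ≤ 1)
    (hβ : c₁ / LF lf Lf lg Lg ≤ β) (hβ' : β ≤ c₂ / LF lf Lf lg Lg)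
    (hlam : ∀ t, β ≤ lam t ∧ lam t ≤ (1 + α) * β) (hε : 0 < ε) (hε' : ε ≤ lf * lg)
    (htau : 0 < tau) (hT : 1 ≤ T) (h : IsFiniteSumRun P N n repl b₁ b₂ tau T m S ζ) :
    Integrable (outputNorm f g (fun x => finMean f (finMean g x)) r
      ⟨ε, tau, lam, fun _ => β, fun _ => α⟩ x0 S ζ) P ∧
    ∫ ω, outputNorm f g (fun x => finMean f (finMean g x)) r
      ⟨ε, tau, lam, fun _ => β, fun _ => α⟩ x0 S ζ ω ∂P ≤
      rateConst c₁ c₂ b₁ * (ε + LF lf Lf lg Lg *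
        gap (objective (finMean f) (finMean g) r) x0 / (ε * T)) := by
  have : Nonempty (Fin n) := ⟨⟨0, hn⟩⟩
  have : Nonempty (Fin N) := ⟨⟨0, hN⟩⟩
  have hL : 0 < LF lf Lf lg Lg := by
    have := hreg.lf_pos; have := hreg.Lf_pos; have := hreg.lg_pos; have := hreg.Lg_pos
    unfold LF; positivity
  have hS := h.isControlledSampling (ε := ε) hN hn hreg
  rw [← expMean_uniformOn hN f, ← expMean_uniformOn hn g] at hreg ⊢
  exact MVRC.integral_outputNorm_le (h := ⟨ε, tau, lam, fun _ => β, fun _ => α⟩) hreg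
    (fun x => measurable_of_countable _)
    (fun y => measurable_of_countable _) (fun x => Integrable.of_finite)
    (fun y => Integrable.of_finite) (admissible_of_steps tau hε hα hα1 hc₁ hL hβ hlam) htau hε' hb₁
    hc₁ (by rw [div_le_iff₀ hL] at hβ; linarith) (by rw [le_div_iff₀ hL] at hβ'; linarith) hT hS

end FiniteSum

section Online

variable {d p : ℕ} {ι κ : Type*} [MeasurableSpace ι] [MeasurableSpace κ] {f : κ → E p → ℝ}
  {g : ι → E d → E p} {r : E d → ℝ} {lf Lf lg Lg σg σg' σf' : ℝ}
  {Ω : Type*} [MeasurableSpace Ω] {P : Measure Ω} [IsProbabilityMeasure P]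
  {T tau : ℕ} {m : BatchSizes} {S : ∀ t, Ω → Batch ι κ (m.A t) (m.A' t) (m.B t)}
  {ζ : Ω → Fin T} {μ : Measure ι} {ν : Measure κ} [IsProbabilityMeasure μ]
  [IsProbabilityMeasure ν] {x0 : E d} {c₁ c₂ b₁ b₂ ε α β : ℝ} {lam : ℕ → ℝ}

/-- Convergence of MVRC-2 for the online problem. -/
theorem IsOnlineRun.integral_outputNorm_le
    (hreg : Regular f g r (objective (expMean ν f) (expMean μ g) r) lf Lf lg Lg)
    (hv : VarianceBounds μ ν f g σg σg' σf')
    (hc₁ : 0 < c₁) (hb₁ : 0 < b₁) (hα : 0 < α) (hα1 : α ≤ 1)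
    (hβ : c₁ / LF lf Lf lg Lg ≤ β) (hβ' : β ≤ c₂ / LF lf Lf lg Lg)
    (hlam : ∀ t, β ≤ lam t ∧ lam t ≤ (1 + α) * β) (hε : 0 < ε) (hε' : ε ≤ lf * lg)
    (htau : 0 < tau) (hT : 1 ≤ T)
    (h : IsOnlineRun P μ ν (Lf ^ 2 * lg ^ 2 * σg ^ 2 / ε ^ 2) (lf ^ 2 * σg' ^ 2 / ε ^ 2)
      (lg ^ 2 * σf' ^ 2 / ε ^ 2) b₁ b₂ tau T m S ζ) :
    Integrable (outputNorm f g (fun x => expMean ν f (expMean μ g x)) r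
      ⟨ε, tau, lam, fun _ => β, fun _ => α⟩ x0 S ζ) P ∧
    ∫ ω, outputNorm f g (fun x => expMean ν f (expMean μ g x)) r
      ⟨ε, tau, lam, fun _ => β, fun _ => α⟩ x0 S ζ ω ∂P ≤
      rateConst c₁ c₂ b₁ * (ε + LF lf Lf lg Lg *
        gap (objective (expMean ν f) (expMean μ g) r) x0 / (ε * T)) := by
  have hL : 0 < LF lf Lf lg Lg := by
    have := hreg.lf_pos; have := hreg.Lf_pos; have := hreg.lg_pos; have := hreg.Lg_pos
    unfold LF; positivity
  exact MVRC.integral_outputNorm_le (h := ⟨ε, tau, lam, fun _ => β, fun _ => α⟩) hreg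
    hv.g_meas hv.f_meas hv.g_int hv.f_int
    (admissible_of_steps tau hε hα hα1 hc₁ hL hβ hlam) htau hε' hb₁
    hc₁ (by rw [div_le_iff₀ hL] at hβ; linarith) (by rw [le_div_iff₀ hL] at hβ'; linarith) hT
    (h.isControlledSampling hreg hv hb₁ hε)

end Online

lemma Regular.LF_mul_gap_nonneg {d p : ℕ} {ι κ : Type*} {f : κ → E p → ℝ} {g : ι → E d → E p}
    {r Φ : E d → ℝ} {lf Lf lg Lg : ℝ} (h : Regular f g r Φ lf Lf lg Lg) (x0 : E d) :
    0 ≤ LF lf Lf lg Lg * gap Φ x0 := by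
  have := h.lf_pos; have := h.Lf_pos; have := h.lg_pos; have := h.Lg_pos
  refine mul_nonneg ?_ (sub_nonneg.2 (ciInf_le h.bddBelow _))
  unfold LF; positivity

end MVRC

open MVRC
theorem theorem6 :
    -- the finite-sum problem
    (∀ c₁ c₂ b₁ b₂ : ℝ, 0 < c₁ → 0 < c₂ → 0 < b₁ → 0 < b₂ →
      ∃ C : ℝ, 0 < C ∧
      ∀ (d p N n : ℕ), 0 < N → 0 < n →
      ∀ (f : Fin N → E p → ℝ) (g : Fin n → E d → E p) (r : E d → ℝ) (lf Lf lg Lg : ℝ),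
      Regular f g r (objective (finMean f) (finMean g) r) lf Lf lg Lg →
      ∀ (x0 : E d) (α β : ℝ) (lam : ℕ → ℝ), 0 < α → α ≤ 1 →
      c₁ / LF lf Lf lg Lg ≤ β → β ≤ c₂ / LF lf Lf lg Lg →
      (∀ t, β ≤ lam t ∧ lam t ≤ (1 + α) * β) →
      -- convergence bound
      (∀ (ε : ℝ) (T : ℕ), 0 < ε → ε < lf * lg / Real.sqrt (max N n : ℕ) → 1 ≤ T →
        ∀ (Ω : Type*) [MeasurableSpace Ω] (P : Measure Ω) [IsProbabilityMeasure P] (repl : Bool)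
          (m : BatchSizes) (S : ∀ t, Ω → Batch (Fin n) (Fin N) (m.A t) (m.A' t) (m.B t))
          (ζ : Ω → Fin T),
        IsFiniteSumRun P N n repl b₁ b₂ (Nat.sqrt (max N n)) T m S ζ →
        Integrable (outputNorm f g (fun x => finMean f (finMean g x)) r
          ⟨ε, Nat.sqrt (max N n), lam, fun _ => β, fun _ => α⟩ x0 S ζ) P ∧
        ∫ ω, outputNorm f g (fun x => finMean f (finMean g x)) r
          ⟨ε, Nat.sqrt (max N n), lam, fun _ => β, fun _ => α⟩ x0 S ζ ω ∂P ≤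
          C * (ε / α +
            LF lf Lf lg Lg * gap (objective (finMean f) (finMean g) r) x0 / (ε * T))) ∧
      -- sample complexity of reaching accuracy `ε`
      (∀ ε : ℝ, 0 < ε → ε < lf * lg / Real.sqrt (max N n : ℕ) →
        ∃ (ε' : ℝ) (T : ℕ), 0 < ε' ∧ ε' ≤ ε ∧ 1 ≤ T ∧
        ∀ (Ω : Type*) [MeasurableSpace Ω] (P : Measure Ω) [IsProbabilityMeasure P] (repl : Bool)
          (m : BatchSizes) (S : ∀ t, Ω → Batch (Fin n) (Fin N) (m.A t) (m.A' t) (m.B t))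
          (ζ : Ω → Fin T),
        IsFiniteSumRun P N n repl b₁ b₂ (Nat.sqrt (max N n)) T m S ζ →
        (Integrable (outputNorm f g (fun x => finMean f (finMean g x)) r
          ⟨ε', Nat.sqrt (max N n), lam, fun _ => β, fun _ => α⟩ x0 S ζ) P ∧
        ∫ ω, outputNorm f g (fun x => finMean f (finMean g x)) r
          ⟨ε', Nat.sqrt (max N n), lam, fun _ => β, fun _ => α⟩ x0 S ζ ω ∂P ≤ ε) ∧
        (evaluations (Nat.sqrt (max N n)) m T : ℝ) ≤
          C * (N + n + Real.sqrt (max N n : ℕ) *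
            (LF lf Lf lg Lg * gap (objective (finMean f) (finMean g) r) x0) / ε ^ 2))) ∧
    -- the online problem
    (∀ c₁ c₂ b₁ b₂ : ℝ, 0 < c₁ → 0 < c₂ → 0 < b₁ → 0 < b₂ →
      ∃ C : ℝ, 0 < C ∧
      ∀ (d p : ℕ) (Ξ H : Type*) [MeasurableSpace Ξ] [MeasurableSpace H]
        (μ : Measure Ξ) (ν : Measure H) [IsProbabilityMeasure μ] [IsProbabilityMeasure ν]
        (f : H → E p → ℝ) (g : Ξ → E d → E p) (r : E d → ℝ) (lf Lf lg Lg σg σg' σf' : ℝ),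
      Regular f g r (objective (expMean ν f) (expMean μ g) r) lf Lf lg Lg →
      VarianceBounds μ ν f g σg σg' σf' →
      ∀ (x0 : E d) (α β : ℝ) (lam : ℕ → ℝ), 0 < α → α ≤ 1 →
      c₁ / LF lf Lf lg Lg ≤ β → β ≤ c₂ / LF lf Lf lg Lg →
      (∀ t, β ≤ lam t ∧ lam t ≤ (1 + α) * β) →
      -- convergence bound
      (∀ (ε : ℝ) (T : ℕ), 0 < ε → ε ≤ lf * lg → 1 ≤ T →
        ∀ (Ω : Type*) [MeasurableSpace Ω] (P : Measure Ω) [IsProbabilityMeasure P]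
          (m : BatchSizes) (S : ∀ t, Ω → Batch Ξ H (m.A t) (m.A' t) (m.B t)) (ζ : Ω → Fin T),
        IsOnlineRun P μ ν (Lf ^ 2 * lg ^ 2 * σg ^ 2 / ε ^ 2) (lf ^ 2 * σg' ^ 2 / ε ^ 2)
          (lg ^ 2 * σf' ^ 2 / ε ^ 2) b₁ b₂ ⌊lf * lg / ε⌋₊ T m S ζ →
        Integrable (outputNorm f g (fun x => expMean ν f (expMean μ g x)) r
          ⟨ε, ⌊lf * lg / ε⌋₊, lam, fun _ => β, fun _ => α⟩ x0 S ζ) P ∧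
        ∫ ω, outputNorm f g (fun x => expMean ν f (expMean μ g x)) r
          ⟨ε, ⌊lf * lg / ε⌋₊, lam, fun _ => β, fun _ => α⟩ x0 S ζ ω ∂P ≤
          C * (ε / α +
            LF lf Lf lg Lg * gap (objective (expMean ν f) (expMean μ g) r) x0 / (ε * T))) ∧
      -- sample complexity of reaching accuracy `ε`
      (∀ ε : ℝ, 0 < ε → ε ≤ lf * lg →
        ∃ (ε' : ℝ) (T : ℕ), 0 < ε' ∧ ε' ≤ ε ∧ 1 ≤ T ∧
        ∀ (Ω : Type*) [MeasurableSpace Ω] (P : Measure Ω) [IsProbabilityMeasure P]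
          (m : BatchSizes) (S : ∀ t, Ω → Batch Ξ H (m.A t) (m.A' t) (m.B t)) (ζ : Ω → Fin T),
        IsOnlineRun P μ ν (Lf ^ 2 * lg ^ 2 * σg ^ 2 / ε' ^ 2) (lf ^ 2 * σg' ^ 2 / ε' ^ 2)
          (lg ^ 2 * σf' ^ 2 / ε' ^ 2) b₁ b₂ ⌊lf * lg / ε'⌋₊ T m S ζ →
        (Integrable (outputNorm f g (fun x => expMean ν f (expMean μ g x)) r
          ⟨ε', ⌊lf * lg / ε'⌋₊, lam, fun _ => β, fun _ => α⟩ x0 S ζ) P ∧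
        ∫ ω, outputNorm f g (fun x => expMean ν f (expMean μ g x)) r
          ⟨ε', ⌊lf * lg / ε'⌋₊, lam, fun _ => β, fun _ => α⟩ x0 S ζ ω ∂P ≤ ε) ∧
        (evaluations ⌊lf * lg / ε'⌋₊ m T : ℝ) ≤
          C * ((lf ^ 2 * lg ^ 2 + Lf ^ 2 * lg ^ 2 * σg ^ 2 + lf ^ 2 * σg' ^ 2 + lg ^ 2 * σf' ^ 2) *
            (lf * lg +
              LF lf Lf lg Lg * gap (objective (expMean ν f) (expMean μ g) r) x0 / (lf * lg))) /
            ε ^ 3)) := by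
  refine ⟨fun c₁ c₂ b₁ b₂ hc₁ hc₂ hb₁ hb₂ => ?_, fun c₁ c₂ b₁ b₂ hc₁ hc₂ hb₁ hb₂ => ?_⟩
  · set C₀ := rateConst c₁ c₂ b₁
    have hC₀ : 0 < C₀ := rateConst_pos hc₁ hc₂ hb₁
    have hk := shrink_pos hC₀
    have hk1 := shrink_le_one C₀
    set k := shrink C₀
    have hC₁ : 0 < (2 + (12 + 6 * b₂) * (2 + 2 * C₀ / k)) := by positivity
    -- One constant for both claims: `C₀` from the rate and the other summand from
    -- `finiteSum_cost_le` with `C₁ = 2 * C₀ / k`.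
    refine ⟨C₀ + (2 + (12 + 6 * b₂) * (2 + 2 * C₀ / k)), by positivity, ?_⟩
    intro d p N n hN hn f g r lf Lf lg Lg hreg x0 α β lam hα hα1 hβ hβ' hlam
    have hG := hreg.LF_mul_gap_nonneg x0
    have hM : 1 ≤ max N n := hN.trans_le (le_max_left _ _)
    have hτ : 0 < Nat.sqrt (max N n) := Nat.sqrt_pos.2 hM
    have hlt : ∀ ε : ℝ, ε < lf * lg / Real.sqrt (max N n : ℕ) → ε ≤ lf * lg := fun ε h => by
      refine h.le.trans (div_le_self (mul_pos hreg.lf_pos hreg.lg_pos).le ?_)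
      rw [Real.one_le_sqrt]
      exact_mod_cast hM
    refine ⟨?_, ?_⟩
    · intro ε T hε hεM hT Ω _ P _ repl m S ζ hrun
      obtain ⟨h1, h2⟩ := hrun.integral_outputNorm_le (x0 := x0) hN hn hreg hc₁ hb₁ hα hα1 hβ hβ' hlam
        hε (hlt ε hεM) hτ hT
      exact ⟨h1, h2.trans (mul_add_le_mul_div_add hC₀.le (by linarith) hε.le hα hα1
        (by positivity))⟩
    · intro ε hε hεM
      obtain ⟨T, hT1, hT2, hT3⟩ := exists_iterations hC₀ hG hε
      rw [show shrink C₀ = k from rfl] at hT3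
      have hkε : k * ε ≤ ε := mul_le_of_le_one_left hε.le hk1
      -- The accuracy parameter is shrunk by `k`, which depends only on `c₁`, `c₂` and `b₁`, so the
      -- order of the cost is unaffected.
      refine ⟨k * ε, T, by positivity, hkε, hT1, ?_⟩
      intro Ω _ P _ repl m S ζ hrun
      obtain ⟨h1, h2⟩ := hrun.integral_outputNorm_le (x0 := x0) hN hn hreg hc₁ hb₁ hα hα1 hβ hβ' hlam
        (ε := k * ε) (by positivity) (hkε.trans (hlt ε hεM)) hτ hT1
      refine ⟨⟨h1, h2.trans hT2⟩, ?_⟩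
      have h3 := evaluations_le (R := 2 * n + N) (b₂ := b₂) (by positivity) hb₂.le
        (fun t ht hmod => by
          obtain ⟨e1, e2, e3⟩ := hrun.size_reset t ht hmod
          rw [e1, e2, e3]
          linarith)
        (fun t ht hmod => ⟨(hrun.size_inner t ht hmod).1.2, (hrun.size_inner t ht hmod).2.1.2,
          (hrun.size_inner t ht hmod).2.2.2⟩)
      have h4 := finiteSum_cost_le (n := n) hN hb₂ (by positivity) (by positivity) (by positivity) hT3
      refine (h3.trans h4).trans ?_
      rw [mul_div_assoc (Real.sqrt _)]
      exact mul_le_mul_of_nonneg_right (le_add_of_nonneg_left hC₀.le) (by positivity)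
  · set C₀ := rateConst c₁ c₂ b₁
    have hC₀ : 0 < C₀ := rateConst_pos hc₁ hc₂ hb₁
    have hk := shrink_pos hC₀
    have hk1 := shrink_le_one C₀
    set k := shrink C₀
    have hC₁ : 0 < 12 * b₂ / k * (2 + 2 * C₀ / k) + 3 * b₂ / k ^ 2 := by positivity
    -- Again the rate constant plus the cost constant, now from `online_cost_le`; the powers of `1 /
    -- k` come from the period and the batch sizes being set by `k * ε`.
    refine ⟨C₀ + (12 * b₂ / k * (2 + 2 * C₀ / k) + 3 * b₂ / k ^ 2), by positivity, ?_⟩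
    intro d p Ξ H _ _ μ ν _ _ f g r lf Lf lg Lg σg σg' σf' hreg hv x0 α β lam hα hα1 hβ hβ' hlam
    have hG := hreg.LF_mul_gap_nonneg x0
    have hlf := hreg.lf_pos
    have hlg := hreg.lg_pos
    have hτ : ∀ ε : ℝ, 0 < ε → ε ≤ lf * lg → 0 < ⌊lf * lg / ε⌋₊ := fun ε hε h =>
      Nat.floor_pos.2 ((one_le_div hε).2 h)
    refine ⟨?_, ?_⟩
    · intro ε T hε hεM hT Ω _ P _ m S ζ hrun
      obtain ⟨h1, h2⟩ := hrun.integral_outputNorm_le (x0 := x0) hreg hv hc₁ hb₁ hα hα1 hβ hβ' hlam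
        hε hεM (hτ ε hε hεM) hT
      exact ⟨h1, h2.trans (mul_add_le_mul_div_add hC₀.le (by linarith) hε.le hα hα1
        (by positivity))⟩
    · intro ε hε hεM
      obtain ⟨T, hT1, hT2, hT3⟩ := exists_iterations hC₀ hG hε
      rw [show shrink C₀ = k from rfl] at hT3
      have hkε : k * ε ≤ ε := mul_le_of_le_one_left hε.le hk1
      have hkε0 : 0 < k * ε := by positivity
      refine ⟨k * ε, T, hkε0, hkε, hT1, ?_⟩
      intro Ω _ P _ m S ζ hrun
      obtain ⟨h1, h2⟩ := hrun.integral_outputNorm_le (x0 := x0) hreg hv hc₁ hb₁ hα hα1 hβ hβ' hlam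
        hkε0 (hkε.trans hεM) (hτ _ hkε0 (hkε.trans hεM)) hT1
      refine ⟨⟨h1, h2.trans hT2⟩, ?_⟩
      set a := Lf ^ 2 * lg ^ 2 * σg ^ 2 with ha
      set a' := lf ^ 2 * σg' ^ 2 with ha'
      set b := lg ^ 2 * σf' ^ 2 with hb
      have hceil : ∀ x : ℝ, 0 ≤ x → (⌈x / (k * ε) ^ 2⌉₊ : ℝ) ≤ x / (k * ε) ^ 2 + 1 := fun x hx =>
        (Nat.ceil_lt_add_one (by positivity)).le
      have q1 := hceil a (by positivity)
      have q2 := hceil a' (by positivity)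
      have q3 := hceil b (by positivity)
      have h3 := evaluations_le
        (R := b₂ * ((⌈a / (k * ε) ^ 2⌉₊ : ℝ) + ⌈a' / (k * ε) ^ 2⌉₊ + ⌈b / (k * ε) ^ 2⌉₊))
        (b₂ := b₂) (by positivity) hb₂.le
        (fun t ht hmod => by
          obtain ⟨e1, e2, e3⟩ := hrun.size_reset t ht hmod
          linarith [e1.2, e2.2, e3.2])
        (fun t ht hmod => ⟨(hrun.size_inner t ht hmod).1.2, (hrun.size_inner t ht hmod).2.1.2,
          (hrun.size_inner t ht hmod).2.2.2⟩)
      have h4 := online_cost_le (M := lf * lg) (V := a + a' + b)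
        (G := LF lf Lf lg Lg * gap (objective (expMean ν f) (expMean μ g) r) x0) (b₂ := b₂)
        (R := b₂ * ((⌈a / (k * ε) ^ 2⌉₊ : ℝ) + ⌈a' / (k * ε) ^ 2⌉₊ + ⌈b / (k * ε) ^ 2⌉₊))
        (by positivity) hG hε hεM hk hk1 hb₂ (by positivity) (by positivity) hT3 (by positivity)
        (by
          refine mul_le_mul_of_nonneg_left ?_ hb₂.le
          rw [add_div, add_div]
          linarith)
      refine (h3.trans h4).trans ?_
      have e : (lf * lg) ^ 2 + (a + a' + b) = lf ^ 2 * lg ^ 2 + a + a' + b := by ring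
      rw [e]
      exact div_le_div_of_nonneg_right (mul_le_mul_of_nonneg_right
        (le_add_of_nonneg_left hC₀.le) (by positivity)) (by positivity)
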